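/- Let $q$ be an odd prime, let $G$ be a finite $q$-group, and let $\ell\ge 0$ be an integer that is a primitive root modulo $|G|$, i.e. its residue class is a unit generating the group $(\mathbb{Z}/|G|)^\times$. A $G$-Green functor is a Mackey functor for $G$ with values in commutative rings whose restriction and conjugation maps are ring homomorphisms and whose transfers satisfy Frobenius reciprocity; a morphism (isomorphism) of Green functors is a family of ring homomorphisms (isomorphisms), one for each subgroup of $G$, commuting with restrictions, transfers and conjugations. For a subgroup $H\le G$ let $A(H)$ be the Burnside ring (the Grothendieck ring of finite left $H$-sets under disjoint union and product), and let $R\mathbb{Q}(H)$ and $RU(H)$ be the Grothendieck rings of finite-dimensional rational and complex representations of $H$ under direct sum and tensor product. With restriction, induction and conjugation these form $G$-Green functors $\underline{A}$, $\underline{R\mathbb{Q}}$, $\underline{RU}$, with value at $G/H$ the ring $A(H)$, $R\mathbb{Q}(H)$, $RU(H)$ respectively. Sending a finite $H$-set to its rational or complex permutation representation gives morphisms $\underline{A}\to\underline{R\mathbb{Q}}$ and $\underline{A}\to\underline{RU}$, and extension of scalars gives a morphism $\underline{R\mathbb{Q}}\to\underline{RU}$. Let $\underline{J}=\ker(\underline{A}\to\underline{RU})$,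 an ideal of $\underline{A}$, so that $\underline{A}/\underline{J}$ is a Green functor. Let $\psi^\ell:\underline{RU}\to\underline{RU}$ be the $\ell$-th Adams operation (the natural ring endomorphism expressed through exterior powers by Newton's formula; on characters, $\chi_{\psi^\ell x}(h)=\chi_x(h^\ell)$). Since $\ell$ is prime to $|G|$, it is an endomorphism of the Green functor $\underline{RU}$, so $\ker(\psi^\ell-1)$ is a sub-Green functor of $\underline{RU}$. Then there are isomorphisms of Green functors $$\underline{A}/\underline{J}\;\cong\;\underline{R\mathbb{Q}}\;\cong\;\ker\bigl(\psi^\ell-1:\underline{RU}\to\underline{RU}\bigr),$$ where the first is induced by the canonical morphism $\underline{A}\to\underline{R\mathbb{Q}}$, and the second, followed by the inclusion into $\underline{RU}$, is the extension of scalars $\underline{R\mathbb{Q}}\to\underline{RU}$. -/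

import Mathlib

open scoped TensorProduct Pointwise
open Module

universe u v

section CharacterTheory

namespace Representation

variable {k : Type} [Field k] {G : Type u} [Group G]

/-- A representation is the direct sum of two complementary subrepresentations. -/
theorem nonempty_equiv_of_isCompl {V : Type v} [AddCommGroup V] [Module k V]
    {ρ : Representation k G V} (P Q : Subrepresentation ρ) (h : IsCompl P Q) :
    Nonempty ((P.toRepresentation.prod Q.toRepresentation).Equiv ρ) := by
  have h' : IsCompl P.toSubmodule Q.toSubmodule := by
    constructor
    · rw [disjoint_iff]
      have := congrArg Subrepresentation.toSubmodule (disjoint_iff.1 h.1)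
      exact (Subrepresentation.toSubmodule_inf P Q).symm.trans this
    · rw [codisjoint_iff]
      have := congrArg Subrepresentation.toSubmodule (codisjoint_iff.1 h.2)
      exact (Subrepresentation.toSubmodule_sup P Q).symm.trans this
  refine ⟨.mk (Submodule.prodEquivOfIsCompl _ _ h') fun g => ?_⟩
  ext x <;> simp [Subrepresentation.toRepresentation]

theorem char_prod {V W : Type*} [AddCommGroup V] [Module k V] [Module.Finite k V]
    [AddCommGroup W] [Module k W] [Module.Finite k W]
    (ρ : Representation k G V) (σ : Representation k G W) :
    (ρ.prod σ).character = ρ.character + σ.character := by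
  ext g
  exact LinearMap.trace_prodMap' (ρ g) (σ g)

variable [CharZero k] [Finite G]

theorem nonempty_equiv_of_char_eq_aux (n : ℕ) :
    ∀ {V W : Type v} [AddCommGroup V] [Module k V] [Module.Finite k V]
    [AddCommGroup W] [Module k W] [Module.Finite k W]
    (ρ : Representation k G V) (σ : Representation k G W),
    finrank k V = n → ρ.character = σ.character → Nonempty (ρ.Equiv σ) := by
  induction n using Nat.strong_induction_on with
  | _ n ih =>
  intro V W _ _ _ _ _ _ ρ σ hn hχ
  have hdim : finrank k V = finrank k W := by
    have := congrFun hχ 1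
    rw [char_one, char_one] at this
    exact_mod_cast this
  by_cases h0 : n = 0
  · have hV : Subsingleton V := finrank_zero_iff.1 (hn.trans h0)
    have hW : Subsingleton W := finrank_zero_iff.1 (hdim ▸ hn.trans h0)
    exact ⟨.mk (LinearEquiv.ofFinrankEq V W hdim) fun g => by ext; exact Subsingleton.elim _ _⟩
  have : Fintype G := Fintype.ofFinite G
  have : NeZero (Nat.card G : k) := ⟨by exact_mod_cast Nat.card_pos.ne'⟩
  have : Invertible (Nat.card G : k) := invertibleOfNonzero (NeZero.ne _)
  have hhom : finrank k (IntertwiningMap ρ σ) = finrank k (IntertwiningMap ρ ρ) := by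
    have h1 := card_inv_mul_sum_char_mul_char_eq_finrank ρ σ
    have h2 := card_inv_mul_sum_char_mul_char_eq_finrank ρ ρ
    rw [← hχ, h2] at h1
    exact_mod_cast h1.symm
  have hnt : Nontrivial V := finrank_pos_iff (R := k).1 (by omega)
  have hne : ∃ f : IntertwiningMap ρ σ, f ≠ 0 := by
    by_contra! hcon
    have hs : Subsingleton (IntertwiningMap ρ σ) := ⟨fun a b => by rw [hcon a, hcon b]⟩
    have h1 : finrank k (IntertwiningMap ρ ρ) = 0 := by
      rw [← hhom, finrank_zero_iff]; exact hs
    rw [finrank_zero_iff] at h1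
    obtain ⟨v, hv⟩ := exists_ne (0 : V)
    apply hv
    have := Subsingleton.elim (IntertwiningMap.id ρ) 0
    simpa using congrArg (fun f : IntertwiningMap ρ ρ => f v) this
  obtain ⟨f, hf⟩ := hne
  have hc1 : ComplementedLattice (Subrepresentation ρ) :=
    inferInstanceAs (IsSemisimpleRepresentation ρ)
  have hc2 : ComplementedLattice (Subrepresentation σ) :=
    inferInstanceAs (IsSemisimpleRepresentation σ)
  obtain ⟨C, hC⟩ := exists_isCompl f.ker
  obtain ⟨D, hD⟩ := exists_isCompl f.range
  obtain ⟨e1⟩ := nonempty_equiv_of_isCompl _ _ hC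
  obtain ⟨e2⟩ := nonempty_equiv_of_isCompl _ _ hD
  have e3 : Nonempty (C.toRepresentation.Equiv f.range.toRepresentation) := by
    let F : C.toSubmodule →ₗ[k] f.range.toSubmodule :=
      (f.toLinearMap.domRestrict C.toSubmodule).codRestrict _ fun x => ⟨x.1, rfl⟩
    have hker : ∀ x, x ∈ f.ker ↔ f x = 0 := fun x => IntertwiningMap.mem_ker _ _ f x
    have hF : Function.Bijective F := by
      constructor
      · rw [← LinearMap.ker_eq_bot, LinearMap.ker_eq_bot']
        intro x hx
        have hx' : x.1 ∈ f.ker := (hker _).2 (congrArg Subtype.val hx)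
        have : x.1 ∈ f.ker ⊓ C := ⟨hx', x.2⟩
        rw [hC.inf_eq_bot] at this
        exact Subtype.ext this
      · rintro ⟨_, y, rfl⟩
        have hmem : y ∈ (f.ker ⊔ C).toSubmodule := by
          rw [hC.sup_eq_top]
          exact Submodule.mem_top
        rw [Subrepresentation.toSubmodule_sup] at hmem
        obtain ⟨a, ha, b, hb, hab⟩ := Submodule.mem_sup.1 hmem
        refine ⟨⟨b, hb⟩, Subtype.ext ?_⟩
        have : f a = 0 := (hker _).1 ha
        change f b = f y
        rw [← hab, map_add, this, zero_add]
    refine ⟨.mk (LinearEquiv.ofBijective F hF) fun g => ?_⟩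
    ext x
    exact IntertwiningMap.isIntertwining _ _ f g x.1
  obtain ⟨e3⟩ := e3
  have hlt : finrank k f.ker.toSubmodule < n := by
    rw [← hn]
    apply Submodule.finrank_lt
    intro htop
    apply hf
    ext x
    have : x ∈ f.ker.toSubmodule := by rw [htop]; trivial
    exact (IntertwiningMap.mem_ker _ _ f x).1 this
  have hχ' : f.ker.toRepresentation.character = D.toRepresentation.character := by
    have h1 := char_iso e1
    have h2 := char_iso e2
    have h3 := char_iso e3
    rw [char_prod] at h1 h2
    rw [← h3, ← hχ, ← h1, add_comm] at h2
    exact (add_right_cancel h2).symm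
  obtain ⟨e4⟩ := ih _ hlt _ _ rfl hχ'
  refine ⟨e1.symm.trans (Equiv.trans ?_ e2)⟩
  refine .mk ((LinearEquiv.prodCongr e4.toLinearEquiv e3.toLinearEquiv).trans
    (LinearEquiv.prodComm _ _ _)) fun g => ?_
  apply LinearMap.ext
  rintro ⟨a, b⟩
  exact Prod.ext (IntertwiningMap.isIntertwining _ _ e3.toIntertwiningMap g b)
    (IntertwiningMap.isIntertwining _ _ e4.toIntertwiningMap g a)

/-- In characteristic zero, representations of a finite group with the same character are
isomorphic. -/
theorem nonempty_equiv_of_char_eq {V W : Type v} [AddCommGroup V] [Module k V] [Module.Finite k V]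
    [AddCommGroup W] [Module k W] [Module.Finite k W]
    (ρ : Representation k G V) (σ : Representation k G W)
    (h : ρ.character = σ.character) : Nonempty (ρ.Equiv σ) :=
  nonempty_equiv_of_char_eq_aux _ ρ σ rfl h

end Representation

end CharacterTheory
section TraceFormulas

open scoped MonoidAlgebra

namespace Representation

variable {k : Type} [Field k]

open Classical in
theorem trace_mapDomain {X : Type*} [Fintype X] (f : X → X) :
    LinearMap.trace k k[X] (MonoidAlgebra.mapDomainLinearMap k k f) =
      ∑ x : X, if f x = x then (1 : k) else 0 := by
  let b : Basis X k k[X] := Basis.ofRepr (MonoidAlgebra.coeffLinearEquiv k)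
  have hb : ∀ x, b x = MonoidAlgebra.single x 1 := fun x => by
    apply b.repr.injective
    rw [Basis.repr_self]
    rfl
  rw [LinearMap.trace_eq_matrix_trace k b, Matrix.trace]
  refine Finset.sum_congr rfl fun x _ => ?_
  rw [Matrix.diag_apply, LinearMap.toMatrix_apply, hb]
  have : (MonoidAlgebra.mapDomainLinearMap k k f) (MonoidAlgebra.single x 1) = b (f x) := by
    rw [hb]; simp
  rw [this, Basis.repr_self, Finsupp.single_apply]

variable {G : Type*} [Group G]

open Classical in
theorem char_ofMulAction {X : Type*} [MulAction G X] [Fintype X] (g : G) :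
    (ofMulAction k G X).character g = ∑ x : X, if g • x = x then (1 : k) else 0 := by
  rw [character, ofMulAction_def]
  exact trace_mapDomain _

/-- The trace on coinvariants of an operator commuting with the action of a finite group. -/
theorem trace_coinvariants [CharZero k] [Fintype G] {W : Type*} [AddCommGroup W] [Module k W]
    [Module.Finite k W] (τ : Representation k G W) (T : W →ₗ[k] W)
    (T' : Coinvariants τ →ₗ[k] Coinvariants τ)
    (h : T' ∘ₗ Coinvariants.mk τ = Coinvariants.mk τ ∘ₗ T) :
    LinearMap.trace k _ T' =
      (Fintype.card G : k)⁻¹ * ∑ g : G, LinearMap.trace k _ (T ∘ₗ τ g) := by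
  have hc : (Fintype.card G : k) ≠ 0 := by exact_mod_cast Fintype.card_ne_zero
  let avg : W →ₗ[k] W := (Fintype.card G : k)⁻¹ • ∑ g : G, τ g
  let s : Coinvariants τ →ₗ[k] W := Coinvariants.lift τ avg fun g => by
    ext w
    simp only [avg, LinearMap.comp_apply, LinearMap.smul_apply, LinearMap.sum_apply]
    congr 1
    refine Fintype.sum_equiv (Equiv.mulRight g) _ _ fun x => ?_
    simp [map_mul]
  have hs : s ∘ₗ Coinvariants.mk τ = avg := Coinvariants.lift_comp_mk _ _ _
  have hπ : Coinvariants.mk τ ∘ₗ s = LinearMap.id := by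
    apply Coinvariants.hom_ext
    rw [LinearMap.comp_assoc, hs]
    ext w
    simp only [avg, LinearMap.comp_apply, LinearMap.smul_apply, LinearMap.sum_apply, map_smul,
      map_sum, Coinvariants.mk_self_apply]
    simp [← Nat.cast_smul_eq_nsmul k, smul_smul]
  calc LinearMap.trace k _ T'
      = LinearMap.trace k _ ((T' ∘ₗ Coinvariants.mk τ) ∘ₗ s) := by
        rw [LinearMap.comp_assoc, hπ, LinearMap.comp_id]
    _ = LinearMap.trace k _ (Coinvariants.mk τ ∘ₗ (T ∘ₗ s)) := by rw [h, LinearMap.comp_assoc]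
    _ = LinearMap.trace k _ (T ∘ₗ avg) := by
        rw [LinearMap.trace_comp_comm', LinearMap.comp_assoc, hs]
    _ = _ := by
        have : T ∘ₗ avg = (Fintype.card G : k)⁻¹ • ∑ g : G, T ∘ₗ τ g := by
          ext w
          simp [avg]
        rw [this, map_smul, map_sum, smul_eq_mul]

open Classical in
/-- The character of an induced representation. -/
theorem char_ind [CharZero k] {H : Type*} [Group H] [Fintype G] [Fintype H] (φ : G →* H)
    {A : Type*} [AddCommGroup A] [Module k A] [Module.Finite k A] (ρ : Representation k G A)
    (h : H) :
    (ind φ ρ).character h = (Fintype.card G : k)⁻¹ *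
      ∑ g : G, ∑ x : H, if φ g * x = x * h then ρ.character g else 0 := by
  rw [character, trace_coinvariants _
    ((MonoidAlgebra.mapDomainLinearMap k k fun x : H => x * h⁻¹).rTensor A) _ (by ext; simp)]
  congr 1
  refine Finset.sum_congr rfl fun g _ => ?_
  have : (MonoidAlgebra.mapDomainLinearMap k k fun x : H => x * h⁻¹).rTensor A ∘ₗ
      (tprod ((leftRegular k H).comp φ) ρ) g =
      TensorProduct.map (MonoidAlgebra.mapDomainLinearMap k k fun x : H => φ g * x * h⁻¹) (ρ g) := by
    ext; simp
  rw [this, LinearMap.trace_tensorProduct', trace_mapDomain, Finset.sum_mul]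
  refine Finset.sum_congr rfl fun x _ => ?_
  simp only [ite_mul, one_mul, zero_mul, mul_inv_eq_iff_eq_mul]
  rfl

/-- The exterior power of a representation. -/
noncomputable def extPower {V : Type*} [AddCommGroup V] [Module k V] (n : ℕ)
    (ρ : Representation k G V) : Representation k G (⋀[k]^n V) where
  toFun g := exteriorPower.map n (ρ g)
  map_one' := by rw [map_one]; exact exteriorPower.map_id
  map_mul' g h := by rw [map_mul]; exact exteriorPower.map_comp _ _

open Classical in
theorem trace_extPower {V : Type*} [AddCommGroup V] [Module k V] {d : ℕ}
    (b : Basis (Fin d) k V) (f : V →ₗ[k] V) (μ : Fin d → k) (hf : ∀ i, f (b i) = μ i • b i)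
    (n : ℕ) :
    LinearMap.trace k (⋀[k]^n V) (exteriorPower.map n f) =
      MvPolynomial.aeval μ (MvPolynomial.esymm (Fin d) k n) := by
  have key : ∀ s : Set.powersetCard (Fin d) n,
      exteriorPower.map n f (b.exteriorPower n s) =
        (∏ i ∈ (s : Finset (Fin d)), μ i) • b.exteriorPower n s := by
    intro s
    rw [exteriorPower.basis_apply, exteriorPower.ιMulti_family, exteriorPower.map_apply_ιMulti]
    have h1 : f ∘ b ∘ (Set.powersetCard.ofFinEmbEquiv.symm s) =
        fun i => μ (Set.powersetCard.ofFinEmbEquiv.symm s i) •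
          (b ∘ (Set.powersetCard.ofFinEmbEquiv.symm s)) i := by
      funext i
      exact hf _
    rw [h1]
    rw [AlternatingMap.map_smul_univ]
    congr 1
    have h2 : (s : Finset (Fin d)) = Finset.univ.map
        (Set.powersetCard.ofFinEmbEquiv.symm s).toEmbedding := by
      ext i
      simp only [Finset.mem_map, Finset.mem_univ, true_and]
      exact (Set.powersetCard.mem_range_ofFinEmbEquiv_symm_iff_mem s i).symm
    rw [h2, Finset.prod_map]
    rfl
  rw [LinearMap.trace_eq_matrix_trace k (b.exteriorPower n), Matrix.trace]
  rw [MvPolynomial.esymm, map_sum, Finset.sum_subtype (p := (· ∈ Set.powersetCard (Fin d) n)) _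
    (fun _ => Finset.mem_powersetCard_univ)]
  refine Finset.sum_congr rfl fun s _ => ?_
  rw [Matrix.diag_apply, LinearMap.toMatrix_apply, key, map_smul, Basis.repr_self]
  simp [map_prod]

/-- An operator of finite order on a complex vector space is diagonalizable. -/
theorem exists_eigenbasis {V : Type*} [AddCommGroup V] [Module ℂ V] [Module.Finite ℂ V]
    (f : End ℂ V) (N : ℕ) (hN : N ≠ 0) (hf : f ^ N = 1) :
    ∃ (d : ℕ) (b : Basis (Fin d) ℂ V) (μ : Fin d → ℂ), ∀ i, f (b i) = μ i • b i := by
  have hss : f.IsSemisimple := by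
    apply Module.End.isSemisimple_of_squarefree_aeval_eq_zero (p := Polynomial.X ^ N - 1)
    · exact (Polynomial.X_pow_sub_one_separable_iff.2 (by exact_mod_cast hN)).squarefree
    · simp [hf]
  have htop := hss.iSup_eigenspace_eq_top
  classical
  have hint : DirectSum.IsInternal f.eigenspace :=
    DirectSum.isInternal_submodule_of_iSupIndep_of_iSup_eq_top f.eigenspaces_iSupIndep htop
  let B := hint.collectedBasis fun μ => Module.finBasis ℂ (f.eigenspace μ)
  have hB : ∀ i, f (B i) = i.1 • B i := fun i =>
    Module.End.mem_eigenspace_iff.1 (hint.collectedBasis_mem _ i)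
  have : Fintype (Σ μ : ℂ, Fin (finrank ℂ (f.eigenspace μ))) := FiniteDimensional.fintypeBasisIndex B
  let e := Fintype.equivFin (Σ μ : ℂ, Fin (finrank ℂ (f.eigenspace μ)))
  exact ⟨_, B.reindex e, fun i => (e.symm i).1, fun i => by simpa using hB (e.symm i)⟩

theorem psum_newton (d n : ℕ) (μ : Fin d → ℂ) :
    MvPolynomial.aeval μ (MvPolynomial.psum (Fin d) ℂ (n + 1)) =
      (-1) ^ n * (n + 1 : ℕ) * MvPolynomial.aeval μ (MvPolynomial.esymm (Fin d) ℂ (n + 1)) -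
      ∑ i : Fin n, (-1) ^ (i.1 + 1) *
        MvPolynomial.aeval μ (MvPolynomial.esymm (Fin d) ℂ (i.1 + 1)) *
        MvPolynomial.aeval μ (MvPolynomial.psum (Fin d) ℂ (n - i.1)) := by
  rw [MvPolynomial.psum_eq_mul_esymm_sub_sum _ _ (n + 1) n.succ_pos]
  simp only [map_sub, map_mul, map_pow, map_neg, map_one, map_natCast, map_sum]
  congr 1
  · ring
  · symm
    refine Finset.sum_bij (fun i _ => (i.1 + 1, n - i.1)) ?_ ?_ ?_ ?_
    · intro i _
      have := i.2
      simp only [Finset.mem_filter, Finset.HasAntidiagonal.mem_antidiagonal, Set.mem_Ioo]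
      omega
    · intro i _ j _ h
      ext
      simpa using congrArg Prod.fst h
    · rintro ⟨a, c⟩ h
      simp only [Finset.mem_filter, Finset.HasAntidiagonal.mem_antidiagonal, Set.mem_Ioo] at h
      refine ⟨⟨a - 1, by omega⟩, Finset.mem_univ _, ?_⟩
      ext <;> simp <;> omega
    · intro i _
      rfl

theorem trace_pow_eq_psum {V : Type*} [AddCommGroup V] [Module ℂ V] {d : ℕ}
    (b : Basis (Fin d) ℂ V) (f : End ℂ V) (μ : Fin d → ℂ) (hf : ∀ i, f (b i) = μ i • b i)
    (n : ℕ) :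
    LinearMap.trace ℂ V (f ^ n) = MvPolynomial.aeval μ (MvPolynomial.psum (Fin d) ℂ n) := by
  have key : ∀ i, (f ^ n) (b i) = μ i ^ n • b i := by
    intro i
    induction n with
    | zero => simp
    | succ n ih => rw [pow_succ', Module.End.mul_apply, ih, map_smul, hf, smul_smul, pow_succ]
  rw [LinearMap.trace_eq_matrix_trace ℂ b, Matrix.trace, MvPolynomial.psum, map_sum]
  refine Finset.sum_congr rfl fun i _ => ?_
  rw [Matrix.diag_apply, LinearMap.toMatrix_apply, key, map_smul, Basis.repr_self]
  simp

end Representation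

end TraceFormulas
section GrothendieckRing

variable {S : Type*} [CommSemiring S]

variable (S) in
/-- The Grothendieck ring of a commutative semiring: the Grothendieck group of its additive
monoid, with the multiplication that extends the one of the semiring. -/
def GrothendieckRing : Type _ := Algebra.GrothendieckAddGroup S

namespace GrothendieckRing

noncomputable instance : AddCommGroup (GrothendieckRing S) :=
  inferInstanceAs (AddCommGroup (Algebra.GrothendieckAddGroup S))

/-- The class of an element of the semiring. -/
noncomputable def of : S →+ GrothendieckRing S := Algebra.GrothendieckAddGroup.of

/-- Extension of an additive map to the Grothendieck group. -/
noncomputable def lift {B : Type*} [AddCommGroup B] (f : S →+ B) : GrothendieckRing S →+ B :=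
  Algebra.GrothendieckAddGroup.lift f

theorem lift_of {B : Type*} [AddCommGroup B] (f : S →+ B) (a : S) : lift f (of a) = f a :=
  DFunLike.congr_fun (Algebra.GrothendieckAddGroup.lift.symm_apply_apply f) a

theorem exists_sub_aux (x : Algebra.GrothendieckAddGroup S) :
    ∃ a b : S, x = Algebra.GrothendieckAddGroup.of a - Algebra.GrothendieckAddGroup.of b := by
  induction x using AddLocalization.ind with
  | _ y =>
    obtain ⟨a, b⟩ := y
    refine ⟨a, b.1, eq_sub_iff_add_eq.2 ?_⟩
    change AddLocalization.mk a b + AddLocalization.mk b.1 0 = AddLocalization.mk a 0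
    rw [AddLocalization.mk_add, AddLocalization.mk_eq_mk_iff, AddLocalization.r_iff_exists]
    exact ⟨0, by simp [add_comm]⟩

theorem exists_sub (x : GrothendieckRing S) : ∃ a b : S, x = of a - of b := exists_sub_aux x

theorem hom_ext {B : Type*} [AddCommGroup B] {f g : GrothendieckRing S →+ B}
    (h : ∀ a, f (of a) = g (of a)) : f = g := by
  ext x
  obtain ⟨a, b, rfl⟩ := exists_sub x
  rw [map_sub, map_sub, h, h]

/-- The multiplication of the Grothendieck ring. -/
noncomputable def mulHom : GrothendieckRing S →+ GrothendieckRing S →+ GrothendieckRing S :=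
  lift
    { toFun a := lift (of.comp (AddMonoidHom.mulLeft a))
      map_zero' := hom_ext fun b => by simp [lift_of]
      map_add' a a' := hom_ext fun b => by simp [lift_of, add_mul] }

noncomputable instance : Mul (GrothendieckRing S) := ⟨fun x y => mulHom x y⟩

noncomputable instance : One (GrothendieckRing S) := ⟨of 1⟩

theorem mul_def (x y : GrothendieckRing S) : x * y = mulHom x y := rfl

theorem of_one : of (1 : S) = 1 := rfl

theorem of_mul (a b : S) : of (a * b) = of a * of b := by
  simp [mul_def, mulHom, lift_of]

noncomputable instance : CommRing (GrothendieckRing S) where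
  __ := (inferInstance : AddCommGroup (GrothendieckRing S))
  left_distrib x y z := by simp [mul_def]
  right_distrib x y z := by simp [mul_def]
  zero_mul x := by simp [mul_def]
  mul_zero x := by simp [mul_def]
  mul_assoc x y z := by
    obtain ⟨a, a', rfl⟩ := exists_sub x
    obtain ⟨b, b', rfl⟩ := exists_sub y
    obtain ⟨c, c', rfl⟩ := exists_sub z
    simp only [mul_def, map_sub, AddMonoidHom.sub_apply]
    simp only [← mul_def, ← of_mul, mul_assoc]
  mul_comm x y := by
    obtain ⟨a, a', rfl⟩ := exists_sub x
    obtain ⟨b, b', rfl⟩ := exists_sub y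
    simp only [mul_def, map_sub, AddMonoidHom.sub_apply]
    simp only [← mul_def, ← of_mul, mul_comm]
    abel
  one_mul x := by
    obtain ⟨a, a', rfl⟩ := exists_sub x
    simp only [mul_def, map_sub]
    simp only [← mul_def, ← of_one, ← of_mul, one_mul]
  mul_one x := by
    obtain ⟨a, a', rfl⟩ := exists_sub x
    simp only [mul_def, map_sub, AddMonoidHom.sub_apply]
    simp only [← mul_def, ← of_one, ← of_mul, mul_one]

/-- Extension of a semiring homomorphism to the Grothendieck ring. -/
noncomputable def liftRing {B : Type*} [CommRing B] (f : S →+* B) : GrothendieckRing S →+* B where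
  __ := lift f.toAddMonoidHom
  map_one' := (lift_of f.toAddMonoidHom 1).trans (map_one f)
  map_mul' x y := by
    obtain ⟨a, a', rfl⟩ := exists_sub x
    obtain ⟨b, b', rfl⟩ := exists_sub y
    have h : ∀ c, lift f.toAddMonoidHom (of c) = f c := lift_of _
    simp only [ZeroHom.toFun_eq_coe, AddMonoidHom.toZeroHom_coe]
    rw [mul_sub, sub_mul, sub_mul]
    simp only [← of_mul, map_sub, h, map_mul]
    ring

theorem liftRing_of {B : Type*} [CommRing B] (f : S →+* B) (a : S) : liftRing f (of a) = f a :=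
  lift_of f.toAddMonoidHom a

variable {S' : Type*} [CommSemiring S']

/-- The class map as a semiring homomorphism. -/
noncomputable def ofHom : S →+* GrothendieckRing S where
  __ := of
  map_one' := of_one
  map_mul' := of_mul

/-- Functoriality for additive maps. -/
noncomputable def mapAdd (f : S →+ S') : GrothendieckRing S →+ GrothendieckRing S' :=
  lift (of.comp f)

theorem mapAdd_of (f : S →+ S') (a : S) : mapAdd f (of a) = of (f a) := lift_of _ a

/-- Functoriality for semiring homomorphisms. -/
noncomputable def mapRing (f : S →+* S') : GrothendieckRing S →+* GrothendieckRing S' :=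
  liftRing (ofHom.comp f)

theorem mapRing_of (f : S →+* S') (a : S) : mapRing f (of a) = of (f a) := liftRing_of _ a

end GrothendieckRing

end GrothendieckRing

section GreenFunctors

/-- A Green functor for a group `G`: a Mackey functor given by its values on the subgroups `H`
of `G` (that is, on the orbits `G/H`), with values in commutative rings, such that restrictions
and conjugations are ring homomorphisms and transfers satisfy Frobenius reciprocity.
The conjugation by `g` goes from the value at `H` to the value at `K` whenever `K = gHg⁻¹`, and
the double coset formula is required for every finite system `T` of representatives of the double
cosets `L \ H / K`. -/
structure GreenFunctor (G : Type u) [Group G] where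
  obj : Subgroup G → Type v
  [commRing : ∀ H, CommRing (obj H)]
  res : ∀ {K H : Subgroup G}, K ≤ H → obj H →+* obj K
  tr : ∀ {K H : Subgroup G}, K ≤ H → obj K →+ obj H
  conj : ∀ (g : G) {H K : Subgroup G}, K = MulAut.conj g • H → obj H →+* obj K
  res_refl : ∀ {H : Subgroup G} (h : H ≤ H) (x : obj H), res h x = x
  res_res : ∀ {L K H : Subgroup G} (hLK : L ≤ K) (hKH : K ≤ H) (x : obj H),
    res hLK (res hKH x) = res (hLK.trans hKH) x
  tr_refl : ∀ {H : Subgroup G} (h : H ≤ H) (x : obj H), tr h x = x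
  tr_tr : ∀ {L K H : Subgroup G} (hLK : L ≤ K) (hKH : K ≤ H) (x : obj L),
    tr hKH (tr hLK x) = tr (hLK.trans hKH) x
  conj_mem : ∀ {H : Subgroup G} (g : G) (e : H = MulAut.conj g • H) (x : obj H),
    g ∈ H → conj g e x = x
  conj_conj : ∀ (g g' : G) {H K L : Subgroup G} (e : K = MulAut.conj g • H)
    (e' : L = MulAut.conj g' • K) (e'' : L = MulAut.conj (g' * g) • H) (x : obj H),
    conj g' e' (conj g e x) = conj (g' * g) e'' x
  conj_res : ∀ (g : G) {K H K' H' : Subgroup G} (h : K ≤ H) (h' : K' ≤ H')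
    (eK : K' = MulAut.conj g • K) (eH : H' = MulAut.conj g • H) (x : obj H),
    conj g eK (res h x) = res h' (conj g eH x)
  conj_tr : ∀ (g : G) {K H K' H' : Subgroup G} (h : K ≤ H) (h' : K' ≤ H')
    (eK : K' = MulAut.conj g • K) (eH : H' = MulAut.conj g • H) (x : obj K),
    conj g eH (tr h x) = tr h' (conj g eK x)
  mackey : ∀ {K L H : Subgroup G} (hK : K ≤ H) (hL : L ≤ H) (T : Finset G),
    (∀ t ∈ T, t ∈ H) → (∀ h ∈ H, ∃! t, t ∈ T ∧ ∃ l ∈ L, ∃ k ∈ K, h = l * t * k) →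
    ∀ x : obj K, res hL (tr hK x) =
      ∑ t ∈ T, tr (inf_le_left : L ⊓ MulAut.conj t • K ≤ L) (res inf_le_right (conj t rfl x))
  frobenius : ∀ {K H : Subgroup G} (h : K ≤ H) (x : obj H) (y : obj K),
    tr h (res h x * y) = x * tr h y

attribute [instance] GreenFunctor.commRing

namespace GreenFunctor

variable {G : Type u} [Group G]

/-- A morphism of Green functors. -/
structure Hom (M N : GreenFunctor.{u, v} G) where
  app : ∀ H, M.obj H →+* N.obj H
  app_res : ∀ {K H : Subgroup G} (h : K ≤ H) (x : M.obj H), app K (M.res h x) = N.res h (app H x)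
  app_tr : ∀ {K H : Subgroup G} (h : K ≤ H) (x : M.obj K), app H (M.tr h x) = N.tr h (app K x)
  app_conj : ∀ (g : G) {H K : Subgroup G} (e : K = MulAut.conj g • H) (x : M.obj H),
    app K (M.conj g e x) = N.conj g e (app H x)

/-- An isomorphism of Green functors. -/
structure Iso (M N : GreenFunctor.{u, v} G) where
  app : ∀ H, M.obj H ≃+* N.obj H
  app_res : ∀ {K H : Subgroup G} (h : K ≤ H) (x : M.obj H), app K (M.res h x) = N.res h (app H x)
  app_tr : ∀ {K H : Subgroup G} (h : K ≤ H) (x : M.obj K), app H (M.tr h x) = N.tr h (app K x)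
  app_conj : ∀ (g : G) {H K : Subgroup G} (e : K = MulAut.conj g • H) (x : M.obj H),
    app K (M.conj g e x) = N.conj g e (app H x)

/-- An ideal of a Green functor. -/
structure GreenIdeal (M : GreenFunctor.{u, v} G) where
  ideal : ∀ H, Ideal (M.obj H)
  res_mem : ∀ {K H : Subgroup G} (h : K ≤ H) {x : M.obj H}, x ∈ ideal H → M.res h x ∈ ideal K
  tr_mem : ∀ {K H : Subgroup G} (h : K ≤ H) {x : M.obj K}, x ∈ ideal K → M.tr h x ∈ ideal H
  conj_mem : ∀ (g : G) {H K : Subgroup G} (e : K = MulAut.conj g • H) {x : M.obj H},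
    x ∈ ideal H → M.conj g e x ∈ ideal K

/-- The kernel of a morphism of Green functors. -/
def Hom.ker {M N : GreenFunctor.{u, v} G} (f : Hom M N) : GreenIdeal M where
  ideal H := RingHom.ker (f.app H)
  res_mem h x hx := by
    rw [RingHom.mem_ker] at hx ⊢
    rw [f.app_res, hx, map_zero]
  tr_mem h x hx := by
    rw [RingHom.mem_ker] at hx ⊢
    rw [f.app_tr, hx, map_zero]
  conj_mem g H K e x hx := by
    rw [RingHom.mem_ker] at hx ⊢
    rw [f.app_conj, hx, map_zero]

/-- The quotient of a Green functor by an ideal. -/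
def quotient (M : GreenFunctor.{u, v} G) (I : GreenIdeal M) : GreenFunctor.{u, v} G where
  obj H := M.obj H ⧸ I.ideal H
  res {K H} h := Ideal.quotientMap (I.ideal K) (M.res h) fun _ hx => I.res_mem h hx
  tr {K H} h := QuotientAddGroup.map (I.ideal K).toAddSubgroup (I.ideal H).toAddSubgroup (M.tr h)
    fun _ hx => I.tr_mem h hx
  conj g {H K} e := Ideal.quotientMap (I.ideal K) (M.conj g e) fun _ hx => I.conj_mem g e hx
  res_refl h x := by
    obtain ⟨x, rfl⟩ := Ideal.Quotient.mk_surjective x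
    exact congrArg (Ideal.Quotient.mk _) (M.res_refl h x)
  res_res h h' x := by
    obtain ⟨x, rfl⟩ := Ideal.Quotient.mk_surjective x
    exact congrArg (Ideal.Quotient.mk _) (M.res_res h h' x)
  tr_refl h x := by
    obtain ⟨x, rfl⟩ := Ideal.Quotient.mk_surjective x
    exact congrArg (Ideal.Quotient.mk _) (M.tr_refl h x)
  tr_tr h h' x := by
    obtain ⟨x, rfl⟩ := Ideal.Quotient.mk_surjective x
    exact congrArg (Ideal.Quotient.mk _) (M.tr_tr h h' x)
  conj_mem g e x hg := by
    obtain ⟨x, rfl⟩ := Ideal.Quotient.mk_surjective x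
    exact congrArg (Ideal.Quotient.mk _) (M.conj_mem g e x hg)
  conj_conj g g' H K L e e' e'' x := by
    obtain ⟨x, rfl⟩ := Ideal.Quotient.mk_surjective x
    exact congrArg (Ideal.Quotient.mk _) (M.conj_conj g g' e e' e'' x)
  conj_res g K H K' H' h h' eK eH x := by
    obtain ⟨x, rfl⟩ := Ideal.Quotient.mk_surjective x
    exact congrArg (Ideal.Quotient.mk _) (M.conj_res g h h' eK eH x)
  conj_tr g K H K' H' h h' eK eH x := by
    obtain ⟨x, rfl⟩ := Ideal.Quotient.mk_surjective x
    exact congrArg (Ideal.Quotient.mk _) (M.conj_tr g h h' eK eH x)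
  mackey {K L H} hK hL T hT hT' x := by
    obtain ⟨x, rfl⟩ := Ideal.Quotient.mk_surjective x
    refine (congrArg (Ideal.Quotient.mk (I.ideal L)) (M.mackey hK hL T hT hT' x)).trans ?_
    rw [map_sum]
    rfl
  frobenius {K H} h x y := by
    obtain ⟨x, rfl⟩ := Ideal.Quotient.mk_surjective x
    obtain ⟨y, rfl⟩ := Ideal.Quotient.mk_surjective y
    exact congrArg (Ideal.Quotient.mk (I.ideal H)) (M.frobenius h x y)

/-- The projection onto a quotient. -/
def quotientMk (M : GreenFunctor.{u, v} G) (I : GreenIdeal M) : Hom M (M.quotient I) where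
  app H := Ideal.Quotient.mk (I.ideal H)
  app_res _ _ := rfl
  app_tr _ _ := rfl
  app_conj _ _ _ _ _ := rfl

/-- The kernel of the additive map `f - 1` at the subgroup `H`, for a ring endomorphism `f`. -/
def kerSubOneRing {M : GreenFunctor.{u, v} G} (f : Hom M M) (H : Subgroup G) :
    Subring (M.obj H) where
  __ := ((f.app H).toAddMonoidHom - AddMonoidHom.id (M.obj H)).ker
  one_mem' := by
    change f.app H 1 - 1 = 0
    rw [map_one, sub_self]
  mul_mem' {a b} ha hb := by
    change f.app H a - a = 0 at ha
    change f.app H b - b = 0 at hb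
    change f.app H (a * b) - a * b = 0
    rw [map_mul, sub_eq_zero.1 ha, sub_eq_zero.1 hb, sub_self]

theorem mem_kerSubOneRing {M : GreenFunctor.{u, v} G} (f : Hom M M) (H : Subgroup G)
    (x : M.obj H) : x ∈ kerSubOneRing f H ↔ f.app H x = x :=
  (Iff.rfl : _ ↔ f.app H x - x = 0).trans sub_eq_zero

/-- The kernel of `f - 1 : M → M` for an endomorphism `f` of a Green functor `M`, with the
restrictions, transfers and conjugations of `M`. -/
def kerSubOne {M : GreenFunctor.{u, v} G} (f : Hom M M) : GreenFunctor.{u, v} G where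
  obj H := kerSubOneRing f H
  res {K H} h := (M.res h).restrict _ _ fun x hx => by
    rw [mem_kerSubOneRing] at hx ⊢
    rw [f.app_res, hx]
  tr {K H} h := ((M.tr h).comp (kerSubOneRing f K).subtype.toAddMonoidHom).codRestrict
    (kerSubOneRing f H).toAddSubgroup fun x => by
      have hx := (mem_kerSubOneRing f K _).1 x.2
      refine (mem_kerSubOneRing f H _).2 ?_
      change f.app H (M.tr h x.1) = M.tr h x.1
      rw [f.app_tr, hx]
  conj g {H K} e := (M.conj g e).restrict _ _ fun x hx => by
    rw [mem_kerSubOneRing] at hx ⊢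
    rw [f.app_conj, hx]
  res_refl h x := Subtype.ext (M.res_refl h x.1)
  res_res h h' x := Subtype.ext (M.res_res h h' x.1)
  tr_refl h x := Subtype.ext (M.tr_refl h x.1)
  tr_tr h h' x := Subtype.ext (M.tr_tr h h' x.1)
  conj_mem g e x hg := Subtype.ext (M.conj_mem g e x.1 hg)
  conj_conj g g' H K L e e' e'' x := Subtype.ext (M.conj_conj g g' e e' e'' x.1)
  conj_res g K H K' H' h h' eK eH x := Subtype.ext (M.conj_res g h h' eK eH x.1)
  conj_tr g K H K' H' h h' eK eH x := Subtype.ext (M.conj_tr g h h' eK eH x.1)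
  mackey {K L H} hK hL T hT hT' x := by
    apply Subtype.ext
    refine (M.mackey hK hL T hT hT' x.1).trans ?_
    rw [AddSubmonoidClass.coe_finsetSum]
    rfl
  frobenius h x y := Subtype.ext (M.frobenius h x.1 y.1)

/-- The inclusion of the kernel of `f - 1`. -/
def kerSubOneIncl {M : GreenFunctor.{u, v} G} (f : Hom M M) : Hom (kerSubOne f) M where
  app H := (kerSubOneRing f H).subtype
  app_res _ _ := rfl
  app_tr _ _ := rfl
  app_conj _ _ _ _ _ := rfl

end GreenFunctor

theorem mem_conj_smul_iff {G : Type u} [Group G] {g x : G} {H : Subgroup G} :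
    x ∈ MulAut.conj g • H ↔ g⁻¹ * x * g ∈ H := by
  rw [Subgroup.mem_pointwise_smul_iff_inv_smul_mem]
  simp [MulAut.smul_def]

/-- The isomorphism `K → H`, `k ↦ g⁻¹kg`, for `K = gHg⁻¹`. -/
def conjEquiv {G : Type u} [Group G] (g : G) {H K : Subgroup G} (e : K = MulAut.conj g • H) :
    K ≃* H where
  toFun k := ⟨g⁻¹ * k * g, mem_conj_smul_iff.1 (e ▸ k.2)⟩
  invFun h := ⟨g * h * g⁻¹, by
    subst e
    rw [mem_conj_smul_iff]
    simp [mul_assoc]⟩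
  left_inv k := Subtype.ext (by simp [mul_assoc])
  right_inv h := Subtype.ext (by simp [mul_assoc])
  map_mul' k k' := Subtype.ext (by simp [mul_assoc])

/-- A Green functor from a pullback and a pushforward along all homomorphisms between subgroups:
restriction and conjugation are the pullbacks along inclusions and along `k ↦ g⁻¹kg`, transfer is
the pushforward along inclusions. -/
def GreenFunctor.ofPullPush {G : Type u} [Group G] (R : Subgroup G → Type v)
    [∀ H, CommRing (R H)] (pull : ∀ {K H : Subgroup G}, (K →* H) → R H →+* R K)
    (push : ∀ {K H : Subgroup G}, (K →* H) → R K →+ R H)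
    (pull_inner : ∀ {H : Subgroup G} (φ : H →* H) (g : H), (∀ h, φ h = g⁻¹ * h * g) →
      ∀ x : R H, pull φ x = x)
    (pull_pull : ∀ {L K H : Subgroup G} (φ : K →* H) (ψ : L →* K) (x : R H),
      pull ψ (pull φ x) = pull (φ.comp ψ) x)
    (push_push : ∀ {L K H : Subgroup G} (φ : K →* H) (ψ : H →* L) (x : R K),
      push ψ (push φ x) = push (ψ.comp φ) x)
    (push_mulEquiv : ∀ {K H : Subgroup G} (e : K ≃* H) (x : R K),
      push e.toMonoidHom x = pull e.symm.toMonoidHom x)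
    (push_mul : ∀ {K H : Subgroup G} (φ : K →* H) (y : R H) (x : R K),
      push φ (pull φ y * x) = y * push φ x)
    (pull_push : ∀ {K L H : Subgroup G} (hK : K ≤ H) (hL : L ≤ H) (T : Finset G),
      (∀ t ∈ T, t ∈ H) → (∀ h ∈ H, ∃! t, t ∈ T ∧ ∃ l ∈ L, ∃ k ∈ K, h = l * t * k) →
      ∀ x : R K, pull (Subgroup.inclusion hL) (push (Subgroup.inclusion hK) x) =
        ∑ t ∈ T, push (Subgroup.inclusion (inf_le_left : L ⊓ MulAut.conj t • K ≤ L))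
          (pull ((conjEquiv t rfl).toMonoidHom.comp (Subgroup.inclusion inf_le_right)) x)) :
    GreenFunctor.{u, v} G where
  obj := R
  res h := pull (Subgroup.inclusion h)
  tr h := push (Subgroup.inclusion h)
  conj g _ _ e := pull (conjEquiv g e).toMonoidHom
  res_refl h x := pull_inner _ 1 (fun h => by simp only [inv_one, one_mul, mul_one]; rfl) x
  res_res h h' x := pull_pull _ _ x
  tr_refl {H} h x := (push_mulEquiv (MulEquiv.refl H) x).trans
    (pull_inner _ 1 (fun h => by simp) x)
  tr_tr h h' x := push_push _ _ x
  conj_mem g e x hg := pull_inner _ ⟨g, hg⟩ (fun h => rfl) x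
  conj_conj g g' H K L e e' e'' x := by
    rw [pull_pull]
    congr 2
    ext x
    simp [conjEquiv, mul_assoc]
  conj_res g K H K' H' h h' eK eH x := by
    rw [pull_pull, pull_pull]
    rfl
  conj_tr g K H K' H' h h' eK eH x := by
    have h1 := push_mulEquiv (conjEquiv g eH).symm (push (Subgroup.inclusion h) x)
    have h2 := push_mulEquiv (conjEquiv g eK).symm x
    rw [MulEquiv.symm_symm] at h1 h2
    rw [← h1, ← h2, push_push, push_push]
    rfl
  mackey hK hL T hT hT' x := by
    refine (pull_push hK hL T hT hT' x).trans (Finset.sum_congr rfl fun t _ => ?_)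
    rw [pull_pull]
  frobenius h x y := push_mul _ _ _

end GreenFunctors
section Burnside

/-- A finite set with a left action of the group `H`. -/
structure FinGSet (H : Type u) [Group H] where
  carrier : Type u
  [action : MulAction H carrier]
  [finite : Finite carrier]

attribute [instance] FinGSet.action FinGSet.finite

namespace FinGSet

variable {H K L : Type u} [Group H] [Group K] [Group L]

/-- Isomorphism of finite `H`-sets. -/
instance setoid (H : Type u) [Group H] : Setoid (FinGSet H) where
  r X Y := ∃ e : X.carrier ≃ Y.carrier, ∀ (h : H) (x : X.carrier), e (h • x) = h • e x
  iseqv :=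
    { refl X := ⟨Equiv.refl _, fun _ _ => rfl⟩
      symm := fun ⟨e, he⟩ => ⟨e.symm, fun h x => e.injective (by simp [he])⟩
      trans := fun ⟨e, he⟩ ⟨f, hf⟩ => ⟨e.trans f, fun h x => by simp [he, hf]⟩ }

theorem equiv_of_bijective {X Y : FinGSet H} (f : X.carrier → Y.carrier)
    (hf : ∀ (h : H) (x : X.carrier), f (h • x) = h • f x) (hb : Function.Bijective f) : X ≈ Y :=
  ⟨Equiv.ofBijective f hb, hf⟩

/-- The disjoint union. -/
def sum (X Y : FinGSet H) : FinGSet H where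
  carrier := X.carrier ⊕ Y.carrier
  action :=
    { smul h := Sum.map (h • ·) (h • ·)
      one_smul := by rintro (x | x) <;> simp [HSMul.hSMul, SMul.smul] <;> exact one_smul _ _
      mul_smul := by rintro g h (x | x) <;> simp [HSMul.hSMul, SMul.smul] <;> exact mul_smul _ _ _ }

/-- The cartesian product with the diagonal action. -/
def prod (X Y : FinGSet H) : FinGSet H where
  carrier := X.carrier × Y.carrier

/-- The disjoint union of a finite family. -/
def sigma {ι : Type u} [Finite ι] (X : ι → FinGSet H) : FinGSet H where
  carrier := Σ i, (X i).carrier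
  action :=
    { smul h x := ⟨x.1, h • x.2⟩
      one_smul := by rintro ⟨i, x⟩; exact congrArg (Sigma.mk i) (one_smul H x)
      mul_smul := by rintro g h ⟨i, x⟩; exact congrArg (Sigma.mk i) (mul_smul g h x) }

/-- The empty set. -/
def empty (H : Type u) [Group H] : FinGSet H where
  carrier := PEmpty
  action := { smul _ x := x, one_smul _ := rfl, mul_smul _ _ _ := rfl }

/-- The one-point set. -/
def point (H : Type u) [Group H] : FinGSet H where
  carrier := PUnit
  action := { smul _ x := x, one_smul _ := rfl, mul_smul _ _ _ := rfl }

/-- The pullback of an action along a group homomorphism. -/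
def pull (φ : K →* H) (X : FinGSet H) : FinGSet K where
  carrier := X.carrier
  action := MulAction.compHom X.carrier φ

/-- The identification of the underlying set of a pullback. -/
def pull.val (φ : K →* H) (X : FinGSet H) : (X.pull φ).carrier ≃ X.carrier := Equiv.refl _

theorem pull.val_smul (φ : K →* H) (X : FinGSet H) (k : K) (x : (X.pull φ).carrier) :
    pull.val φ X (k • x) = φ k • pull.val φ X x := rfl

/-- The relation `(h * φ k, x) ∼ (h, k • x)` on `H × X`. -/
def pushSetoid (φ : K →* H) (X : FinGSet K) : Setoid (H × X.carrier) where
  r p p' := ∃ k : K, p'.1 = p.1 * φ k⁻¹ ∧ p'.2 = k • p.2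
  iseqv :=
    { refl p := ⟨1, by simp⟩
      symm := by
        rintro ⟨h, x⟩ ⟨h', x'⟩ ⟨k, rfl, rfl⟩
        exact ⟨k⁻¹, by simp⟩
      trans := by
        rintro ⟨h, x⟩ ⟨h', x'⟩ ⟨h'', x''⟩ ⟨k, rfl, rfl⟩ ⟨k', rfl, rfl⟩
        exact ⟨k' * k, by simp [mul_assoc], by simp [mul_smul]⟩ }

/-- The induced set `H ×_K X`. -/
def push [Finite H] (φ : K →* H) (X : FinGSet K) : FinGSet H where
  carrier := Quotient (pushSetoid φ X)
  action :=
    { smul h := Quotient.map (fun p => (h * p.1, p.2)) (by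
        rintro ⟨a, x⟩ ⟨b, y⟩ ⟨k, rfl, rfl⟩
        exact ⟨k, by simp [mul_assoc], rfl⟩)
      one_smul := by
        rintro ⟨p⟩
        exact congrArg (Quotient.mk _) (Prod.ext (one_mul _) rfl)
      mul_smul := by
        rintro g h ⟨p⟩
        exact congrArg (Quotient.mk _) (Prod.ext (mul_assoc _ _ _) rfl) }

/-- The class of `(h, x)` in `H ×_K X`. -/
def push.mk [Finite H] (φ : K →* H) (X : FinGSet K) (h : H) (x : X.carrier) :
    (push φ X).carrier := Quotient.mk (pushSetoid φ X) (h, x)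

theorem push.smul_mk [Finite H] (φ : K →* H) (X : FinGSet K) (g h : H) (x : X.carrier) :
    g • push.mk φ X h x = push.mk φ X (g * h) x := rfl

theorem push.mk_eq [Finite H] (φ : K →* H) (X : FinGSet K) {h h' : H} {x x' : X.carrier} :
    push.mk φ X h x = push.mk φ X h' x' ↔ ∃ k : K, h' = h * φ k⁻¹ ∧ x' = k • x :=
  Quotient.eq (r := pushSetoid φ X)

theorem push.exists_mk [Finite H] (φ : K →* H) (X : FinGSet K) (p : (push φ X).carrier) :
    ∃ h x, p = push.mk φ X h x := by
  obtain ⟨⟨h, x⟩, rfl⟩ := Quotient.exists_rep p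
  exact ⟨h, x, rfl⟩

theorem sum_congr {X X' Y Y' : FinGSet H} : X ≈ X' → Y ≈ Y' → X.sum Y ≈ X'.sum Y' := by
  rintro ⟨e, he⟩ ⟨f, hf⟩
  refine ⟨Equiv.sumCongr e f, ?_⟩
  rintro h (x | x)
  · exact congrArg Sum.inl (he h x)
  · exact congrArg Sum.inr (hf h x)

theorem prod_congr {X X' Y Y' : FinGSet H} : X ≈ X' → Y ≈ Y' → X.prod Y ≈ X'.prod Y' := by
  rintro ⟨e, he⟩ ⟨f, hf⟩
  refine ⟨Equiv.prodCongr e f, ?_⟩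
  rintro h ⟨x, y⟩
  exact Prod.ext (he h x) (hf h y)

theorem pull_congr (φ : K →* H) {X X' : FinGSet H} : X ≈ X' → X.pull φ ≈ X'.pull φ := by
  rintro ⟨e, he⟩
  exact ⟨e, fun k x => he (φ k) x⟩

theorem push_congr [Finite H] (φ : K →* H) {X X' : FinGSet K} :
    X ≈ X' → X.push φ ≈ X'.push φ := by
  rintro ⟨e, he⟩
  refine equiv_of_bijective (X := X.push φ) (Y := X'.push φ)
    (Quotient.map (fun p => (p.1, e p.2)) ?_) ?_ ⟨?_, ?_⟩
  · rintro ⟨a, x⟩ ⟨b, y⟩ ⟨k, rfl, rfl⟩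
    exact ⟨k, rfl, he k x⟩
  · rintro h ⟨p⟩
    rfl
  · intro p p' h
    obtain ⟨a, x, rfl⟩ := push.exists_mk _ _ p
    obtain ⟨b, y, rfl⟩ := push.exists_mk _ _ p'
    obtain ⟨k, h1, h2⟩ := (push.mk_eq φ X').1 h
    exact (push.mk_eq φ X).2 ⟨k, h1, e.injective (by rw [h2, he])⟩
  · intro p
    obtain ⟨a, x, rfl⟩ := push.exists_mk _ _ p
    exact ⟨push.mk φ X a (e.symm x), congrArg (push.mk φ X' a) (e.apply_symm_apply x)⟩

theorem push_sum [Finite H] (φ : K →* H) (X Y : FinGSet K) :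
    (X.sum Y).push φ ≈ (X.push φ).sum (Y.push φ) := by
  refine Setoid.symm (equiv_of_bijective (X := (X.push φ).sum (Y.push φ))
    (Y := (X.sum Y).push φ) (Sum.elim
      (Quotient.map (fun p => (p.1, Sum.inl p.2)) ?_)
      (Quotient.map (fun p => (p.1, Sum.inr p.2)) ?_)) ?_ ⟨?_, ?_⟩)
  · rintro ⟨a, x⟩ ⟨b, y⟩ ⟨k, rfl, rfl⟩
    exact ⟨k, rfl, rfl⟩
  · rintro ⟨a, x⟩ ⟨b, y⟩ ⟨k, rfl, rfl⟩
    exact ⟨k, rfl, rfl⟩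
  · rintro h (p | p)
    · obtain ⟨a, x, rfl⟩ := push.exists_mk _ _ p
      rfl
    · obtain ⟨a, x, rfl⟩ := push.exists_mk _ _ p
      rfl
  · rintro (p | p) (p' | p') h <;>
      obtain ⟨a, x, rfl⟩ := push.exists_mk _ _ p <;>
      obtain ⟨b, y, rfl⟩ := push.exists_mk _ _ p' <;>
      obtain ⟨k, h1, h2⟩ := (push.mk_eq φ (X.sum Y)).1 h
    · exact congrArg Sum.inl ((push.mk_eq φ X).2 ⟨k, h1, Sum.inl_injective h2⟩)
    · cases h2
    · cases h2
    · exact congrArg Sum.inr ((push.mk_eq φ Y).2 ⟨k, h1, Sum.inr_injective h2⟩)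
  · intro p
    obtain ⟨a, x | x, rfl⟩ := push.exists_mk _ _ p
    · exact ⟨Sum.inl (push.mk φ X a x), rfl⟩
    · exact ⟨Sum.inr (push.mk φ Y a x), rfl⟩

theorem push_empty [Finite H] (φ : K →* H) : (empty K).push φ ≈ empty H := by
  refine Setoid.symm (equiv_of_bijective (X := empty H) (Y := (empty K).push φ) PEmpty.elim
    (fun _ x => x.elim) ⟨fun x => x.elim, fun p => ?_⟩)
  obtain ⟨_, x, rfl⟩ := push.exists_mk _ _ p
  exact x.elim

theorem push_push [Finite H] [Finite L] (φ : K →* H) (ψ : H →* L) (X : FinGSet K) :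
    (X.push φ).push ψ ≈ X.push (ψ.comp φ) := by
  refine Setoid.symm (equiv_of_bijective (X := X.push (ψ.comp φ)) (Y := (X.push φ).push ψ)
    (Quotient.lift (fun p => push.mk ψ (X.push φ) p.1 (push.mk φ X 1 p.2)) ?_) ?_ ⟨?_, ?_⟩)
  · rintro ⟨a, x⟩ ⟨b, y⟩ ⟨k, rfl, rfl⟩
    refine (push.mk_eq _ _).2 ⟨φ k, by simp, ?_⟩
    rw [push.smul_mk]
    exact (push.mk_eq _ _).2 ⟨k⁻¹, by simp, by simp⟩
  · rintro h ⟨p⟩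
    rfl
  · intro p p' h
    obtain ⟨a, x, rfl⟩ := push.exists_mk _ _ p
    obtain ⟨b, y, rfl⟩ := push.exists_mk _ _ p'
    obtain ⟨m, h1, h2⟩ := (push.mk_eq _ _).1 h
    rw [push.smul_mk] at h2
    obtain ⟨k, h3, h4⟩ := (push.mk_eq _ _).1 h2
    refine (push.mk_eq _ _).2 ⟨k⁻¹, ?_, ?_⟩
    · have : m = φ k⁻¹ := by
        rw [mul_one] at h3
        rw [h3, one_mul]
      change b = a * ψ (φ k⁻¹⁻¹)
      change b = a * ψ m⁻¹ at h1
      rw [h1, this, map_inv φ k⁻¹]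
    · change x = k • y at h4
      rw [h4, inv_smul_smul]
  · intro p
    obtain ⟨a, q, rfl⟩ := push.exists_mk _ _ p
    obtain ⟨h, x, rfl⟩ := push.exists_mk _ _ q
    refine ⟨push.mk (ψ.comp φ) X (a * ψ h) x, (push.mk_eq _ _).2 ⟨h, by simp, ?_⟩⟩
    rw [push.smul_mk, mul_one]

theorem push_mulEquiv [Finite H] (e : K ≃* H) (X : FinGSet K) :
    X.push e.toMonoidHom ≈ X.pull e.symm.toMonoidHom := by
  let v := pull.val e.symm.toMonoidHom X
  refine Setoid.symm (equiv_of_bijective (X := X.pull e.symm.toMonoidHom)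
    (Y := X.push e.toMonoidHom) (fun x => push.mk e.toMonoidHom X 1 (v x)) ?_ ⟨?_, ?_⟩)
  · intro h x
    rw [push.smul_mk, pull.val_smul]
    exact (push.mk_eq _ _).2 ⟨(e.symm h)⁻¹, by simp, (inv_smul_smul (e.symm h) (v x)).symm⟩
  · intro x y h
    obtain ⟨k, h1, h2⟩ := (push.mk_eq _ _).1 h
    have : k = 1 := by
      have : e k = 1 := by simpa using h1
      simpa using this
    exact v.injective (by rw [h2, this, one_smul])
  · intro p
    obtain ⟨h, x, rfl⟩ := push.exists_mk _ _ p
    refine ⟨v.symm (e.symm h • x), (push.mk_eq _ _).2 ⟨(e.symm h)⁻¹, by simp, ?_⟩⟩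
    rw [Equiv.apply_symm_apply, inv_smul_smul]

theorem push_prod [Finite H] (φ : K →* H) (Y : FinGSet H) (X : FinGSet K) :
    ((Y.pull φ).prod X).push φ ≈ Y.prod (X.push φ) := by
  let v := pull.val φ Y
  refine equiv_of_bijective (X := ((Y.pull φ).prod X).push φ) (Y := Y.prod (X.push φ))
    (Quotient.lift (fun p => ((p.1 • v p.2.1, push.mk φ X p.1 p.2.2) :
      Y.carrier × (X.push φ).carrier)) ?_) ?_ ⟨?_, ?_⟩
  · rintro ⟨a, y, x⟩ ⟨b, y', x'⟩ ⟨k, h1, h2⟩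
    have h3 : y' = k • y := congrArg Prod.fst h2
    have h4 : x' = k • x := congrArg Prod.snd h2
    subst h3 h4
    change b = a * φ k⁻¹ at h1
    subst h1
    refine Prod.ext ?_ ((push.mk_eq _ _).2 ⟨k, rfl, rfl⟩)
    change a • v y = (a * φ k⁻¹) • v (k • y)
    rw [pull.val_smul, smul_smul]
    simp [v]
  · rintro h ⟨a, y, x⟩
    exact Prod.ext (mul_smul h a (v y)) rfl
  · intro p p' h
    obtain ⟨a, ⟨y, x⟩, rfl⟩ := push.exists_mk _ _ p
    obtain ⟨b, ⟨y', x'⟩, rfl⟩ := push.exists_mk _ _ p'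
    obtain ⟨k, h1, h2⟩ := (push.mk_eq _ _).1 (congrArg Prod.snd h)
    have h3 : a • v y = b • v y' := congrArg Prod.fst h
    refine (push.mk_eq _ _).2 ⟨k, h1, Prod.ext (v.injective ?_) h2⟩
    change v y' = φ k • v y
    change b = a * φ k⁻¹ at h1
    rw [h1, mul_smul] at h3
    have h4 := MulAction.injective a h3
    rw [h4, smul_smul]
    simp
  · rintro ⟨y, p⟩
    obtain ⟨a, x, rfl⟩ := push.exists_mk _ _ p
    refine ⟨push.mk φ ((Y.pull φ).prod X) a (v.symm (a⁻¹ • y), x), Prod.ext ?_ rfl⟩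
    change a • v (v.symm (a⁻¹ • y)) = y
    rw [Equiv.apply_symm_apply, smul_inv_smul]

/-- The double coset decomposition of the restriction of an induced set. -/
theorem pull_push {G : Type u} [Group G] [Finite G] {K L H : Subgroup G} (hK : K ≤ H) (hL : L ≤ H)
    (T : Finset G) (hT : ∀ t ∈ T, t ∈ H)
    (hT' : ∀ h ∈ H, ∃! t, t ∈ T ∧ ∃ l ∈ L, ∃ k ∈ K, h = l * t * k)
    (M : G → Subgroup G) (hM : ∀ t, M t ≤ L) (φ : ∀ t, M t →* K)
    (hφ : ∀ t (m : M t), (φ t m : G) = t⁻¹ * m * t)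
    (hMK : ∀ t, ∀ l ∈ L, t⁻¹ * l * t ∈ K → l ∈ M t) (X : FinGSet K) :
    (X.push (Subgroup.inclusion hK)).pull (Subgroup.inclusion hL) ≈
      sigma fun t : T => (X.pull (φ t)).push (Subgroup.inclusion (hM t)) := by
  let v := fun t => pull.val (φ t) X
  let w := pull.val (Subgroup.inclusion hL) (X.push (Subgroup.inclusion hK))
  let F : ∀ t : T, ((X.pull (φ t)).push (Subgroup.inclusion (hM t))).carrier →
      (X.push (Subgroup.inclusion hK)).carrier := fun t =>
    Quotient.lift (fun p => push.mk (Subgroup.inclusion hK) X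
      (Subgroup.inclusion hL p.1 * ⟨t, hT t t.2⟩) (v t p.2)) (by
        rintro ⟨a, x⟩ ⟨b, y⟩ ⟨m, h1, h2⟩
        change b = a * Subgroup.inclusion (hM t) m⁻¹ at h1
        change y = m • x at h2
        subst h1 h2
        refine (push.mk_eq _ _).2 ⟨φ t m, Subtype.ext ?_, pull.val_smul _ _ _ _⟩
        simp [hφ, mul_assoc])
  refine Setoid.symm (equiv_of_bijective
    (X := sigma fun t : T => (X.pull (φ t)).push (Subgroup.inclusion (hM t)))
    (Y := (X.push (Subgroup.inclusion hK)).pull (Subgroup.inclusion hL))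
    (fun p => w.symm (F p.1 p.2)) ?_ ⟨?_, ?_⟩)
  · rintro l ⟨t, p⟩
    obtain ⟨a, x, rfl⟩ := push.exists_mk _ _ p
    apply w.injective
    rw [pull.val_smul]
    refine (push.mk_eq _ _).2 ⟨1, ?_, (one_smul _ _).symm⟩
    simp [mul_assoc]
    rfl
  · rintro ⟨t, p⟩ ⟨t', p'⟩ h
    obtain ⟨a, x, rfl⟩ := push.exists_mk _ _ p
    obtain ⟨b, y, rfl⟩ := push.exists_mk _ _ p'
    obtain ⟨k, h1, h2⟩ := (push.mk_eq _ _).1 (w.symm.injective h)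
    have h1' : (b : G) * t' = a * t * (k : G)⁻¹ := by
      simpa using congrArg Subtype.val h1
    have htt : t = t' := by
      obtain ⟨s, -, hs⟩ := hT' (t : G) (hT t t.2)
      have e1 := hs t ⟨t.2, 1, L.one_mem, 1, K.one_mem, by simp⟩
      have e2 := hs t' ⟨t'.2, (a : G)⁻¹ * b, L.mul_mem (L.inv_mem a.2) b.2, k, k.2, by
        rw [mul_assoc _ (b : G), h1']; group⟩
      exact Subtype.ext (e1.trans e2.symm)
    subst htt
    have hk : (k : G) = (t : G)⁻¹ * ((b : G)⁻¹ * a) * t := by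
      have : (k : G) = ((b : G) * t)⁻¹ * (a * t) := by rw [h1']; group
      rw [this]; group
    have hm : (b : G)⁻¹ * a ∈ M t :=
      hMK t _ (L.mul_mem (L.inv_mem b.2) a.2) (by rw [← hk]; exact k.2)
    refine congrArg (Sigma.mk t) ((push.mk_eq _ _).2 ⟨⟨_, hm⟩, ?_, (v t).injective ?_⟩)
    · apply Subtype.ext
      simp
    · rw [pull.val_smul, h2]
      congr 1
      exact Subtype.ext (by rw [hφ, hk])
  · intro p
    obtain ⟨h, x, hp⟩ := push.exists_mk _ _ (w p)
    obtain ⟨t, ⟨ht, l, hl, k, hk, e⟩, -⟩ := hT' h h.2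
    refine ⟨⟨⟨t, ht⟩, push.mk _ _ ⟨l, hl⟩ ((v t).symm ((⟨k, hk⟩ : K) • x))⟩, w.injective ?_⟩
    rw [hp]
    refine (push.mk_eq _ _).2 ⟨(⟨k, hk⟩ : K)⁻¹, Subtype.ext ?_, ?_⟩
    · simp [e]
    · rw [Equiv.apply_symm_apply, inv_smul_smul]

end FinGSet


/-- The semiring of isomorphism classes of finite `H`-sets, with disjoint union and product. -/
def BurnsideSemiring (H : Type u) [Group H] : Type (u + 1) := Quotient (FinGSet.setoid H)

namespace BurnsideSemiring

variable {H K L : Type u} [Group H] [Group K] [Group L]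

/-- The isomorphism class of a finite `H`-set. -/
def mk (X : FinGSet H) : BurnsideSemiring H := Quotient.mk _ X

theorem sound {X Y : FinGSet H} (h : X ≈ Y) : mk X = mk Y := Quotient.sound h

theorem exists_mk (x : BurnsideSemiring H) : ∃ X, x = mk X := by
  obtain ⟨X, rfl⟩ := Quotient.exists_rep x
  exact ⟨X, rfl⟩

instance : Zero (BurnsideSemiring H) := ⟨mk (.empty H)⟩

instance : One (BurnsideSemiring H) := ⟨mk (.point H)⟩

instance : Add (BurnsideSemiring H) :=
  ⟨Quotient.map₂ FinGSet.sum fun _ _ h _ _ h' => FinGSet.sum_congr h h'⟩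

instance : Mul (BurnsideSemiring H) :=
  ⟨Quotient.map₂ FinGSet.prod fun _ _ h _ _ h' => FinGSet.prod_congr h h'⟩

theorem mk_add (X Y : FinGSet H) : mk X + mk Y = mk (X.sum Y) := rfl

theorem mk_mul (X Y : FinGSet H) : mk X * mk Y = mk (X.prod Y) := rfl

instance : CommSemiring (BurnsideSemiring H) where
  nsmul := nsmulRec
  npow := npowRec
  add_assoc := by
    rintro ⟨X⟩ ⟨Y⟩ ⟨Z⟩
    refine sound (X := (X.sum Y).sum Z) (Y := X.sum (Y.sum Z)) ⟨Equiv.sumAssoc _ _ _, ?_⟩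
    rintro h ((x | x) | x) <;> rfl
  zero_add := by
    rintro ⟨X⟩
    refine sound (X := (FinGSet.empty H).sum X) ⟨Equiv.emptySum PEmpty _, ?_⟩
    rintro h (x | x)
    · exact x.elim
    · rfl
  add_zero := by
    rintro ⟨X⟩
    refine sound (X := X.sum (FinGSet.empty H)) ⟨Equiv.sumEmpty _ PEmpty, ?_⟩
    rintro h (x | x)
    · rfl
    · exact x.elim
  add_comm := by
    rintro ⟨X⟩ ⟨Y⟩
    refine sound (X := X.sum Y) (Y := Y.sum X) ⟨Equiv.sumComm _ _, ?_⟩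
    rintro h (x | x) <;> rfl
  left_distrib := by
    rintro ⟨X⟩ ⟨Y⟩ ⟨Z⟩
    refine sound (X := X.prod (Y.sum Z)) (Y := (X.prod Y).sum (X.prod Z))
      ⟨Equiv.prodSumDistrib _ _ _, ?_⟩
    rintro h ⟨x, (y | y)⟩ <;> rfl
  right_distrib := by
    rintro ⟨X⟩ ⟨Y⟩ ⟨Z⟩
    refine sound (X := (X.sum Y).prod Z) (Y := (X.prod Z).sum (Y.prod Z))
      ⟨Equiv.sumProdDistrib _ _ _, ?_⟩
    rintro h ⟨(y | y), x⟩ <;> rfl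
  zero_mul := by
    rintro ⟨X⟩
    exact sound (X := (FinGSet.empty H).prod X) (Y := FinGSet.empty H)
      ⟨Equiv.pemptyProd _, fun h x => x.1.elim⟩
  mul_zero := by
    rintro ⟨X⟩
    exact sound (X := X.prod (FinGSet.empty H)) (Y := FinGSet.empty H)
      ⟨Equiv.prodPEmpty _, fun h x => x.2.elim⟩
  mul_assoc := by
    rintro ⟨X⟩ ⟨Y⟩ ⟨Z⟩
    exact sound (X := (X.prod Y).prod Z) (Y := X.prod (Y.prod Z))
      ⟨Equiv.prodAssoc _ _ _, fun _ _ => rfl⟩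
  one_mul := by
    rintro ⟨X⟩
    exact sound (X := (FinGSet.point H).prod X) ⟨Equiv.punitProd _, fun _ _ => rfl⟩
  mul_one := by
    rintro ⟨X⟩
    exact sound (X := X.prod (FinGSet.point H)) ⟨Equiv.prodPUnit _, fun _ _ => rfl⟩
  mul_comm := by
    rintro ⟨X⟩ ⟨Y⟩
    exact sound (X := X.prod Y) (Y := Y.prod X) ⟨Equiv.prodComm _ _, fun _ _ => rfl⟩

/-- Pullback along a group homomorphism. -/
def pull (φ : K →* H) : BurnsideSemiring H →+* BurnsideSemiring K where
  toFun := Quotient.map (FinGSet.pull φ) fun _ _ h => FinGSet.pull_congr φ h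
  map_zero' := sound (X := (FinGSet.empty H).pull φ) ⟨Equiv.refl _, fun _ _ => rfl⟩
  map_one' := sound (X := (FinGSet.point H).pull φ) ⟨Equiv.refl _, fun _ _ => rfl⟩
  map_add' := by
    rintro ⟨X⟩ ⟨Y⟩
    refine sound (X := (X.sum Y).pull φ) (Y := (X.pull φ).sum (Y.pull φ)) ⟨Equiv.refl _, ?_⟩
    rintro k (x | x) <;> rfl
  map_mul' := by
    rintro ⟨X⟩ ⟨Y⟩
    exact sound (X := (X.prod Y).pull φ) (Y := (X.pull φ).prod (Y.pull φ))
      ⟨Equiv.refl _, fun _ _ => rfl⟩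

theorem pull_mk (φ : K →* H) (X : FinGSet H) : pull φ (mk X) = mk (X.pull φ) := rfl

/-- Induction along a group homomorphism. -/
def push [Finite H] (φ : K →* H) : BurnsideSemiring K →+ BurnsideSemiring H where
  toFun := Quotient.map (FinGSet.push φ) fun _ _ h => FinGSet.push_congr φ h
  map_zero' := sound (FinGSet.push_empty φ)
  map_add' := by
    rintro ⟨X⟩ ⟨Y⟩
    exact sound (FinGSet.push_sum φ X Y)

theorem push_mk [Finite H] (φ : K →* H) (X : FinGSet K) : push φ (mk X) = mk (X.push φ) := rfl

theorem pull_pull (φ : K →* H) (ψ : L →* K) (x : BurnsideSemiring H) :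
    pull ψ (pull φ x) = pull (φ.comp ψ) x := by
  obtain ⟨X, rfl⟩ := exists_mk x
  exact sound (X := (X.pull φ).pull ψ) (Y := X.pull (φ.comp ψ)) ⟨Equiv.refl _, fun _ _ => rfl⟩

/-- Pullback along an inner automorphism is the identity. -/
theorem pull_inner (φ : H →* H) (g : H) (hφ : ∀ h, φ h = g⁻¹ * h * g) (x : BurnsideSemiring H) :
    pull φ x = x := by
  obtain ⟨X, rfl⟩ := exists_mk x
  let v := FinGSet.pull.val φ X
  refine sound (X := X.pull φ) (Y := X) ⟨v.trans (MulAction.toPerm g), fun h x => ?_⟩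
  change g • v (h • x) = h • g • v x
  rw [FinGSet.pull.val_smul, hφ, smul_smul, smul_smul]
  congr 1
  group

theorem push_push [Finite H] [Finite L] (φ : K →* H) (ψ : H →* L) (x : BurnsideSemiring K) :
    push ψ (push φ x) = push (ψ.comp φ) x := by
  obtain ⟨X, rfl⟩ := exists_mk x
  exact sound (FinGSet.push_push φ ψ X)

theorem push_mulEquiv [Finite H] (e : K ≃* H) (x : BurnsideSemiring K) :
    push e.toMonoidHom x = pull e.symm.toMonoidHom x := by
  obtain ⟨X, rfl⟩ := exists_mk x
  exact sound (FinGSet.push_mulEquiv e X)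

theorem push_mul [Finite H] (φ : K →* H) (y : BurnsideSemiring H) (x : BurnsideSemiring K) :
    push φ (pull φ y * x) = y * push φ x := by
  obtain ⟨X, rfl⟩ := exists_mk x
  obtain ⟨Y, rfl⟩ := exists_mk y
  exact sound (FinGSet.push_prod φ Y X)

theorem sum_mk {ι : Type u} (T : Finset ι) (X : ι → FinGSet H) :
    ∑ t ∈ T, mk (X t) = mk (.sigma fun t : T => X t) := by
  classical
  induction T using Finset.induction_on with
  | empty =>
    rw [Finset.sum_empty]
    refine sound (X := FinGSet.empty H) (Y := .sigma fun t : (∅ : Finset ι) => X t)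
      (FinGSet.equiv_of_bijective PEmpty.elim (fun _ x => x.elim)
        ⟨fun x => x.elim, fun p => ?_⟩)
    exact absurd p.1.2 (Finset.notMem_empty _)
  | insert a T ha ih =>
    rw [Finset.sum_insert ha, ih, mk_add]
    let F : (X a).carrier ⊕ (Σ t : T, (X t).carrier) →
        Σ t : (insert a T : Finset ι), (X t).carrier :=
      Sum.elim (fun x => ⟨⟨a, Finset.mem_insert_self a T⟩, x⟩)
        (fun p => ⟨⟨p.1, Finset.mem_insert_of_mem p.1.2⟩, p.2⟩)
    have hF : Function.Bijective F := by
      constructor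
      · rintro (x | ⟨⟨t, ht⟩, x⟩) (y | ⟨⟨s, hs⟩, y⟩) h
        · simp only [F, Sum.elim_inl, Sigma.mk.injEq, heq_eq_eq, true_and] at h
          rw [h]
        · simp only [F, Sum.elim_inl, Sum.elim_inr, Sigma.mk.injEq, Subtype.mk.injEq] at h
          exact absurd (h.1 ▸ hs) ha
        · simp only [F, Sum.elim_inl, Sum.elim_inr, Sigma.mk.injEq, Subtype.mk.injEq] at h
          exact absurd (h.1 ▸ ht) ha
        · simp only [F, Sum.elim_inr, Sigma.mk.injEq, Subtype.mk.injEq] at h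
          obtain ⟨rfl, h⟩ := h
          rw [eq_of_heq h]
      · rintro ⟨⟨t, ht⟩, x⟩
        rcases Finset.mem_insert.1 ht with rfl | ht'
        · exact ⟨Sum.inl x, rfl⟩
        · exact ⟨Sum.inr ⟨⟨t, ht'⟩, x⟩, rfl⟩
    refine sound (X := (X a).sum (.sigma fun t : T => X t))
      (Y := .sigma fun t : (insert a T : Finset ι) => X t)
      (FinGSet.equiv_of_bijective F ?_ hF)
    rintro h (x | x) <;> rfl

/-- The double coset formula for isomorphism classes of finite sets. -/
theorem pull_push {G : Type u} [Group G] [Finite G] {K L H : Subgroup G} (hK : K ≤ H) (hL : L ≤ H)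
    (T : Finset G) (hT : ∀ t ∈ T, t ∈ H)
    (hT' : ∀ h ∈ H, ∃! t, t ∈ T ∧ ∃ l ∈ L, ∃ k ∈ K, h = l * t * k) (a : BurnsideSemiring K) :
    pull (Subgroup.inclusion hL) (push (Subgroup.inclusion hK) a) =
      ∑ t ∈ T, push (Subgroup.inclusion (inf_le_left : L ⊓ MulAut.conj t • K ≤ L))
        (pull ((conjEquiv t rfl).toMonoidHom.comp (Subgroup.inclusion inf_le_right)) a) := by
  obtain ⟨X, rfl⟩ := BurnsideSemiring.exists_mk a
  let M : G → Subgroup G := fun t => L ⊓ MulAut.conj t • K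
  have hM : ∀ t, M t ≤ L := fun _ => inf_le_left
  let φ : ∀ t, M t →* K := fun t =>
    (conjEquiv t rfl).toMonoidHom.comp (Subgroup.inclusion inf_le_right)
  have key := FinGSet.pull_push hK hL T hT hT' M hM φ (fun _ _ => rfl)
    (fun t l hl h => ⟨hl, mem_conj_smul_iff.2 h⟩) X
  exact (sound key).trans
    (sum_mk T fun t => (X.pull (φ t)).push (Subgroup.inclusion (hM t))).symm

end BurnsideSemiring

/-- The Burnside ring: the Grothendieck ring of finite `H`-sets. -/
abbrev BurnsideRing (H : Type u) [Group H] : Type (u + 1) := GrothendieckRing (BurnsideSemiring H)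

open GrothendieckRing in
/-- The Burnside Green functor `G/H ↦ A(H)`: restriction and conjugation are given by pulling
back the action, and transfer is induction `X ↦ H ×_K X`. -/
noncomputable def burnsideGreen (G : Type u) [Group G] [Finite G] : GreenFunctor.{u, u + 1} G :=
  GreenFunctor.ofPullPush (fun H => BurnsideRing H)
    (fun φ => mapRing (BurnsideSemiring.pull φ))
    (fun φ => mapAdd (BurnsideSemiring.push φ))
    (fun φ g hφ x => by
      obtain ⟨a, b, rfl⟩ := exists_sub x
      simp only [map_sub, mapRing_of, BurnsideSemiring.pull_inner φ g hφ])
    (fun φ ψ x => by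
      obtain ⟨a, b, rfl⟩ := exists_sub x
      simp only [map_sub, mapRing_of, BurnsideSemiring.pull_pull])
    (fun φ ψ x => by
      obtain ⟨a, b, rfl⟩ := exists_sub x
      simp only [map_sub, mapAdd_of, BurnsideSemiring.push_push])
    (fun e x => by
      obtain ⟨a, b, rfl⟩ := exists_sub x
      simp only [map_sub, mapAdd_of, mapRing_of, BurnsideSemiring.push_mulEquiv])
    (fun φ y x => by
      obtain ⟨a, b, rfl⟩ := exists_sub x
      obtain ⟨c, d, rfl⟩ := exists_sub y
      simp only [map_sub, mul_sub, sub_mul, mapRing_of, ← of_mul, mapAdd_of,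
        BurnsideSemiring.push_mul])
    (fun {K L H} hK hL T hT hT' x => by
      obtain ⟨a, b, rfl⟩ := exists_sub x
      simp only [map_sub, mapAdd_of, mapRing_of, BurnsideSemiring.pull_push hK hL T hT hT',
        map_sum, Finset.sum_sub_distrib])

end Burnside
section RepresentationRing

/-- A finite-dimensional representation of the group `H` over the field `k`. -/
structure FinRep (k : Type) [Field k] (H : Type u) [Group H] where
  V : Type u
  [addCommGroup : AddCommGroup V]
  [module : Module k V]
  [finite : Module.Finite k V]
  ρ : Representation k H V

attribute [instance] FinRep.addCommGroup FinRep.module FinRep.finite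

namespace FinRep

variable {k : Type} [Field k] {H K : Type u} [Group H] [Group K]

/-- Isomorphism of representations. -/
instance setoid (k : Type) [Field k] (H : Type u) [Group H] : Setoid (FinRep k H) where
  r V W := Nonempty (V.ρ.Equiv W.ρ)
  iseqv :=
    { refl _ := ⟨.refl _⟩
      symm := fun ⟨e⟩ => ⟨e.symm⟩
      trans := fun ⟨e⟩ ⟨f⟩ => ⟨e.trans f⟩ }

theorem equiv_iff [CharZero k] [Finite H] {V W : FinRep k H} :
    V ≈ W ↔ V.ρ.character = W.ρ.character :=
  ⟨fun ⟨e⟩ => Representation.char_iso e, Representation.nonempty_equiv_of_char_eq _ _⟩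

/-- The zero representation. -/
def zero (k : Type) [Field k] (H : Type u) [Group H] : FinRep k H where
  V := PUnit
  ρ := Representation.trivial k H PUnit.{u + 1}

/-- The trivial one-dimensional representation. -/
def one (k : Type) [Field k] (H : Type u) [Group H] : FinRep k H where
  V := ULift k
  ρ := Representation.trivial k H (ULift k)

/-- The direct sum. -/
noncomputable def add (V W : FinRep k H) : FinRep k H where
  V := V.V × W.V
  ρ := V.ρ.prod W.ρ

/-- The tensor product. -/
noncomputable def mul (V W : FinRep k H) : FinRep k H where
  V := V.V ⊗[k] W.V
  ρ := V.ρ.tprod W.ρ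

/-- The pullback along a group homomorphism. -/
def pull (φ : K →* H) (V : FinRep k H) : FinRep k K where
  V := V.V
  ρ := V.ρ.comp φ

/-- The induced representation. -/
noncomputable def ind [Finite H] (φ : K →* H) (V : FinRep k K) : FinRep k H where
  V := Representation.IndV φ V.ρ
  finite := Module.Finite.of_surjective _ (Representation.Coinvariants.mk_surjective _)
  ρ := Representation.ind φ V.ρ

/-- The exterior power. -/
noncomputable def ext (n : ℕ) (V : FinRep k H) : FinRep k H where
  V := ⋀[k]^n V.V
  ρ := V.ρ.extPower n

/-- The permutation representation of a finite `H`-set. -/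
noncomputable def perm (k : Type) [Field k] (X : FinGSet H) : FinRep k H where
  V := MonoidAlgebra k X.carrier
  finite := Module.Finite.equiv (MonoidAlgebra.coeffLinearEquiv k).symm
  ρ := Representation.ofMulAction k H X.carrier

/-- The extension of scalars. -/
noncomputable def baseChange (k' : Type) [Field k'] [Algebra k k'] (V : FinRep k H) :
    FinRep k' H where
  V := k' ⊗[k] V.V
  ρ :=
    { toFun h := (V.ρ h).baseChange k'
      map_one' := by rw [map_one]; exact LinearMap.baseChange_id
      map_mul' g h := by rw [map_mul]; exact LinearMap.baseChange_comp _ _ }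

end FinRep

/-- The semiring of isomorphism classes of finite-dimensional representations, with direct sum and
tensor product. -/
def RepSemiring (k : Type) [Field k] (H : Type u) [Group H] : Type (u + 1) :=
  Quotient (FinRep.setoid k H)

namespace RepSemiring

variable {k : Type} [Field k] {H K : Type u} [Group H] [Group K]

/-- The isomorphism class of a representation. -/
def mk (V : FinRep k H) : RepSemiring k H := Quotient.mk _ V

theorem exists_mk (x : RepSemiring k H) : ∃ V, x = mk V := by
  obtain ⟨V, rfl⟩ := Quotient.exists_rep x
  exact ⟨V, rfl⟩

/-- The character. -/
noncomputable def char : RepSemiring k H → H → k :=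
  Quotient.lift (fun V => V.ρ.character) fun _ _ ⟨e⟩ => Representation.char_iso e

theorem char_mk (V : FinRep k H) : char (mk V) = V.ρ.character := rfl

variable [CharZero k] [Finite H] [Finite K]

theorem char_injective : Function.Injective (char : RepSemiring k H → H → k) := by
  rintro ⟨V⟩ ⟨W⟩ h
  exact Quotient.sound (FinRep.equiv_iff.2 h)

theorem mk_eq {V W : FinRep k H} (h : V.ρ.character = W.ρ.character) : mk V = mk W :=
  char_injective h

instance : Zero (RepSemiring k H) := ⟨mk (.zero k H)⟩

instance : One (RepSemiring k H) := ⟨mk (.one k H)⟩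

theorem char_add_aux (V W : FinRep k H) :
    (V.add W).ρ.character = V.ρ.character + W.ρ.character := Representation.char_prod _ _

theorem char_mul_aux (V W : FinRep k H) :
    (V.mul W).ρ.character = V.ρ.character * W.ρ.character := Representation.char_tensor _ _

noncomputable instance : Add (RepSemiring k H) :=
  ⟨Quotient.map₂ FinRep.add fun _ _ h _ _ h' => FinRep.equiv_iff.2 (by
    rw [char_add_aux, char_add_aux, FinRep.equiv_iff.1 h, FinRep.equiv_iff.1 h'])⟩

noncomputable instance : Mul (RepSemiring k H) :=
  ⟨Quotient.map₂ FinRep.mul fun _ _ h _ _ h' => FinRep.equiv_iff.2 (by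
    rw [char_mul_aux, char_mul_aux, FinRep.equiv_iff.1 h, FinRep.equiv_iff.1 h'])⟩

theorem mk_add (V W : FinRep k H) : mk V + mk W = mk (V.add W) := rfl

theorem mk_mul (V W : FinRep k H) : mk V * mk W = mk (V.mul W) := rfl

theorem char_zero : char (0 : RepSemiring k H) = 0 := by
  ext h
  change LinearMap.trace k PUnit.{u + 1} LinearMap.id = 0
  rw [LinearMap.trace_id, finrank_zero_of_subsingleton, Nat.cast_zero]

theorem char_one : char (1 : RepSemiring k H) = 1 := by
  ext h
  change LinearMap.trace k (ULift k) LinearMap.id = 1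
  rw [LinearMap.trace_id]
  simp

theorem char_add (x y : RepSemiring k H) : char (x + y) = char x + char y := by
  obtain ⟨V, rfl⟩ := exists_mk x
  obtain ⟨W, rfl⟩ := exists_mk y
  exact char_add_aux V W

theorem char_mul (x y : RepSemiring k H) : char (x * y) = char x * char y := by
  obtain ⟨V, rfl⟩ := exists_mk x
  obtain ⟨W, rfl⟩ := exists_mk y
  exact char_mul_aux V W

noncomputable instance : CommSemiring (RepSemiring k H) where
  nsmul := nsmulRec
  npow := npowRec
  add_assoc x y z := char_injective (by simp only [char_add, add_assoc])
  zero_add x := char_injective (by simp only [char_add, char_zero, zero_add])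
  add_zero x := char_injective (by simp only [char_add, char_zero, add_zero])
  add_comm x y := char_injective (by simp only [char_add, add_comm])
  left_distrib x y z := char_injective (by simp only [char_add, char_mul, mul_add])
  right_distrib x y z := char_injective (by simp only [char_add, char_mul, add_mul])
  zero_mul x := char_injective (by simp only [char_mul, char_zero, zero_mul])
  mul_zero x := char_injective (by simp only [char_mul, char_zero, mul_zero])
  mul_assoc x y z := char_injective (by simp only [char_mul, mul_assoc])
  one_mul x := char_injective (by simp only [char_mul, char_one, one_mul])
  mul_one x := char_injective (by simp only [char_mul, char_one, mul_one])
  mul_comm x y := char_injective (by simp only [char_mul, mul_comm])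

/-- The character as a semiring homomorphism. -/
noncomputable def charHom : RepSemiring k H →+* (H → k) where
  toFun := char
  map_zero' := char_zero
  map_one' := char_one
  map_add' := char_add
  map_mul' := char_mul

theorem char_pull_aux (φ : K →* H) (V : FinRep k H) (g : K) :
    (V.pull φ).ρ.character g = V.ρ.character (φ g) := rfl

/-- Pullback of isomorphism classes along a group homomorphism. -/
noncomputable def pullFun (φ : K →* H) : RepSemiring k H → RepSemiring k K :=
  Quotient.map (FinRep.pull φ) fun _ _ h => FinRep.equiv_iff.2 (by
    ext g
    rw [char_pull_aux, char_pull_aux, FinRep.equiv_iff.1 h])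

theorem char_pullFun (φ : K →* H) (x : RepSemiring k H) (g : K) :
    char (pullFun φ x) g = char x (φ g) := by
  obtain ⟨V, rfl⟩ := exists_mk x
  rfl

/-- Pullback along a group homomorphism. -/
noncomputable def pull (φ : K →* H) : RepSemiring k H →+* RepSemiring k K where
  toFun := pullFun φ
  map_zero' := char_injective (by ext; simp [char_pullFun, char_zero])
  map_one' := char_injective (by ext; simp [char_pullFun, char_one])
  map_add' x y := char_injective (by ext; simp [char_pullFun, char_add])
  map_mul' x y := char_injective (by ext; simp [char_pullFun, char_mul])

theorem char_pull (φ : K →* H) (x : RepSemiring k H) (g : K) :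
    char (pull φ x) g = char x (φ g) := char_pullFun φ x g

end RepSemiring

open Classical in
/-- The formula for an induced character. -/
noncomputable def indChar {k : Type} [Field k] {H K : Type u} [Group H] [Group K] [Finite H]
    [Finite K] (φ : K →* H) : (K → k) →+ (H → k) :=
  letI := Fintype.ofFinite H
  letI := Fintype.ofFinite K
  { toFun f h := (Fintype.card K : k)⁻¹ * ∑ g : K, ∑ x : H, if φ g * x = x * h then f g else 0
    map_zero' := by ext; simp
    map_add' f f' := by
      ext h
      simp only [Pi.add_apply, ← mul_add, ← Finset.sum_add_distrib]
      congr 1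
      refine Finset.sum_congr rfl fun g _ => Finset.sum_congr rfl fun x _ => ?_
      split_ifs <;> simp }

namespace RepSemiring

variable {k : Type} [Field k] {H K : Type u} [Group H] [Group K] [CharZero k] [Finite H] [Finite K]

theorem char_ind_aux (φ : K →* H) (V : FinRep k K) :
    (V.ind φ).ρ.character = indChar φ V.ρ.character := by
  let _ := Fintype.ofFinite H
  let _ := Fintype.ofFinite K
  ext h
  exact Representation.char_ind φ V.ρ h

/-- Induction of isomorphism classes along a group homomorphism. -/
noncomputable def indFun (φ : K →* H) : RepSemiring k K → RepSemiring k H :=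
  Quotient.map (FinRep.ind φ) fun _ _ h => FinRep.equiv_iff.2 (by
    rw [char_ind_aux, char_ind_aux, FinRep.equiv_iff.1 h])

theorem char_indFun (φ : K →* H) (x : RepSemiring k K) :
    char (indFun φ x) = indChar φ (char x) := by
  obtain ⟨V, rfl⟩ := exists_mk x
  exact char_ind_aux φ V

/-- Induction along a group homomorphism. -/
noncomputable def ind (φ : K →* H) : RepSemiring k K →+ RepSemiring k H where
  toFun := indFun φ
  map_zero' := char_injective (by rw [char_indFun, char_zero, char_zero, map_zero])
  map_add' x y := char_injective (by simp only [char_indFun, char_add, map_add])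

theorem char_ind (φ : K →* H) (x : RepSemiring k K) : char (ind φ x) = indChar φ (char x) :=
  char_indFun φ x

theorem char_perm_aux (X : FinGSet H) (h : H) :
    (FinRep.perm k X).ρ.character h = (Nat.card {x : X.carrier // h • x = x} : k) := by
  classical
  let _ := Fintype.ofFinite X.carrier
  refine (Representation.char_ofMulAction h).trans ?_
  rw [Nat.card_eq_fintype_card, Fintype.card_subtype, Finset.sum_boole]

/-- The isomorphism class of the permutation representation of a finite `H`-set. -/
noncomputable def linFun (k : Type) [Field k] [CharZero k] (H : Type u) [Group H] [Finite H] :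
    BurnsideSemiring H → RepSemiring k H :=
  Quotient.lift (fun X => mk (FinRep.perm k X)) (by
    rintro X Y ⟨e, he⟩
    refine mk_eq (funext fun h => ?_)
    rw [char_perm_aux, char_perm_aux]
    refine congrArg _ (Nat.card_congr (e.subtypeEquiv fun x => ?_))
    rw [← he, e.injective.eq_iff])

theorem char_linFun (X : FinGSet H) (h : H) :
    char (linFun k H (.mk X)) h = (Nat.card {x : X.carrier // h • x = x} : k) :=
  char_perm_aux X h

/-- Linearization, sending a finite `H`-set to its permutation representation. -/
noncomputable def lin (k : Type) [Field k] [CharZero k] (H : Type u) [Group H] [Finite H] :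
    BurnsideSemiring H →+* RepSemiring k H where
  toFun := linFun k H
  map_zero' := char_injective (by
    rw [char_zero]
    ext h
    refine (char_linFun _ h).trans ?_
    have : IsEmpty {x : (FinGSet.empty H).carrier // h • x = x} := ⟨fun x => x.1.elim⟩
    simp)
  map_one' := char_injective (by
    rw [char_one]
    ext h
    refine (char_linFun _ h).trans ?_
    have : Unique {x : (FinGSet.point H).carrier // h • x = x} :=
      ⟨⟨⟨PUnit.unit, rfl⟩⟩, fun _ => rfl⟩
    simp)
  map_add' x y := by
    obtain ⟨X, rfl⟩ := BurnsideSemiring.exists_mk x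
    obtain ⟨Y, rfl⟩ := BurnsideSemiring.exists_mk y
    apply char_injective
    rw [char_add, BurnsideSemiring.mk_add]
    ext h
    rw [Pi.add_apply, char_linFun, char_linFun, char_linFun, ← Nat.cast_add, ← Nat.card_sum]
    refine congrArg _ (Nat.card_congr (Equiv.subtypeSum.trans (Equiv.sumCongr
      (Equiv.subtypeEquivRight fun x => ?_) (Equiv.subtypeEquivRight fun x => ?_))))
    · exact Sum.inl_injective.eq_iff
    · exact Sum.inr_injective.eq_iff
  map_mul' x y := by
    obtain ⟨X, rfl⟩ := BurnsideSemiring.exists_mk x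
    obtain ⟨Y, rfl⟩ := BurnsideSemiring.exists_mk y
    apply char_injective
    rw [char_mul, BurnsideSemiring.mk_mul]
    ext h
    rw [Pi.mul_apply, char_linFun, char_linFun, char_linFun, ← Nat.cast_mul, ← Nat.card_prod]
    refine congrArg _ (Nat.card_congr (Equiv.trans (Equiv.subtypeEquivRight fun x => ?_)
      Equiv.subtypeProdEquivProd))
    exact Prod.ext_iff

theorem char_lin (X : FinGSet H) (h : H) :
    char (lin k H (.mk X)) h = (Nat.card {x : X.carrier // h • x = x} : k) :=
  char_linFun X h

theorem char_baseChange_aux (k' : Type) [Field k'] [Algebra k k'] (V : FinRep k H) (h : H) :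
    (V.baseChange k').ρ.character h = algebraMap k k' (V.ρ.character h) :=
  LinearMap.trace_baseChange _ _

/-- Extension of scalars of isomorphism classes. -/
noncomputable def baseChangeFun (k' : Type) [Field k'] [CharZero k'] [Algebra k k'] (H : Type u)
    [Group H] [Finite H] : RepSemiring k H → RepSemiring k' H :=
  Quotient.map (FinRep.baseChange k') fun _ _ h => FinRep.equiv_iff.2 (by
    ext g
    rw [char_baseChange_aux, char_baseChange_aux, FinRep.equiv_iff.1 h])

theorem char_baseChangeFun (k' : Type) [Field k'] [CharZero k'] [Algebra k k']
    (x : RepSemiring k H) (h : H) :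
    char (baseChangeFun k' H x) h = algebraMap k k' (char x h) := by
  obtain ⟨V, rfl⟩ := exists_mk x
  exact char_baseChange_aux k' V h

/-- Extension of scalars. -/
noncomputable def baseChange (k' : Type) [Field k'] [CharZero k'] [Algebra k k'] (H : Type u)
    [Group H] [Finite H] : RepSemiring k H →+* RepSemiring k' H where
  toFun := baseChangeFun k' H
  map_zero' := char_injective (by ext; simp [char_baseChangeFun, char_zero])
  map_one' := char_injective (by ext; simp [char_baseChangeFun, char_one])
  map_add' x y := char_injective (by ext; simp [char_baseChangeFun, char_add])
  map_mul' x y := char_injective (by ext; simp [char_baseChangeFun, char_mul])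

theorem char_baseChange (k' : Type) [Field k'] [CharZero k'] [Algebra k k']
    (x : RepSemiring k H) (h : H) :
    char (baseChange k' H x) h = algebraMap k k' (char x h) := char_baseChangeFun k' x h

end RepSemiring

/-- The representation ring `R_k(H)`: the Grothendieck ring of finite-dimensional representations
of `H` over `k`. -/
abbrev RepRing (k : Type) [Field k] [CharZero k] (H : Type u) [Group H] [Finite H] : Type (u + 1) :=
  GrothendieckRing (RepSemiring k H)

namespace RepRing

open GrothendieckRing

variable {k : Type} [Field k] [CharZero k] {H K : Type u} [Group H] [Group K] [Finite H] [Finite K]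

/-- The character of a virtual representation. -/
noncomputable def char : RepRing k H →+* (H → k) := liftRing RepSemiring.charHom

theorem char_of (a : RepSemiring k H) : char (of a) = RepSemiring.char a := liftRing_of _ a

theorem char_injective : Function.Injective (char : RepRing k H →+* (H → k)) := by
  rw [injective_iff_map_eq_zero]
  intro x hx
  obtain ⟨a, b, rfl⟩ := exists_sub x
  rw [map_sub, char_of, char_of, sub_eq_zero] at hx
  rw [RepSemiring.char_injective hx, sub_self]

/-- Pullback along a group homomorphism. -/
noncomputable def pull (φ : K →* H) : RepRing k H →+* RepRing k K :=
  mapRing (RepSemiring.pull φ)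

/-- Induction along a group homomorphism. -/
noncomputable def ind (φ : K →* H) : RepRing k K →+ RepRing k H := mapAdd (RepSemiring.ind φ)

theorem char_pull (φ : K →* H) (x : RepRing k H) (g : K) : char (pull φ x) g = char x (φ g) := by
  obtain ⟨a, b, rfl⟩ := exists_sub x
  simp only [map_sub, pull, mapRing_of, char_of, Pi.sub_apply, RepSemiring.char_pull]

theorem char_ind (φ : K →* H) (x : RepRing k K) : char (ind φ x) = indChar φ (char x) := by
  obtain ⟨a, b, rfl⟩ := exists_sub x
  simp only [map_sub, ind, mapAdd_of, char_of, RepSemiring.char_ind]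

theorem char_conj (x : RepRing k H) (g h : H) : char x (h * g * h⁻¹) = char x g := by
  obtain ⟨a, b, rfl⟩ := exists_sub x
  obtain ⟨V, rfl⟩ := RepSemiring.exists_mk a
  obtain ⟨W, rfl⟩ := RepSemiring.exists_mk b
  simp only [map_sub, char_of, Pi.sub_apply, RepSemiring.char_mk, Representation.char_conj]

end RepRing

end RepresentationRing
section InducedCharacters

variable {k : Type} [Field k] [CharZero k] {H K L : Type u} [Group H] [Group K] [Group L]
  [Finite H] [Finite K] [Finite L]

open Classical in
theorem indChar_apply [Fintype H] [Fintype K] (φ : K →* H) (f : K → k) (h : H) :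
    indChar φ f h = (Fintype.card K : k)⁻¹ *
      ∑ g : K, ∑ x : H, if φ g * x = x * h then f g else 0 := by
  rw [indChar]
  change (@Fintype.card K (Fintype.ofFinite K) : k)⁻¹ *
    @Finset.sum _ _ _ (@Finset.univ K (Fintype.ofFinite K)) (fun g =>
      @Finset.sum _ _ _ (@Finset.univ H (Fintype.ofFinite H)) _) = _
  rw [Subsingleton.elim (Fintype.ofFinite K) ‹Fintype K›,
    Subsingleton.elim (Fintype.ofFinite H) ‹Fintype H›]

theorem indChar_indChar (φ : K →* H) (ψ : H →* L) (f : K → k) :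
    indChar ψ (indChar φ f) = indChar (ψ.comp φ) f := by
  classical
  have := Fintype.ofFinite H
  have := Fintype.ofFinite K
  have := Fintype.ofFinite L
  ext l
  have hc : (Fintype.card H : k) ≠ 0 := by exact_mod_cast Fintype.card_ne_zero
  have key : ∀ (g : K) (x : H), (∑ h : H, ∑ y : L, if ψ h * y = y * l then
      (if φ g * x = x * h then f g else 0) else 0) =
      ∑ y : L, if ψ (φ g) * y = y * l then f g else 0 := by
    intro g x
    rw [Finset.sum_eq_single (x⁻¹ * φ g * x)]
    · refine Fintype.sum_equiv (Equiv.mulLeft (ψ x)) _ _ fun y => ?_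
      have h1 : φ g * x = x * (x⁻¹ * φ g * x) := by group
      rw [if_pos h1]
      congr 1
      simp only [map_mul, map_inv, Equiv.coe_mulLeft, eq_iff_iff]
      constructor
      · intro h
        have := congrArg (ψ x * ·) h
        simpa [mul_assoc] using this
      · intro h
        have := congrArg ((ψ x)⁻¹ * ·) h
        simpa [mul_assoc] using this
    · intro h _ hne
      have h1 : ¬ φ g * x = x * h := fun e => hne (by rw [mul_assoc, e, inv_mul_cancel_left])
      simp [h1]
    · simp
  simp only [indChar_apply]
  have e1 : ∀ (h : H) (y : L), (if ψ h * y = y * l then (Fintype.card K : k)⁻¹ *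
      ∑ g : K, ∑ x : H, (if φ g * x = x * h then f g else 0) else 0) =
      (Fintype.card K : k)⁻¹ * ∑ g : K, ∑ x : H, (if ψ h * y = y * l then
        (if φ g * x = x * h then f g else 0) else 0) := by
    intro h y
    split_ifs <;> simp
  simp only [e1, ← Finset.mul_sum]
  have e2 : (∑ h : H, ∑ y : L, ∑ g : K, ∑ x : H, (if ψ h * y = y * l then
        (if φ g * x = x * h then f g else 0) else 0)) =
      ∑ g : K, ∑ x : H, ∑ h : H, ∑ y : L, (if ψ h * y = y * l then
        (if φ g * x = x * h then f g else 0) else 0) := by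
    calc _ = ∑ h : H, ∑ g : K, ∑ x : H, ∑ y : L, (if ψ h * y = y * l then
        (if φ g * x = x * h then f g else 0) else 0) := by
          refine Finset.sum_congr rfl fun h _ => ?_
          rw [Finset.sum_comm]
          exact Finset.sum_congr rfl fun g _ => Finset.sum_comm
      _ = _ := by
          rw [Finset.sum_comm]
          exact Finset.sum_congr rfl fun g _ => Finset.sum_comm
  rw [e2]
  simp only [key, Finset.sum_const, Finset.card_univ, nsmul_eq_mul, ← Finset.mul_sum]
  rw [mul_left_comm, inv_mul_cancel_left₀ hc]
  rfl

theorem indChar_mulEquiv (e : K ≃* H) (f : K → k) (hf : ∀ g x, f (x * g * x⁻¹) = f g) (h : H) :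
    indChar e.toMonoidHom f h = f (e.symm h) := by
  classical
  have := Fintype.ofFinite H
  have := Fintype.ofFinite K
  have hc : (Fintype.card K : k) ≠ 0 := by exact_mod_cast Fintype.card_ne_zero
  rw [indChar_apply, Finset.sum_comm]
  have key : ∀ x : H, (∑ g : K, if e.toMonoidHom g * x = x * h then f g else 0) =
      f (e.symm h) := by
    intro x
    rw [Finset.sum_eq_single (e.symm (x * h * x⁻¹))]
    · rw [if_pos (by simp)]
      simpa using hf (e.symm h) (e.symm x)
    · intro g _ hne
      refine if_neg fun h1 => hne ?_
      rw [← h1]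
      simp
    · simp
  simp only [key, Finset.sum_const, Finset.card_univ, nsmul_eq_mul]
  rw [← Fintype.card_congr (α := K) (β := H) e.toEquiv, inv_mul_cancel_left₀ hc]

theorem indChar_mul (φ : K →* H) (a : H → k) (ha : ∀ g x, a (x * g * x⁻¹) = a g) (f : K → k) :
    indChar φ ((fun g => a (φ g)) * f) = a * indChar φ f := by
  classical
  have := Fintype.ofFinite H
  have := Fintype.ofFinite K
  ext h
  rw [Pi.mul_apply, indChar_apply, indChar_apply, mul_left_comm]
  congr 1
  rw [Finset.mul_sum]
  refine Finset.sum_congr rfl fun g _ => ?_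
  rw [Finset.mul_sum]
  refine Finset.sum_congr rfl fun x _ => ?_
  split_ifs with h1
  · have : φ g = x * h * x⁻¹ := by rw [← h1]; group
    rw [Pi.mul_apply, this, ha]
  · simp

theorem indChar_algebraMap {k' : Type} [Field k'] [CharZero k'] [Algebra k k'] (φ : K →* H)
    (f : K → k) (h : H) :
    indChar φ (fun g => algebraMap k k' (f g)) h = algebraMap k k' (indChar φ f h) := by
  classical
  have := Fintype.ofFinite H
  have := Fintype.ofFinite K
  rw [indChar_apply, indChar_apply, map_mul, map_inv₀, map_natCast, map_sum]
  congr 1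
  refine Finset.sum_congr rfl fun g _ => ?_
  rw [map_sum]
  refine Finset.sum_congr rfl fun x _ => ?_
  split_ifs <;> simp

theorem indChar_pow (φ : K →* H) (f : K → k) (n : ℕ) (hK : (Nat.card K).Coprime n)
    (hH : (Nat.card H).Coprime n) (h : H) :
    indChar φ (fun g => f (g ^ n)) h = indChar φ f (h ^ n) := by
  classical
  have := Fintype.ofFinite H
  have := Fintype.ofFinite K
  rw [indChar_apply, indChar_apply]
  congr 1
  refine Fintype.sum_equiv (powCoprime hK) _ _ fun g => Finset.sum_congr rfl fun x _ => ?_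
  congr 1
  have hconj : ∀ (a b : H), a * x = x * b ↔ a = x * b * x⁻¹ := fun a b =>
    ⟨fun e => by rw [← e]; group, fun e => by rw [e]; group⟩
  rw [powCoprime_apply, map_pow, hconj, hconj, eq_iff_iff, ← conj_pow]
  exact ⟨fun e => by rw [e], fun e => (powCoprime hH).injective (by simpa using e)⟩

end InducedCharacters

section DoubleCosets

variable {k : Type} [Field k] [CharZero k] {G : Type u} [Group G] [Finite G]

theorem card_doubleCoset_fiber {K L M : Subgroup G} (t : G)
    (hM : ∀ m, m ∈ M ↔ m ∈ L ∧ t⁻¹ * m * t ∈ K) (z : G) (hz : ∃ l ∈ L, ∃ c ∈ K, z = l * t * c) :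
    Nat.card {p : L × K // (p.1 : G) * t * p.2 = z} = Nat.card M := by
  obtain ⟨l, hl, c, hc, rfl⟩ := hz
  symm
  have hmK : ∀ m : M, t⁻¹ * (m : G)⁻¹ * t ∈ K := fun m => ((hM _).1 (M.inv_mem m.2)).2
  refine Nat.card_eq_of_bijective (fun m : M => (⟨(⟨l * m, L.mul_mem hl ((hM _).1 m.2).1⟩,
    ⟨t⁻¹ * (m : G)⁻¹ * t * c, K.mul_mem (hmK m) hc⟩), by simp; group⟩ :
    {p : L × K // (p.1 : G) * t * p.2 = l * t * c})) ⟨?_, ?_⟩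
  · intro m m' h
    have := congrArg (fun p => (p.1.1 : G)) h
    exact Subtype.ext (mul_left_cancel this)
  · rintro ⟨⟨⟨y, hy⟩, ⟨d, hd⟩⟩, hp⟩
    change y * t * d = l * t * c at hp
    have hd' : d = t⁻¹ * (l⁻¹ * y)⁻¹ * t * c := by
      have : d = (y * t)⁻¹ * (l * t * c) := by rw [← hp]; group
      rw [this]; group
    have hm : l⁻¹ * y ∈ M := by
      refine (hM _).2 ⟨L.mul_mem (L.inv_mem hl) hy, ?_⟩
      have : t⁻¹ * (l⁻¹ * y) * t = c * d⁻¹ := by rw [hd']; group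
      rw [this]
      exact K.mul_mem hc (K.inv_mem hd)
    refine ⟨⟨_, hm⟩, Subtype.ext (Prod.ext (Subtype.ext ?_) (Subtype.ext ?_))⟩
    · simp
    · exact hd'.symm

theorem sum_doubleCosets [Fintype G] {K L H : Subgroup G} [Fintype K] [Fintype L] [Fintype H]
    (T : Finset G) (hK : K ≤ H) (hL : L ≤ H) (hT : ∀ t ∈ T, t ∈ H)
    (hT' : ∀ h ∈ H, ∃! t, t ∈ T ∧ ∃ l ∈ L, ∃ c ∈ K, h = l * t * c)
    (M : G → Subgroup G) (hM : ∀ t m, m ∈ M t ↔ m ∈ L ∧ t⁻¹ * m * t ∈ K)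
    (Φ : G → k) (hΦ : ∀ z, ∀ c ∈ K, Φ (z * c) = Φ z) :
    (Fintype.card K : k)⁻¹ * ∑ x : H, Φ x =
      ∑ t ∈ T, (Nat.card (M t) : k)⁻¹ * ∑ y : L, Φ (y * t) := by
  classical
  have hcK : (Fintype.card K : k) ≠ 0 := by exact_mod_cast Fintype.card_ne_zero
  have step : ∀ t ∈ T, (Nat.card (M t) : k)⁻¹ * ∑ y : L, Φ (y * t) =
      (Fintype.card K : k)⁻¹ * ∑ x : H,
        if ∃ l ∈ L, ∃ c ∈ K, (x : G) = l * t * c then Φ x else 0 := by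
    intro t ht
    have hcM : (Nat.card (M t) : k) ≠ 0 := by exact_mod_cast Nat.card_pos.ne'
    have e1 : (Fintype.card K : k) * ∑ y : L, Φ (y * t) =
        ∑ p : L × K, Φ ((p.1 : G) * t * p.2) := by
      rw [Fintype.sum_prod_type, Finset.mul_sum]
      refine Finset.sum_congr rfl fun y _ => ?_
      simp [hΦ]
    have e2 : ∑ p : L × K, Φ ((p.1 : G) * t * p.2) = (Nat.card (M t) : k) * ∑ x : H,
        if ∃ l ∈ L, ∃ c ∈ K, (x : G) = l * t * c then Φ x else 0 := by
      let π : L × K → H := fun p =>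
        ⟨(p.1 : G) * t * p.2, H.mul_mem (H.mul_mem (hL p.1.2) (hT t ht)) (hK p.2.2)⟩
      have e3 : ∑ p : L × K, Φ ((p.1 : G) * t * p.2) = ∑ p : L × K, Φ (π p) := rfl
      rw [e3, ← Finset.sum_fiberwise (s := Finset.univ) (g := π), Finset.mul_sum]
      refine Finset.sum_congr rfl fun x _ => ?_
      have e4 : ∑ p ∈ Finset.univ.filter (fun p => π p = x), Φ (π p) =
          ∑ p ∈ Finset.univ.filter (fun p => π p = x), Φ x :=
        Finset.sum_congr rfl fun p hp => by rw [(Finset.mem_filter.1 hp).2]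
      rw [e4, Finset.sum_const, nsmul_eq_mul]
      split_ifs with hx
      · rw [← card_doubleCoset_fiber t (hM t) x hx, Nat.card_eq_fintype_card,
          Fintype.card_subtype]
        simp only [π, Subtype.ext_iff]
      · have : Finset.univ.filter (fun p => π p = x) = ∅ := by
          refine Finset.filter_eq_empty_iff.2 fun p _ hp => hx ?_
          exact ⟨p.1, p.1.2, p.2, p.2.2, congrArg Subtype.val hp.symm⟩
        simp [this]
    rw [e2] at e1
    field_simp
    rw [mul_comm _ (Fintype.card K : k), e1]
  rw [Finset.sum_congr rfl step, ← Finset.mul_sum, Finset.sum_comm]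
  congr 1
  refine Finset.sum_congr rfl fun x _ => ?_
  obtain ⟨t, ⟨ht, hx⟩, huniq⟩ := hT' x x.2
  rw [Finset.sum_eq_single t]
  · rw [if_pos hx]
  · intro s hs hne
    exact if_neg fun h => hne (huniq s ⟨hs, h⟩)
  · intro h
    exact absurd ht h

/-- The double coset formula for induced class functions. -/
theorem indChar_mackey {K L H : Subgroup G} (hK : K ≤ H) (hL : L ≤ H)
    (T : Finset G) (hT : ∀ t ∈ T, t ∈ H)
    (hT' : ∀ h ∈ H, ∃! t, t ∈ T ∧ ∃ l ∈ L, ∃ c ∈ K, h = l * t * c)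
    (M : G → Subgroup G) (hML : ∀ t, M t ≤ L)
    (hM : ∀ t m, m ∈ M t ↔ m ∈ L ∧ t⁻¹ * m * t ∈ K) (φ : ∀ t, M t →* K)
    (hφ : ∀ t (m : M t), (φ t m : G) = t⁻¹ * m * t)
    (f : K → k) (hf : ∀ g x, f (x * g * x⁻¹) = f g) (l : L) :
    indChar (Subgroup.inclusion hK) f (Subgroup.inclusion hL l) =
      ∑ t ∈ T, indChar (Subgroup.inclusion (hML t)) (fun m => f (φ t m)) l := by
  classical
  have := Fintype.ofFinite G
  let F : G → k := fun z => if hz : z ∈ K then f ⟨z, hz⟩ else 0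
  have hF : ∀ z, ∀ c ∈ K, F (c * z * c⁻¹) = F z := by
    intro z c hc
    by_cases hz : z ∈ K
    · have h1 : c * z * c⁻¹ ∈ K := K.mul_mem (K.mul_mem hc hz) (K.inv_mem hc)
      simp only [F, dif_pos hz, dif_pos h1]
      exact hf ⟨z, hz⟩ ⟨c, hc⟩
    · have h1 : c * z * c⁻¹ ∉ K := fun h => hz (by
        have := K.mul_mem (K.mul_mem (K.inv_mem hc) h) hc
        simpa [mul_assoc] using this)
      simp only [F, dif_neg hz, dif_neg h1]
  have hA : ∀ x : H, (∑ g : K, if Subgroup.inclusion hK g * x = x * Subgroup.inclusion hL l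
      then f g else 0) = F (x * l * (x : G)⁻¹) := by
    intro x
    by_cases hz : (x : G) * l * (x : G)⁻¹ ∈ K
    · simp only [F, dif_pos hz]
      rw [Finset.sum_eq_single ⟨_, hz⟩]
      · rw [if_pos (Subtype.ext (by simp))]
      · intro g _ hne
        refine if_neg fun h => hne (Subtype.ext ?_)
        have h1 : (g : G) * x = x * l := congrArg Subtype.val h
        exact eq_mul_inv_of_mul_eq h1
      · simp
    · simp only [F, dif_neg hz]
      refine Finset.sum_eq_zero fun g _ => if_neg fun h => hz ?_
      have h1 : (g : G) * x = x * l := congrArg Subtype.val h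
      rw [← h1]; simp
  have hB : ∀ t, ∀ y : L, (∑ m : M t, if Subgroup.inclusion (hML t) m * y = y * l
      then f (φ t m) else 0) = F (t⁻¹ * (y * l * (y : G)⁻¹) * t) := by
    intro t y
    by_cases hz : t⁻¹ * ((y : G) * l * (y : G)⁻¹) * t ∈ K
    · have hm : (y : G) * l * (y : G)⁻¹ ∈ M t :=
        (hM t _).2 ⟨L.mul_mem (L.mul_mem y.2 l.2) (L.inv_mem y.2), hz⟩
      simp only [F, dif_pos hz]
      rw [Finset.sum_eq_single ⟨_, hm⟩]
      · rw [if_pos (Subtype.ext (by simp))]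
        congr 1
        exact Subtype.ext (hφ _ _)
      · intro g _ hne
        refine if_neg fun h => hne (Subtype.ext ?_)
        have h1 : (g : G) * y = y * l := congrArg Subtype.val h
        exact eq_mul_inv_of_mul_eq h1
      · simp
    · simp only [F, dif_neg hz]
      refine Finset.sum_eq_zero fun m _ => if_neg fun h => hz ?_
      have h1 : (m : G) * y = y * l := congrArg Subtype.val h
      have h2 : t⁻¹ * ((y : G) * l * (y : G)⁻¹) * t = φ t m := by
        rw [← h1, hφ, mul_inv_cancel_right]
      rw [h2]
      exact (φ t m).2
  let Φ : G → k := fun z => F (z⁻¹ * l * z)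
  have hΦ : ∀ z, ∀ c ∈ K, Φ (z * c) = Φ z := by
    intro z c hc
    have := hF (z⁻¹ * l * z) c⁻¹ (K.inv_mem hc)
    simp only [Φ]
    rw [← this]
    congr 1
    group
  have main := sum_doubleCosets T hK hL hT hT' M hM Φ hΦ
  rw [indChar_apply, Finset.sum_comm]
  refine Eq.trans ?_ (main.trans ?_)
  · congr 1
    refine (Finset.sum_congr rfl fun x _ => (by convert hA x)).trans ?_
    refine Fintype.sum_equiv (Equiv.inv H) _ _ fun x => ?_
    simp [Φ]
  · refine Finset.sum_congr rfl fun t _ => ?_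
    rw [indChar_apply, Finset.sum_comm, Nat.card_eq_fintype_card]
    congr 1
    symm
    refine (Finset.sum_congr rfl fun y _ => (by convert hB t y)).trans ?_
    refine Fintype.sum_equiv (Equiv.inv L) _ _ fun y => ?_
    simp only [Φ, Equiv.inv_apply, Subgroup.coe_inv]
    congr 1
    group

end DoubleCosets
section RepresentationGreenFunctors

namespace RepRing

open GrothendieckRing

variable {k : Type} [Field k] [CharZero k] {H K L : Type u} [Group H] [Group K] [Group L]
  [Finite H] [Finite K] [Finite L]

theorem pull_inner (φ : H →* H) (g : H) (hφ : ∀ h, φ h = g⁻¹ * h * g) (x : RepRing k H) :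
    pull φ x = x := by
  refine char_injective (funext fun h => ?_)
  rw [char_pull, hφ]
  simpa using char_conj x h g⁻¹

theorem pull_pull (φ : K →* H) (ψ : L →* K) (x : RepRing k H) :
    pull ψ (pull φ x) = pull (φ.comp ψ) x := by
  refine char_injective (funext fun h => ?_)
  rw [char_pull, char_pull, char_pull]
  rfl

theorem ind_ind (φ : K →* H) (ψ : H →* L) (x : RepRing k K) :
    ind ψ (ind φ x) = ind (ψ.comp φ) x := by
  apply char_injective
  rw [char_ind, char_ind, char_ind, indChar_indChar]

theorem ind_mulEquiv (e : K ≃* H) (x : RepRing k K) :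
    ind e.toMonoidHom x = pull e.symm.toMonoidHom x := by
  refine char_injective (funext fun h => ?_)
  rw [char_ind, char_pull, indChar_mulEquiv e _ fun g h => char_conj x g h]
  rfl

theorem ind_mul (φ : K →* H) (y : RepRing k H) (x : RepRing k K) :
    ind φ (pull φ y * x) = y * ind φ x := by
  apply char_injective
  rw [char_ind, map_mul char, map_mul char, char_ind,
    ← indChar_mul φ _ fun g h => char_conj y g h]
  have h1 : char (pull φ y) = fun g => char y (φ g) := funext (char_pull φ y)
  rw [h1]

/-- The double coset formula for virtual representations. -/
theorem pull_ind {G : Type u} [Group G] [Finite G] {K L H : Subgroup G} (hK : K ≤ H) (hL : L ≤ H)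
    (T : Finset G) (hT : ∀ t ∈ T, t ∈ H)
    (hT' : ∀ h ∈ H, ∃! t, t ∈ T ∧ ∃ l ∈ L, ∃ k ∈ K, h = l * t * k) (x : RepRing k K) :
    pull (Subgroup.inclusion hL) (ind (Subgroup.inclusion hK) x) =
      ∑ t ∈ T, ind (Subgroup.inclusion (inf_le_left : L ⊓ MulAut.conj t • K ≤ L))
        (pull ((conjEquiv t rfl).toMonoidHom.comp (Subgroup.inclusion inf_le_right)) x) := by
  let M : G → Subgroup G := fun t => L ⊓ MulAut.conj t • K
  have hM : ∀ t, M t ≤ L := fun _ => inf_le_left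
  let φ : ∀ t, M t →* K := fun t =>
    (conjEquiv t rfl).toMonoidHom.comp (Subgroup.inclusion inf_le_right)
  refine char_injective (funext fun l => ?_)
  rw [char_pull, char_ind, map_sum, Finset.sum_apply,
    indChar_mackey hK hL T hT hT' M hM (fun t m => and_congr_right fun _ => mem_conj_smul_iff) φ
      (fun _ _ => rfl) (char x) (fun g h => char_conj x g h) l]
  refine Finset.sum_congr rfl fun t _ => ?_
  rw [char_ind]
  have h1 : char (pull (φ t) x) = fun m => char x (φ t m) := funext (char_pull (φ t) x)
  exact congrFun (congrArg _ h1.symm) l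

/-- Linearization, sending a finite `H`-set to its permutation representation. -/
noncomputable def lin (k : Type) [Field k] [CharZero k] (H : Type u) [Group H] [Finite H] :
    BurnsideRing H →+* RepRing k H :=
  mapRing (RepSemiring.lin k H)

/-- Extension of scalars. -/
noncomputable def baseChange (k' : Type) [Field k'] [CharZero k'] [Algebra k k'] (H : Type u)
    [Group H] [Finite H] : RepRing k H →+* RepRing k' H :=
  mapRing (RepSemiring.baseChange k' H)

theorem char_baseChange (k' : Type) [Field k'] [CharZero k'] [Algebra k k'] (x : RepRing k H)
    (h : H) : char (baseChange k' H x) h = algebraMap k k' (char x h) := by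
  obtain ⟨a, b, rfl⟩ := exists_sub x
  simp only [map_sub, baseChange, mapRing_of, char_of, Pi.sub_apply, RepSemiring.char_baseChange]

theorem baseChange_pull (k' : Type) [Field k'] [CharZero k'] [Algebra k k'] (φ : K →* H)
    (x : RepRing k H) : baseChange k' K (pull φ x) = pull φ (baseChange k' H x) := by
  refine char_injective (funext fun g => ?_)
  rw [char_baseChange, char_pull, char_pull, char_baseChange]

theorem baseChange_ind (k' : Type) [Field k'] [CharZero k'] [Algebra k k'] (φ : K →* H)
    (x : RepRing k K) : baseChange k' H (ind φ x) = ind φ (baseChange k' K x) := by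
  refine char_injective (funext fun h => ?_)
  have h1 : char (baseChange k' K x) = fun g => algebraMap k k' (char x g) :=
    funext (char_baseChange k' x)
  rw [char_baseChange, char_ind, char_ind, h1, indChar_algebraMap]

open Classical in
theorem sum_push [Fintype H] [Fintype K] (φ : K →* H) (hφ : Function.Injective φ) (X : FinGSet K)
    [Fintype X.carrier] [Fintype (X.push φ).carrier] (F : (X.push φ).carrier → k) :
    ∑ x : H, ∑ p : X.carrier, F (FinGSet.push.mk φ X x⁻¹ p) = (Fintype.card K : k) * ∑ c, F c := by
  let π : H × X.carrier → (X.push φ).carrier := fun p => FinGSet.push.mk φ X p.1⁻¹ p.2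
  rw [← Fintype.sum_prod_type' (f := fun x p => F (FinGSet.push.mk φ X x⁻¹ p))]
  have e1 : ∑ p : H × X.carrier, F (FinGSet.push.mk φ X p.1⁻¹ p.2) = ∑ p, F (π p) := rfl
  rw [e1, ← Finset.sum_fiberwise (s := Finset.univ) (g := π), Finset.mul_sum]
  refine Finset.sum_congr rfl fun c _ => ?_
  have e2 : ∑ p ∈ Finset.univ.filter (fun p => π p = c), F (π p) =
      ∑ p ∈ Finset.univ.filter (fun p => π p = c), F c :=
    Finset.sum_congr rfl fun p hp => by rw [(Finset.mem_filter.1 hp).2]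
  rw [e2, Finset.sum_const, nsmul_eq_mul]
  congr 2
  obtain ⟨a, p, rfl⟩ := FinGSet.push.exists_mk _ _ c
  symm
  refine Finset.card_bij (fun m _ => ((a * φ m⁻¹)⁻¹, m • p)) ?_ ?_ ?_
  · intro m _
    refine Finset.mem_filter.2 ⟨Finset.mem_univ _, ?_⟩
    change FinGSet.push.mk φ X (a * φ m⁻¹)⁻¹⁻¹ (m • p) = _
    exact ((FinGSet.push.mk_eq φ X).2 ⟨m, inv_inv _, rfl⟩).symm
  · intro m _ m' _ h
    have h1 := mul_left_cancel (inv_injective (congrArg Prod.fst h))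
    exact inv_injective (hφ h1)
  · rintro ⟨x, p'⟩ h
    obtain ⟨m, h1, h2⟩ := (FinGSet.push.mk_eq φ X).1 (Finset.mem_filter.1 h).2.symm
    refine ⟨m, Finset.mem_univ _, Prod.ext ?_ h2.symm⟩
    change (a * φ m⁻¹)⁻¹ = x
    rw [← h1, inv_inv]

theorem card_fixed_push (φ : K →* H) (hφ : Function.Injective φ) (X : FinGSet K) (h : H) :
    (Nat.card {c : (X.push φ).carrier // h • c = c} : k) =
      indChar φ (fun g => (Nat.card {p : X.carrier // g • p = p} : k)) h := by
  classical
  have := Fintype.ofFinite H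
  have := Fintype.ofFinite K
  have := Fintype.ofFinite X.carrier
  have := Fintype.ofFinite (X.push φ).carrier
  have hc : (Fintype.card K : k) ≠ 0 := by exact_mod_cast Fintype.card_ne_zero
  have key : ∀ (x : H) (p : X.carrier), (∑ g : K, if φ g * x = x * h then
      (if g • p = p then (1 : k) else 0) else 0) =
      if h • FinGSet.push.mk φ X x⁻¹ p = FinGSet.push.mk φ X x⁻¹ p then 1 else 0 := by
    intro x p
    have hiff : ∀ g : K, φ g * x = x * h ↔ x⁻¹ = h * x⁻¹ * φ g⁻¹ := by
      intro g
      rw [map_inv, eq_mul_inv_iff_mul_eq, inv_mul_eq_iff_eq_mul, ← mul_assoc,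
        eq_mul_inv_iff_mul_eq]
    by_cases hx : h • FinGSet.push.mk φ X x⁻¹ p = FinGSet.push.mk φ X x⁻¹ p
    · rw [if_pos hx]
      rw [FinGSet.push.smul_mk] at hx
      obtain ⟨g, h1, h2⟩ := (FinGSet.push.mk_eq φ X).1 hx
      rw [Finset.sum_eq_single g]
      · rw [if_pos ((hiff g).2 h1), if_pos h2.symm]
      · intro g' _ hne
        refine if_neg fun h' => hne (hφ (mul_right_cancel (h'.trans ((hiff g).2 h1).symm)))
      · simp
    · rw [if_neg hx]
      refine Finset.sum_eq_zero fun g _ => ?_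
      split_ifs with h1 h2
      · refine absurd ?_ hx
        rw [FinGSet.push.smul_mk]
        exact (FinGSet.push.mk_eq φ X).2 ⟨g, (hiff g).1 h1, h2.symm⟩
      · rfl
      · rfl
  have hcard : ∀ g : K, (Nat.card {p : X.carrier // g • p = p} : k) =
      ∑ p : X.carrier, if g • p = p then 1 else 0 := by
    intro g
    rw [Nat.card_eq_fintype_card, Fintype.card_subtype, Finset.sum_boole]
  rw [indChar_apply]
  have e1 : (∑ g : K, ∑ x : H, if φ g * x = x * h then
      (Nat.card {p : X.carrier // g • p = p} : k) else 0) =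
      ∑ x : H, ∑ p : X.carrier, if h • FinGSet.push.mk φ X x⁻¹ p = FinGSet.push.mk φ X x⁻¹ p
        then (1 : k) else 0 := by
    rw [Finset.sum_comm]
    refine Finset.sum_congr rfl fun x _ => ?_
    rw [← Finset.sum_congr rfl fun p _ => key x p, Finset.sum_comm]
    refine Finset.sum_congr rfl fun g _ => ?_
    rw [hcard]
    split_ifs <;> simp
  refine Eq.trans ?_ (congrArg _ (Eq.trans e1.symm ?_))
  · rw [sum_push φ hφ X (fun c => if h • c = c then (1 : k) else 0), inv_mul_cancel_left₀ hc,
      Nat.card_eq_fintype_card, Fintype.card_subtype, Finset.sum_boole]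
  · refine Finset.sum_congr rfl fun g _ => Finset.sum_congr rfl fun x _ => ?_
    congr

theorem lin_push (φ : K →* H) (hφ : Function.Injective φ) (x : BurnsideRing K) :
    lin k H (mapAdd (BurnsideSemiring.push φ) x) = ind φ (lin k K x) := by
  obtain ⟨a, b, rfl⟩ := exists_sub x
  have key : ∀ a : BurnsideSemiring K,
      RepSemiring.lin k H (BurnsideSemiring.push φ a) = RepSemiring.ind φ (RepSemiring.lin k K a) := by
    intro a
    obtain ⟨X, rfl⟩ := BurnsideSemiring.exists_mk a
    refine RepSemiring.char_injective (funext fun h => ?_)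
    rw [RepSemiring.char_ind, BurnsideSemiring.push_mk, RepSemiring.char_lin,
      card_fixed_push φ hφ X h]
    have h1 : RepSemiring.char (RepSemiring.lin k K (.mk X)) =
        fun g => (Nat.card {p : X.carrier // g • p = p} : k) := funext (RepSemiring.char_lin X)
    rw [h1]
  simp only [map_sub, mapAdd_of, lin, ind, mapRing_of, key]

theorem lin_pull (φ : K →* H) (x : BurnsideRing H) :
    lin k K (mapRing (BurnsideSemiring.pull φ) x) = pull φ (lin k H x) := by
  obtain ⟨a, b, rfl⟩ := exists_sub x
  have key : ∀ a : BurnsideSemiring H,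
      RepSemiring.lin k K (BurnsideSemiring.pull φ a) =
        RepSemiring.pull φ (RepSemiring.lin k H a) := by
    intro a
    obtain ⟨X, rfl⟩ := BurnsideSemiring.exists_mk a
    refine RepSemiring.char_injective (funext fun h => ?_)
    rw [RepSemiring.char_pull, BurnsideSemiring.pull_mk, RepSemiring.char_lin,
      RepSemiring.char_lin]
    rfl
  simp only [map_sub, lin, pull, mapRing_of, key]

end RepRing

/-- The Green functor `G/H ↦ R_k(H)` of representation rings over `k`: restriction and conjugation
are given by pulling back the action, and transfer is induction. -/
noncomputable def repGreen (k : Type) [Field k] [CharZero k] (G : Type u) [Group G] [Finite G] :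
    GreenFunctor.{u, u + 1} G :=
  GreenFunctor.ofPullPush (fun H => RepRing k H) (fun φ => RepRing.pull φ)
    (fun φ => RepRing.ind φ) RepRing.pull_inner RepRing.pull_pull RepRing.ind_ind
    RepRing.ind_mulEquiv RepRing.ind_mul RepRing.pull_ind

/-- The linearization morphism `A → R_k`. -/
noncomputable def linHom (k : Type) [Field k] [CharZero k] (G : Type u) [Group G] [Finite G] :
    GreenFunctor.Hom (burnsideGreen G) (repGreen k G) where
  app H := RepRing.lin k H
  app_res h x := RepRing.lin_pull (Subgroup.inclusion h) x
  app_tr h x := RepRing.lin_push (Subgroup.inclusion h) (Subgroup.inclusion_injective h) x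
  app_conj g _ _ e x := RepRing.lin_pull (conjEquiv g e).toMonoidHom x

/-- The extension of scalars `R_k → R_k'`. -/
noncomputable def baseChangeHom (k k' : Type) [Field k] [CharZero k] [Field k'] [CharZero k']
    [Algebra k k'] (G : Type u) [Group G] [Finite G] :
    GreenFunctor.Hom (repGreen k G) (repGreen k' G) where
  app H := RepRing.baseChange k' H
  app_res h x := RepRing.baseChange_pull k' (Subgroup.inclusion h) x
  app_tr h x := RepRing.baseChange_ind k' (Subgroup.inclusion h) x
  app_conj g _ _ e x := RepRing.baseChange_pull k' (conjEquiv g e).toMonoidHom x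

end RepresentationGreenFunctors

section AdamsOperations

namespace RepRing

open GrothendieckRing

variable {H : Type u} [Group H] [Finite H]

/-- The class of the exterior power `Λⁿ V` in the complex representation ring. -/
noncomputable def extClass (V : FinRep ℂ H) (n : ℕ) : RepRing ℂ H := of (RepSemiring.mk (V.ext n))

/-- The Adams operation `ψⁿ` on the class of a complex representation `V`, defined recursively by
Newton's formula
`ψⁿ⁺¹ V = (-1)ⁿ (n + 1) Λⁿ⁺¹ V - ∑_{i < n} (-1)ⁱ⁺¹ Λⁱ⁺¹ V · ψⁿ⁻ⁱ V`, with `ψ⁰ V = dim V`. -/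
noncomputable def adamsRep (V : FinRep ℂ H) : ℕ → RepRing ℂ H
  | 0 => (finrank ℂ V.V : ℕ)
  | n + 1 => (-1) ^ n * (n + 1 : ℕ) * extClass V (n + 1) -
      ∑ i : Fin n, (-1) ^ (i.1 + 1) * extClass V (i.1 + 1) * adamsRep V (n - i.1)
termination_by n => n

theorem char_adamsRep (V : FinRep ℂ H) (n : ℕ) (h : H) :
    char (adamsRep V n) h = V.ρ.character (h ^ n) := by
  have hN : (V.ρ h) ^ Nat.card H = 1 := by rw [← map_pow, pow_card_eq_one', map_one]
  obtain ⟨d, b, μ, hμ⟩ := Representation.exists_eigenbasis (V.ρ h) _ Nat.card_pos.ne' hN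
  have hpow : ∀ n, V.ρ.character (h ^ n) =
      MvPolynomial.aeval μ (MvPolynomial.psum (Fin d) ℂ n) := fun n => by
    rw [Representation.character, map_pow, Representation.trace_pow_eq_psum b _ μ hμ]
  have hext : ∀ n, char (extClass V n) h =
      MvPolynomial.aeval μ (MvPolynomial.esymm (Fin d) ℂ n) := fun n => by
    rw [extClass, char_of, RepSemiring.char_mk]
    exact Representation.trace_extPower b _ μ hμ n
  rw [hpow]
  induction n using Nat.strong_induction_on with
  | _ n ih =>
    cases n with
    | zero =>
      rw [adamsRep, map_natCast, ← hpow, pow_zero, Representation.char_one]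
      rfl
    | succ n =>
      rw [adamsRep, Representation.psum_newton, ← hext]
      simp only [map_sub, map_mul, map_pow, map_neg, map_one, map_natCast, map_sum, Pi.sub_apply,
        Pi.mul_apply, Pi.pow_apply, Pi.neg_apply, Pi.one_apply, Pi.natCast_apply, Finset.sum_apply,
        ← hext]
      congr 1
      refine Finset.sum_congr rfl fun i _ => ?_
      rw [ih _ (by omega)]

/-- The Adams operation on isomorphism classes of representations. -/
noncomputable def adamsFun (n : ℕ) : RepSemiring ℂ H → RepRing ℂ H :=
  Quotient.lift (fun V => adamsRep V n) fun V W h => char_injective (funext fun g => by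
    rw [char_adamsRep, char_adamsRep, FinRep.equiv_iff.1 h])

theorem char_adamsFun (n : ℕ) (a : RepSemiring ℂ H) (h : H) :
    char (adamsFun n a) h = RepSemiring.char a (h ^ n) := by
  obtain ⟨V, rfl⟩ := RepSemiring.exists_mk a
  exact char_adamsRep V n h

/-- The Adams operation `ψⁿ` on the complex representation ring. -/
noncomputable def adams (n : ℕ) (H : Type u) [Group H] [Finite H] : RepRing ℂ H →+* RepRing ℂ H :=
  liftRing
    { toFun := adamsFun n
      map_zero' := char_injective (by ext; simp [char_adamsFun, RepSemiring.char_zero])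
      map_one' := char_injective (by ext; simp [char_adamsFun, RepSemiring.char_one])
      map_add' x y := char_injective (by ext; simp [char_adamsFun, RepSemiring.char_add])
      map_mul' x y := char_injective (by ext; simp [char_adamsFun, RepSemiring.char_mul]) }

theorem char_adams (n : ℕ) (x : RepRing ℂ H) (h : H) :
    char (adams n H x) h = char x (h ^ n) := by
  obtain ⟨a, b, rfl⟩ := exists_sub x
  simp only [map_sub, adams, liftRing_of, Pi.sub_apply, char_of]
  exact congrArg₂ _ (char_adamsFun n a h) (char_adamsFun n b h)

theorem adams_pull {K : Type u} [Group K] [Finite K] (n : ℕ) (φ : K →* H) (x : RepRing ℂ H) :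
    adams n K (pull φ x) = pull φ (adams n H x) := by
  refine char_injective (funext fun g => ?_)
  rw [char_adams, char_pull, char_pull, char_adams, map_pow]

theorem adams_ind {K : Type u} [Group K] [Finite K] (n : ℕ) (hK : (Nat.card K).Coprime n)
    (hH : (Nat.card H).Coprime n) (φ : K →* H) (x : RepRing ℂ K) :
    adams n H (ind φ x) = ind φ (adams n K x) := by
  refine char_injective (funext fun h => ?_)
  have h1 : char (adams n K x) = fun g => char x (g ^ n) := funext (char_adams n x)
  rw [char_adams, char_ind, char_ind, h1, indChar_pow φ _ n hK hH]

end RepRing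

/-- The Adams operation `ψⁿ` on the Green functor of complex representation rings, for `n` prime to
the order of the group. -/
noncomputable def adamsHom (G : Type u) [Group G] [Finite G] (n : ℕ)
    (hn : (Nat.card G).Coprime n) : GreenFunctor.Hom (repGreen ℂ G) (repGreen ℂ G) where
  app H := RepRing.adams n H
  app_res h x := RepRing.adams_pull n (Subgroup.inclusion h) x
  app_tr {K H} h x := RepRing.adams_ind n (hn.coprime_dvd_left K.card_subgroup_dvd_card)
    (hn.coprime_dvd_left H.card_subgroup_dvd_card) (Subgroup.inclusion h) x
  app_conj g _ _ e x := RepRing.adams_pull n (conjEquiv g e).toMonoidHom x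

end AdamsOperations

/-- `ℓ` is a primitive root modulo `n`: its residue class is a unit that generates `(ℤ/n)ˣ`. -/
def IsPrimitiveRootMod (ℓ n : ℕ) : Prop :=
  ∃ u : (ZMod n)ˣ, (u : ZMod n) = ℓ ∧ ∀ v : (ZMod n)ˣ, v ∈ Subgroup.zpowers u

theorem IsPrimitiveRootMod.coprime {ℓ n : ℕ} (h : IsPrimitiveRootMod ℓ n) : n.Coprime ℓ := by
  obtain ⟨u, hu, -⟩ := h
  exact ((ZMod.isUnit_iff_coprime ℓ n).1 ⟨u, hu⟩).symm

/-!
Both targets are the image of the Burnside ring. A rational character, and likewise the character of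
a fixed point of `ψ^ℓ`, takes the same value at `h` and at `h ^ n` for every `n` prime to `q`, so it
is enough to show that a virtual representation `x` of a `q`-group `H` with such a character is an
integral combination of permutation representations. The kernels agree because extension of scalars
is injective.

The proof is by induction on `|H|`. For a normal subgroup `N ≠ 1`, the average `avg_N x` of the
character over the cosets of `N` comes from `H ⧸ N`, so it is covered by induction.

* If `H` is cyclic and `|N| = q`, then `x - avg_N x` is supported on `N` and is an integral multiple
  of `k[H] - k[H ⧸ N]`; integrality follows by pairing with a linear character nontrivial on `N`.
* If the center contains an elementary abelian `E` of order `q²`, then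
  `x = ∑_L avg_L x - q avg_E x`, the sum running over the `q + 1` subgroups `L` of order `q` in `E`.
* Otherwise, `q` being odd, some noncentral `D` of order `q` has all its commutators in a central
  subgroup `Z` of order `q`. With `C` the centralizer of `D`, a subgroup of index `q`, the
  difference of `x` and `Ind_C avg_D Res_C x` is `Z`-invariant, and induction applies to `C` and to
  `H ⧸ Z`.
-/

section PGroups

open scoped commutatorElement

theorem mul_pow_of_commutator_central {G : Type*} [Group G] {x y c : G} (h : y * x = x * y * c)
    (hx : Commute c x) (hy : Commute c y) (n : ℕ) :
    (x * y) ^ n = x ^ n * y ^ n * c ^ n.choose 2 := by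
  have pow_mul_comm (n : ℕ) : y ^ n * x = x * y ^ n * c ^ n := by
    induction n with
    | zero => simp
    | succ n ih =>
      calc y ^ (n + 1) * x = y * x * y ^ n * c ^ n := by rw [pow_succ', mul_assoc, ih]; group
        _ = x * y * (c * y ^ n) * c ^ n := by rw [h]; group
        _ = x * y ^ (n + 1) * c ^ (n + 1) := by
          rw [(hy.pow_right n).eq, pow_succ' y, pow_succ' c]; group
  induction n with
  | zero => simp
  | succ n ih =>
    calc (x * y) ^ (n + 1) = x ^ n * y ^ n * (c ^ n.choose 2 * x) * y := by
          rw [pow_succ, ih]; group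
      _ = x ^ n * (y ^ n * x) * (c ^ n.choose 2 * y) := by
          rw [(hx.pow_left _).eq]; group
      _ = x ^ n * x * y ^ n * (c ^ n * y) * c ^ n.choose 2 := by
          rw [(hy.pow_left _).eq, pow_mul_comm]; group
      _ = x ^ (n + 1) * y ^ (n + 1) * (c ^ n * c ^ n.choose 2) := by
          rw [(hy.pow_left n).eq, pow_succ x, pow_succ y]; group
      _ = _ := by rw [← pow_add, Nat.choose_succ_succ' n 1, Nat.choose_one_right]

theorem normal_of_le_center {G : Type*} [Group G] {N : Subgroup G}
    (h : N ≤ Subgroup.center G) : N.Normal :=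
  ⟨fun n hn g => by rwa [Subgroup.mem_center_iff.1 (h hn) g, mul_inv_cancel_right]⟩

theorem pow_eq_one_of_card_eq {G : Type*} [Group G] {N : Subgroup G} {n : ℕ}
    (hN : Nat.card N = n) {x : G} (hx : x ∈ N) : x ^ n = 1 :=
  hN ▸ congrArg Subtype.val (pow_card_eq_one' (x := (⟨x, hx⟩ : N)))

theorem card_zpowers_of_pow_eq_one {p : ℕ} [Fact p.Prime] {G : Type*} [Group G] {x : G}
    (hx : x ^ p = 1) (hx1 : x ≠ 1) : Nat.card (Subgroup.zpowers x) = p := by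
  rw [Nat.card_zpowers, orderOf_eq_prime hx hx1]

theorem card_comap_mk' {G : Type*} [Group G] (N : Subgroup G) [N.Normal] (K : Subgroup (G ⧸ N)) :
    Nat.card (K.comap (QuotientGroup.mk' N)) = Nat.card N * Nat.card K :=
  QuotientGroup.card_preimage_mk N K

theorem card_quotient_lt {G : Type*} [Group G] [Finite G] {N : Subgroup G} (hN : N ≠ ⊥) :
    Nat.card (G ⧸ N) < Nat.card G := by
  rw [N.card_eq_card_quotient_mul_card_subgroup]
  exact lt_mul_of_one_lt_right Nat.card_pos (N.one_lt_card_iff_ne_bot.2 hN)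

/-- The elements of `N` whose `n`-th power is trivial, when `n`-th powers are multiplicative
on `N`. -/
def powTorsion {G : Type*} [Group G] (N : Subgroup G) (n : ℕ)
    (hmul : ∀ x ∈ N, ∀ y ∈ N, (x * y) ^ n = x ^ n * y ^ n) : Subgroup G where
  carrier := {x | x ∈ N ∧ x ^ n = 1}
  one_mem' := ⟨N.one_mem, one_pow n⟩
  mul_mem' {x y} hx hy :=
    ⟨N.mul_mem hx.1 hy.1, by rw [hmul x hx.1 y hy.1, hx.2, hy.2, one_mul]⟩
  inv_mem' {x} hx := ⟨N.inv_mem hx.1, by rw [inv_pow, hx.2, inv_one]⟩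

section

variable {G : Type*} [Group G] {N : Subgroup G} {n : ℕ}
  {hmul : ∀ x ∈ N, ∀ y ∈ N, (x * y) ^ n = x ^ n * y ^ n}

theorem mem_powTorsion {x : G} : x ∈ powTorsion N n hmul ↔ x ∈ N ∧ x ^ n = 1 :=
  Iff.rfl

instance powTorsion_normal [hN : N.Normal] : (powTorsion N n hmul).Normal :=
  ⟨fun x hx g => ⟨hN.conj_mem x hx.1 g, by rw [conj_pow, hx.2, mul_one, mul_inv_cancel]⟩⟩

theorem card_le_card_powTorsion_mul [Finite G] {Z : Subgroup G} (hNZ : ∀ x ∈ N, x ^ n ∈ Z) :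
    Nat.card N ≤ Nat.card (powTorsion N n hmul) * Nat.card Z := by
  let F : N →* Z := .mk' (fun x => ⟨x ^ n, hNZ x x.2⟩) fun x y => Subtype.ext (hmul x x.2 y y.2)
  have hker : F.ker.map N.subtype = powTorsion N n hmul := by
    ext x
    simp [F, MonoidHom.mem_ker, mem_powTorsion, Subtype.ext_iff, and_comm]
  rw [← F.ker.card_mul_index, Subgroup.index_ker, ← hker,
    Subgroup.card_map_of_injective N.subtype_injective]
  exact Nat.mul_le_mul_left _ (Subgroup.card_le_card_group _)

end

variable {p : ℕ} [hp : Fact p.Prime] {G : Type*} [Group G] [Finite G]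

theorem exists_mem_center_of_normal (hG : IsPGroup p G) (N : Subgroup G) [N.Normal]
    (hN : N ≠ ⊥) : ∃ g ∈ N, g ∈ Subgroup.center G ∧ g ≠ 1 := by
  have hdvd : p ∣ Nat.card N :=
    (hG.to_subgroup N).card_eq_or_dvd.resolve_left (N.one_lt_card_iff_ne_bot.2 hN).ne'
  have h1 : (1 : N) ∈ MulAction.fixedPoints (ConjAct G) N := fun g => smul_one g
  obtain ⟨b, hb, hne⟩ :=
    (hG.of_equiv ConjAct.toConjAct).exists_fixed_point_of_prime_dvd_card_of_fixed_point N hdvd h1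
  refine ⟨b, b.2, Subgroup.mem_center_iff.2 fun g => ?_, fun h => hne (Subtype.ext h.symm)⟩
  exact mul_inv_eq_iff_eq_mul.1 (congrArg Subtype.val (hb (ConjAct.toConjAct g)))

theorem exists_le_center_card_eq (hG : IsPGroup p G) (N : Subgroup G) [N.Normal] (hN : N ≠ ⊥) :
    ∃ Z ≤ N, Z ≤ Subgroup.center G ∧ Nat.card Z = p := by
  obtain ⟨g, hgN, hgc, hg⟩ := exists_mem_center_of_normal hG N hN
  have hdvd : p ∣ Nat.card (Subgroup.zpowers g) := by
    rw [Nat.card_zpowers]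
    exact hG.dvd_orderOf hg
  obtain ⟨z, hz⟩ := exists_prime_orderOf_dvd_card' p hdvd
  have hzg : Subgroup.zpowers (z : G) ≤ Subgroup.zpowers g := Subgroup.zpowers_le.2 z.2
  refine ⟨Subgroup.zpowers z, hzg.trans (Subgroup.zpowers_le.2 hgN),
    hzg.trans (Subgroup.zpowers_le.2 hgc), ?_⟩
  rw [Nat.card_zpowers, Subgroup.orderOf_coe, hz]

theorem le_center_of_normal_of_card_eq (hG : IsPGroup p G) (N : Subgroup G) [N.Normal]
    (hN : Nat.card N = p) : N ≤ Subgroup.center G := by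
  obtain ⟨Z, hZN, hZc, hZ⟩ := exists_le_center_card_eq hG N
    (N.one_lt_card_iff_ne_bot.1 (hN ▸ hp.out.one_lt))
  rwa [← Subgroup.eq_of_le_of_card_ge hZN (hN.trans hZ.symm).le]

theorem exists_normal_card_sq_of_lt (hG : IsPGroup p G) {Z K : Subgroup G}
    [Z.Normal] [hKn : K.Normal] (hZ : Nat.card Z = p) (hZK : Z < K) (hK : ∀ k ∈ K, k ^ p = 1) :
    ∃ E : Subgroup G, E.Normal ∧ Nat.card E = p ^ 2 ∧ ∀ e ∈ E, e ^ p = 1 := by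
  let π := QuotientGroup.mk' Z
  have hKπ : (K.map π).Normal := hKn.map π (QuotientGroup.mk'_surjective Z)
  have hKbot : K.map π ≠ ⊥ := fun h => hZK.not_ge (by
    rwa [Subgroup.map_eq_bot_iff, QuotientGroup.ker_mk'] at h)
  obtain ⟨L, hLK, hLc, hL⟩ := exists_le_center_card_eq (hG.to_quotient Z) (K.map π) hKbot
  have hLn : L.Normal := normal_of_le_center hLc
  refine ⟨L.comap π, inferInstance, by rw [card_comap_mk', hZ, hL, sq], fun e he => hK e ?_⟩
  rw [← Subgroup.comap_map_eq_self ((QuotientGroup.ker_mk' Z).trans_le hZK.le)]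
  exact hLK he

theorem exists_notMem_pow_eq_one (hG : IsPGroup p G) (hcyc : ¬ IsCyclic G) (Z : Subgroup G)
    [Z.Normal] (hZ : Nat.card Z = p) [hq : IsCyclic (G ⧸ Z)] : ∃ y ∉ Z, y ^ p = 1 := by
  obtain ⟨b, hb⟩ := hq.exists_generator
  obtain ⟨a, rfl⟩ := QuotientGroup.mk'_surjective Z b
  have hsup : Subgroup.zpowers a ⊔ Z = ⊤ := by
    rw [← QuotientGroup.ker_mk' Z, ← Subgroup.comap_map_eq, MonoidHom.map_zpowers,
      (Subgroup.eq_top_iff' _).2 hb, Subgroup.comap_top]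
  have not_top (g : G) : Subgroup.zpowers g ≠ ⊤ := fun h =>
    hcyc ⟨g, (Subgroup.eq_top_iff' _).1 h⟩
  have hZa : ¬ Z ≤ Subgroup.zpowers a := fun h => not_top a (by rwa [sup_eq_left.2 h] at hsup)
  have ha : a ≠ 1 := by
    rintro rfl
    have hZtop : Z = ⊤ := by simpa using hsup
    refine hcyc (isCyclic_of_prime_card (p := p) ?_)
    rw [← hZ, hZtop, Subgroup.card_top]
  obtain ⟨y, hy⟩ := exists_prime_orderOf_dvd_card' (G := Subgroup.zpowers a) p (by
    rw [Nat.card_zpowers]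
    exact hG.dvd_orderOf ha)
  rw [← Subgroup.orderOf_coe] at hy
  refine ⟨y, fun hyZ => hZa ?_, hy ▸ pow_orderOf_eq_one _⟩
  have hyle : Subgroup.zpowers (y : G) ≤ Z := Subgroup.zpowers_le.2 hyZ
  rw [← Subgroup.eq_of_le_of_card_ge hyle (by rw [hZ, Nat.card_zpowers, hy])]
  exact Subgroup.zpowers_le.2 y.2

omit [Finite G] in
theorem mul_pow_of_card_quotient_eq_sq (hodd : Odd p) {Z : Subgroup G} [Z.Normal]
    (hZc : Z ≤ Subgroup.center G) (hZ : Nat.card Z = p) {L : Subgroup (G ⧸ Z)}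
    (hL : Nat.card L = p ^ 2) {x y : G} (hx : (x : G ⧸ Z) ∈ L) (hy : (y : G ⧸ Z) ∈ L) :
    (x * y) ^ p = x ^ p * y ^ p := by
  have hcomm : (y : G ⧸ Z) * x = x * y :=
    congrArg Subtype.val <| (IsPGroup.isMulCommutative_of_card_eq_prime_sq hL).is_comm.comm
      ⟨_, hy⟩ ⟨_, hx⟩
  have hc : (x * y)⁻¹ * (y * x) ∈ Z := by
    rw [← QuotientGroup.eq]
    exact hcomm.symm
  have hcc := Subgroup.mem_center_iff.1 (hZc hc)
  have hdvd : p ∣ p.choose 2 :=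
    hp.out.dvd_choose_self two_ne_zero ((hp.out.two_le).lt_of_ne fun h => by
      rw [← h] at hodd
      exact absurd hodd (by decide))
  obtain ⟨j, hj⟩ := hdvd
  rw [mul_pow_of_commutator_central (mul_inv_cancel_left (x * y) (y * x)).symm
    (hcc x).symm (hcc y).symm, hj, pow_mul, pow_eq_one_of_card_eq hZ hc, one_pow, mul_one]

theorem exists_normal_card_sq_of_isCyclic_quotient (hG : IsPGroup p G) (hcyc : ¬ IsCyclic G)
    (Z : Subgroup G) [Z.Normal] (hZc : Z ≤ Subgroup.center G) (hZ : Nat.card Z = p)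
    [IsCyclic (G ⧸ Z)] :
    ∃ E : Subgroup G, E.Normal ∧ Nat.card E = p ^ 2 ∧ ∀ e ∈ E, e ^ p = 1 := by
  have : IsMulCommutative G := MonoidHom.isMulCommutative_of_isCyclic_of_ker_le_center
    (QuotientGroup.mk' Z) ((QuotientGroup.ker_mk' Z).trans_le hZc)
  let K := powTorsion (⊤ : Subgroup G) p fun x _ y _ => Commute.mul_pow (mul_comm' x y) p
  obtain ⟨y, hyZ, hy⟩ := exists_notMem_pow_eq_one hG hcyc Z hZ
  have hZK : Z < K := lt_of_le_not_ge
    (fun z hz => ⟨Subgroup.mem_top z, pow_eq_one_of_card_eq hZ hz⟩)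
    fun h => hyZ (h ⟨Subgroup.mem_top y, hy⟩)
  exact exists_normal_card_sq_of_lt hG hZ hZK fun _ hk => hk.2

theorem exists_normal_card_sq_of_quotient (hodd : Odd p) (hG : IsPGroup p G)
    (Z : Subgroup G) [Z.Normal] (hZc : Z ≤ Subgroup.center G) (hZ : Nat.card Z = p)
    {L : Subgroup (G ⧸ Z)} [hLn : L.Normal] (hL : Nat.card L = p ^ 2)
    (hLp : ∀ l ∈ L, l ^ p = 1) :
    ∃ E : Subgroup G, E.Normal ∧ Nat.card E = p ^ 2 ∧ ∀ e ∈ E, e ^ p = 1 := by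
  let N := L.comap (QuotientGroup.mk' Z)
  have hmul : ∀ x ∈ N, ∀ y ∈ N, (x * y) ^ p = x ^ p * y ^ p := fun _ hx _ hy =>
    mul_pow_of_card_quotient_eq_sq hodd hZc hZ hL hx hy
  have hNZ : ∀ x ∈ N, x ^ p ∈ Z := fun x hx =>
    (QuotientGroup.eq_one_iff _).1 (hLp _ hx)
  have hZN : Z ≤ N := (QuotientGroup.ker_mk' Z).symm.trans_le (MonoidHom.ker_le_comap _ _)
  let K := powTorsion N p hmul
  have hZK : Z ≤ K := fun z hz => ⟨hZN hz, pow_eq_one_of_card_eq hZ hz⟩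
  have hcard : p * p ^ 2 ≤ Nat.card K * p := by
    have h := card_le_card_powTorsion_mul (hmul := hmul) hNZ
    rwa [card_comap_mk', hZ, hL] at h
  refine exists_normal_card_sq_of_lt hG hZ (hZK.lt_of_ne fun h => ?_) fun _ hk => hk.2
  rw [← h, hZ] at hcard
  nlinarith [hp.out.one_lt, pow_pos hp.out.pos 2]

theorem exists_normal_card_sq (hodd : Odd p) (hG : IsPGroup p G) (hcyc : ¬ IsCyclic G) :
    ∃ E : Subgroup G, E.Normal ∧ Nat.card E = p ^ 2 ∧ ∀ e ∈ E, e ^ p = 1 := by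
  induction hn : Nat.card G using Nat.strong_induction_on generalizing G with
  | _ n ih =>
  have : Nontrivial G := not_subsingleton_iff_nontrivial.1 fun _ => hcyc inferInstance
  obtain ⟨Z, -, hZc, hZ⟩ := exists_le_center_card_eq hG ⊤ top_ne_bot
  have hZn : Z.Normal := normal_of_le_center hZc
  have hZbot : Z ≠ ⊥ := Z.one_lt_card_iff_ne_bot.1 (hZ ▸ hp.out.one_lt)
  by_cases hquot : IsCyclic (G ⧸ Z)
  · exact exists_normal_card_sq_of_isCyclic_quotient hG hcyc Z hZc hZ
  · obtain ⟨L, hLn, hL, hLp⟩ := ih _ (hn ▸ card_quotient_lt hZbot) (hG.to_quotient Z) hquot rfl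
    exact exists_normal_card_sq_of_quotient hodd hG Z hZc hZ hL hLp

theorem commutator_mem_of_normal_card_sq (hG : IsPGroup p G) {E Z : Subgroup G} [hEn : E.Normal]
    [Z.Normal] (hE : Nat.card E = p ^ 2) (hZ : Nat.card Z = p) (hZE : Z ≤ E) {e : G}
    (he : e ∈ E) (g : G) : ⁅g, e⁆ ∈ Z := by
  let π := QuotientGroup.mk' Z
  have hEπ : (E.map π).Normal := hEn.map π (QuotientGroup.mk'_surjective Z)
  have hcard : Nat.card (E.map π) = p := by
    have h := card_comap_mk' Z (E.map π)
    rw [Subgroup.comap_map_eq_self ((QuotientGroup.ker_mk' Z).trans_le hZE), hE, hZ, sq] at h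
    exact (Nat.eq_of_mul_eq_mul_left hp.out.pos h).symm
  have hπe : π e ∈ Subgroup.center (G ⧸ Z) :=
    le_center_of_normal_of_card_eq (hG.to_quotient Z) _ hcard (Subgroup.mem_map_of_mem π he)
  rw [← QuotientGroup.eq_one_iff, ← QuotientGroup.mk'_apply, map_commutatorElement,
    commutatorElement_eq_one_iff_mul_comm]
  exact Subgroup.mem_center_iff.1 hπe (π g)

theorem exists_central_card_sq_or_exists_commutator_le (hodd : Odd p) (hG : IsPGroup p G)
    (hcyc : ¬ IsCyclic G) :
    (∃ E ≤ Subgroup.center G, Nat.card E = p ^ 2 ∧ ∀ e ∈ E, e ^ p = 1) ∨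
      ∃ Z ≤ Subgroup.center G, ∃ D : Subgroup G, ¬ D ≤ Subgroup.center G ∧
        ⁅(⊤ : Subgroup G), D⁆ ≤ Z ∧ Nat.card Z = p ∧ Nat.card D = p := by
  obtain ⟨E, hEn, hE, hEp⟩ := exists_normal_card_sq hodd hG hcyc
  by_cases hEc : E ≤ Subgroup.center G
  · exact Or.inl ⟨E, hEc, hE, hEp⟩
  obtain ⟨Z, hZE, hZc, hZ⟩ := exists_le_center_card_eq hG E
    (E.one_lt_card_iff_ne_bot.1 (hE ▸ Nat.one_lt_pow two_ne_zero hp.out.one_lt))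
  obtain ⟨d, hdE, hdc⟩ := SetLike.not_le_iff_exists.1 hEc
  have hZn : Z.Normal := normal_of_le_center hZc
  have hDE : Subgroup.zpowers d ≤ E := Subgroup.zpowers_le.2 hdE
  have hd1 : d ≠ 1 := fun h => hdc (h ▸ Subgroup.one_mem _)
  exact Or.inr ⟨Z, hZc, Subgroup.zpowers d, mt Subgroup.zpowers_le.1 hdc,
    Subgroup.commutator_le.2 fun g _ e he =>
      commutator_mem_of_normal_card_sq hG hE hZ hZE (hDE he) g,
    hZ, card_zpowers_of_pow_eq_one (hEp d hdE) hd1⟩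

end PGroups

section Commutators

open scoped commutatorElement

variable {K H : Type*} [Group K] [Group H] {Z : Subgroup H}

/-- The homomorphism `x ↦ ⁅f x, g⁆`, for an element `g` whose commutators with the image of `f`
lie in a central subgroup. -/
def commutatorHom (hZ : Z ≤ Subgroup.center H) (f : K →* H) (g : H) (hg : ∀ x, ⁅f x, g⁆ ∈ Z) :
    K →* Z :=
  .mk' (fun x => ⟨⁅f x, g⁆, hg x⟩) fun a b => Subtype.ext <| by
    have hb := Subgroup.mem_center_iff.1 (hZ (hg b))
    calc ⁅f (a * b), g⁆ = f a * ⁅f b, g⁆ * (f a)⁻¹ * ⁅f a, g⁆ := by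
          simp only [map_mul, commutatorElement_def]
          group
      _ = ⁅f a, g⁆ * ⁅f b, g⁆ := by rw [hb (f a), mul_inv_cancel_right, hb]

variable (hZ : Z ≤ Subgroup.center H) {f : K →* H} {g : H} (hg : ∀ x, ⁅f x, g⁆ ∈ Z)

theorem coe_commutatorHom (x : K) : (commutatorHom hZ f g hg x : H) = ⁅f x, g⁆ :=
  rfl

theorem mem_ker_commutatorHom {x : K} : x ∈ (commutatorHom hZ f g hg).ker ↔ f x * g = g * f x := by
  rw [MonoidHom.mem_ker, ← OneMemClass.coe_eq_one, coe_commutatorHom,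
    commutatorElement_eq_one_iff_mul_comm]

include hZ hg

theorem commutatorHom_surjective (hp : (Nat.card Z).Prime) {x : K} (hx : f x * g ≠ g * f x) :
    Function.Surjective (commutatorHom hZ f g hg) := by
  have := Fact.mk hp
  rw [← MonoidHom.range_eq_top]
  refine (commutatorHom hZ f g hg).range.eq_bot_or_eq_top_of_prime_card.resolve_left fun h => hx ?_
  rw [← mem_ker_commutatorHom hZ hg, MonoidHom.mem_ker, MonoidHom.range_eq_bot_iff.1 h]
  rfl

theorem exists_conj_eq_mul (hp : (Nat.card Z).Prime) {x : K} (hx : f x * g ≠ g * f x) {z : H}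
    (hz : z ∈ Z) : ∃ y, f y * g * (f y)⁻¹ = z * g := by
  obtain ⟨y, hy⟩ := commutatorHom_surjective hZ hg hp hx ⟨z, hz⟩
  refine ⟨y, ?_⟩
  rw [← show ⁅f y, g⁆ = z from congrArg Subtype.val hy, commutatorElement_def,
    inv_mul_cancel_right]

omit [Group K] hg in
theorem centralizer_normal_of_commutator_le {D : Subgroup H} (hD : ⁅(⊤ : Subgroup H), D⁆ ≤ Z) :
    (Subgroup.centralizer (D : Set H)).Normal := by
  refine ⟨fun c hc g => Subgroup.mem_centralizer_iff.2 fun d hd => ?_⟩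
  have hdZ (x : H) : ⁅MonoidHom.id H x, d⁆ ∈ Z :=
    hD (Subgroup.commutator_mem_commutator (Subgroup.mem_top x) hd)
  have hcd : c ∈ (commutatorHom hZ _ d hdZ).ker :=
    (mem_ker_commutatorHom hZ hdZ).2 (Subgroup.mem_centralizer_iff.1 hc d hd).symm
  exact ((mem_ker_commutatorHom hZ hdZ).1 (Subgroup.Normal.conj_mem inferInstance c hcd g)).symm

end Commutators

section ClassFunctions

theorem sum_ite_mk_eq {G M : Type*} [Group G] [AddCommMonoid M] [Fintype G] (N : Subgroup G)
    [N.Normal] [DecidableEq (G ⧸ N)] [Fintype N] (F : G → M) (a : G) :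
    (∑ g : G, if (g : G ⧸ N) = a then F g else 0) = ∑ n : N, F (n * a) := by
  rw [← Finset.sum_filter]
  symm
  refine Finset.sum_bij (fun n _ => n * a) (fun n _ => ?_) (fun n _ m _ h => ?_) (fun g hg => ?_)
    fun n _ => rfl
  · simp [(QuotientGroup.eq_one_iff (n : G)).2 n.2]
  · exact Subtype.ext (mul_right_cancel h)
  · have hga : g * a⁻¹ ∈ N := by
      rw [← QuotientGroup.eq_one_iff, QuotientGroup.mk_mul, QuotientGroup.mk_inv,
        (Finset.mem_filter.1 hg).2, mul_inv_cancel]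
    exact ⟨⟨g * a⁻¹, hga⟩, Finset.mem_univ _, inv_mul_cancel_right g a⟩

variable {k : Type} [Field k] [CharZero k] {H : Type u} [Group H] [Finite H]

theorem indChar_mk' (N : Subgroup H) [N.Normal] [Fintype N] (f : H → k)
    (hf : ∀ g x, f (x * g * x⁻¹) = f g) (h : H) :
    indChar (QuotientGroup.mk' N) f h = (Nat.card N : k)⁻¹ * ∑ n : N, f (n * h) := by
  classical
  have := Fintype.ofFinite H
  have := Fintype.ofFinite (H ⧸ N)
  have hcQ : (Fintype.card (H ⧸ N) : k) ≠ 0 := Nat.cast_ne_zero.2 Fintype.card_ne_zero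
  have sum_over_coset (x : H ⧸ N) :
      (∑ g : H, if QuotientGroup.mk' N g * x = x * h then f g else 0) = ∑ n : N, f (n * h) := by
    obtain ⟨a, rfl⟩ := QuotientGroup.mk_surjective x
    have e (g : H) : (QuotientGroup.mk' N g * a = a * h) ↔
        (g : H ⧸ N) = (a * h * a⁻¹ : H) := by
      rw [QuotientGroup.mk_mul, QuotientGroup.mk_inv, eq_mul_inv_iff_mul_eq]
      rfl
    simp only [e, sum_ite_mk_eq]
    refine Fintype.sum_equiv (MulAut.conjNormal (H := N) a⁻¹).toEquiv _ _ fun n => ?_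
    rw [← hf _ a⁻¹]
    congr 1
    simp only [MulEquiv.toEquiv_eq_coe, EquivLike.coe_coe, MulAut.conjNormal_apply]
    group
  rw [indChar_apply, Finset.sum_comm]
  rw [Finset.sum_congr rfl fun x _ => (by convert sum_over_coset x), Finset.sum_const,
    Finset.card_univ, nsmul_eq_mul]
  rw [← Nat.card_eq_fintype_card (α := H), N.card_eq_card_quotient_mul_card_subgroup,
    Nat.card_eq_fintype_card (α := H ⧸ N), Nat.cast_mul]
  field_simp

theorem indChar_subtype_of_normal [Fintype H] (C : Subgroup H) [hC : C.Normal] (f : C → k)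
    (h : C) : indChar C.subtype f h =
      (Nat.card C : k)⁻¹ * ∑ t : H, f ⟨t * h * t⁻¹, hC.conj_mem h h.2 t⟩ := by
  classical
  have := Fintype.ofFinite C
  rw [indChar_apply, Finset.sum_comm, Nat.card_eq_fintype_card]
  congr 1
  refine Finset.sum_congr rfl fun t _ => ?_
  rw [Finset.sum_eq_single ⟨t * h * t⁻¹, hC.conj_mem h h.2 t⟩]
  · rw [if_pos (by simp)]
  · exact fun g _ hne => if_neg fun e => hne (Subtype.ext (eq_mul_inv_of_mul_eq e))
  · simp

theorem indChar_subtype_of_notMem (C : Subgroup H) [hC : C.Normal] (f : C → k) {h : H}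
    (hh : h ∉ C) : indChar C.subtype f h = 0 := by
  classical
  have := Fintype.ofFinite C
  have := Fintype.ofFinite H
  rw [indChar_apply]
  refine mul_eq_zero_of_right _ (Finset.sum_eq_zero fun g _ => Finset.sum_eq_zero fun x _ =>
    if_neg fun e => hh ?_)
  have hgx := hC.conj_mem g g.2 x⁻¹
  rwa [inv_inv, mul_assoc, show (g : H) * x = x * h from e, inv_mul_cancel_left] at hgx

end ClassFunctions

open GrothendieckRing

/-- The regular permutation representation, as an element of the Burnside ring. -/
noncomputable def BurnsideRing.regular (H : Type u) [Group H] [Finite H] : BurnsideRing H :=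
  of (BurnsideSemiring.mk ⟨H⟩)

namespace RepRing

section Averaging

variable {k : Type} [Field k] [CharZero k] {H : Type u} [Group H] [Finite H]

/-- The projection of the representation ring induced by `V ↦ V_N`, the coinvariants of a normal
subgroup `N`; on characters it is the average over the cosets of `N`. -/
noncomputable def avg (N : Subgroup H) [N.Normal] : RepRing k H →+ RepRing k H :=
  (pull (QuotientGroup.mk' N)).toAddMonoidHom.comp (ind (QuotientGroup.mk' N))

theorem avg_apply (N : Subgroup H) [N.Normal] (x : RepRing k H) :
    avg N x = pull (QuotientGroup.mk' N) (ind (QuotientGroup.mk' N) x) :=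
  rfl

theorem char_avg (N : Subgroup H) [N.Normal] [Fintype N] (x : RepRing k H) (h : H) :
    char (avg N x) h = (Nat.card N : k)⁻¹ * ∑ n : N, char x (n * h) := by
  rw [avg_apply, char_pull, char_ind]
  exact indChar_mk' N _ (fun g h => char_conj x g h) h

theorem avg_eq_self {N : Subgroup H} [N.Normal] {x : RepRing k H}
    (hx : ∀ n ∈ N, ∀ h, char x (n * h) = char x h) : avg N x = x := by
  have := Fintype.ofFinite N
  have hc : (Nat.card N : k) ≠ 0 := Nat.cast_ne_zero.2 Nat.card_pos.ne'
  refine char_injective (funext fun h => ?_)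
  rw [char_avg, Finset.sum_congr rfl fun (n : N) _ => hx n n.2 h, Finset.sum_const,
    Finset.card_univ, ← Nat.card_eq_fintype_card, nsmul_eq_mul, inv_mul_cancel_left₀ hc]

theorem avg_avg (N : Subgroup H) [N.Normal] (x : RepRing k H) : avg N (avg N x) = avg N x := by
  refine avg_eq_self fun n hn h => ?_
  rw [avg_apply, char_pull, char_pull, map_mul,
    show QuotientGroup.mk' N n = 1 from (QuotientGroup.eq_one_iff n).2 hn, one_mul]

end Averaging

section Multiplicities

variable {k : Type} [Field k] [CharZero k] {H : Type u} [Group H] [Finite H]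

theorem exists_int_char_one (x : RepRing k H) : ∃ n : ℤ, char x 1 = n := by
  obtain ⟨a, b, rfl⟩ := exists_sub x
  obtain ⟨V, rfl⟩ := RepSemiring.exists_mk a
  obtain ⟨W, rfl⟩ := RepSemiring.exists_mk b
  refine ⟨finrank k V.V - finrank k W.V, ?_⟩
  simp only [map_sub, char_of, Pi.sub_apply, RepSemiring.char_mk, Representation.char_one,
    Int.cast_sub, Int.cast_natCast]

/-- The one-dimensional representation on which `h` acts as the scalar `χ h`; the underlying space
is lifted to the universe of the group. -/
noncomputable def linearChar (χ : H →* k) : RepRing k H :=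
  of (RepSemiring.mk
    { V := ULift.{u} k
      ρ :=
        { toFun h := χ h • LinearMap.id
          map_one' := by rw [map_one, one_smul]; rfl
          map_mul' g h := by
            ext
            simp [map_mul, mul_assoc, mul_left_comm] } })

theorem char_linearChar (χ : H →* k) (h : H) : char (linearChar χ) h = χ h := by
  rw [linearChar, char_of, RepSemiring.char_mk]
  change LinearMap.trace k (ULift.{u} k) (χ h • LinearMap.id) = χ h
  rw [map_smul, LinearMap.trace_id]
  simp

theorem exists_int_char_pairing [Fintype H] (x : RepRing k H) (χ : H →* k) :
    ∃ n : ℤ, ∑ h : H, char x h * χ h = n * Nat.card H := by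
  have := Fintype.ofFinite (⊤ : Subgroup H)
  obtain ⟨n, hn⟩ := exists_int_char_one (avg ⊤ (x * linearChar χ))
  refine ⟨n, ?_⟩
  have hsum : ∑ h : H, char x h * χ h =
      ∑ h : (⊤ : Subgroup H), char (x * linearChar χ) (h * 1) := by
    refine Fintype.sum_equiv Subgroup.topEquiv.symm.toEquiv _ _ fun h => ?_
    rw [map_mul, Pi.mul_apply, char_linearChar, mul_one]
    rfl
  have hc : (Nat.card H : k) ≠ 0 := Nat.cast_ne_zero.2 Nat.card_pos.ne'
  rw [hsum, ← hn, char_avg, Subgroup.card_top, mul_comm _ (Nat.card H : k), mul_inv_cancel_left₀ hc]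

open Classical in
theorem char_lin_regular (h : H) :
    char (lin k H (BurnsideRing.regular H)) h = if h = 1 then (Nat.card H : k) else 0 := by
  rw [lin, BurnsideRing.regular, mapRing_of, char_of, RepSemiring.char_lin]
  split_ifs with h1
  · subst h1
    exact congrArg _ (Nat.card_congr (Equiv.subtypeUnivEquiv fun x => one_smul _ _))
  · have : IsEmpty {x : H // h • x = x} := ⟨fun x => h1 (mul_eq_right.1 x.2)⟩
    exact (congrArg _ Nat.card_of_isEmpty).trans Nat.cast_zero

theorem mem_range_lin_of_subsingleton [Subsingleton H] (x : RepRing k H) :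
    x ∈ (lin k H).range := by
  obtain ⟨m, hm⟩ := exists_int_char_one x
  refine ⟨m, char_injective (funext fun h => ?_)⟩
  rw [map_intCast, map_intCast, Subsingleton.elim h 1, hm]
  rfl

variable {K : Type u} [Group K] [Finite K]

theorem pull_mem_range_lin (φ : K →* H) {x : RepRing k H} (hx : x ∈ (lin k H).range) :
    pull φ x ∈ (lin k K).range := by
  obtain ⟨a, rfl⟩ := hx
  exact ⟨_, lin_pull φ a⟩

theorem ind_mem_range_lin {φ : K →* H} (hφ : Function.Injective φ) {x : RepRing k K}
    (hx : x ∈ (lin k K).range) : ind φ x ∈ (lin k H).range := by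
  obtain ⟨a, rfl⟩ := hx
  exact ⟨_, lin_push φ hφ a⟩

end Multiplicities

/-- The character of `x` takes the same value at `h` and at `h ^ n` for all `n` prime to `m`. When
`m` is the exponent of the group, this is Galois invariance of the character. -/
def PowInvariant {k : Type} [Field k] [CharZero k] {H : Type u} [Group H] [Finite H] (m : ℕ)
    (x : RepRing k H) : Prop :=
  ∀ n, m.Coprime n → ∀ h, char x (h ^ n) = char x h

namespace PowInvariant

variable {k : Type} [Field k] [CharZero k] {H K : Type u} [Group H] [Finite H] [Group K] [Finite K]

theorem sub {m : ℕ} {x y : RepRing k H} (hx : PowInvariant m x) (hy : PowInvariant m y) :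
    PowInvariant m (x - y) := fun n hn h => by
  rw [map_sub, Pi.sub_apply, Pi.sub_apply, hx n hn, hy n hn]

theorem pull {m : ℕ} (φ : K →* H) {x : RepRing k H} (hx : PowInvariant m x) :
    PowInvariant m (pull φ x) := fun n hn h => by
  rw [char_pull, char_pull, map_pow, hx n hn]

variable {q : ℕ} [Fact q.Prime]

theorem of_exponent (hH : IsPGroup q H) {x : RepRing k H}
    (hx : PowInvariant (Monoid.exponent H) x) : PowInvariant q x := fun n hn => by
  obtain ⟨a, ha⟩ := isPGroup_iff_exponent_eq_pow.1 hH
  exact hx n (ha ▸ hn.pow_left a)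

theorem ind (hH : IsPGroup q H) (hK : IsPGroup q K) (φ : K →* H) {x : RepRing k K}
    (hx : PowInvariant q x) : PowInvariant q (ind φ x) := fun n hn h => by
  obtain ⟨a, ha⟩ := IsPGroup.iff_card.1 hH
  obtain ⟨b, hb⟩ := IsPGroup.iff_card.1 hK
  rw [char_ind, ← indChar_pow φ _ n (hb ▸ hn.pow_left b) (ha ▸ hn.pow_left a)]
  exact congrArg (fun f => indChar φ f h) (funext (hx n hn))

theorem avg (hH : IsPGroup q H) (N : Subgroup H) [N.Normal] {x : RepRing k H}
    (hx : PowInvariant q x) : PowInvariant q (avg N x) :=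
  (hx.ind (hH.to_quotient N) hH _).pull _

end PowInvariant

end RepRing

section Cyclic

variable {H : Type u} [Group H] [Finite H] {q : ℕ} [hq : Fact q.Prime]

omit hq in
theorem mem_of_pow_card_eq_one_of_isCyclic [IsCyclic H] (N : Subgroup H) {g : H}
    (hg : g ^ Nat.card N = 1) : g ∈ N := by
  classical
  have := Fintype.ofFinite H
  have hsub : Finset.univ.filter (· ∈ N) ⊆ Finset.univ.filter fun g : H => g ^ Nat.card N = 1 :=
    fun g h => by
      rw [Finset.mem_filter] at h ⊢
      exact ⟨h.1, pow_eq_one_of_card_eq rfl h.2⟩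
  have heq := Finset.eq_of_subset_of_card_le hsub <|
    (IsCyclic.card_pow_eq_one_le Nat.card_pos).trans <| by
      rw [← Fintype.card_subtype, ← Nat.card_eq_fintype_card]
  have hmem : g ∈ Finset.univ.filter fun g : H => g ^ Nat.card N = 1 :=
    Finset.mem_filter.2 ⟨Finset.mem_univ g, hg⟩
  rw [← heq] at hmem
  exact (Finset.mem_filter.1 hmem).2

theorem exists_coprime_pow_eq_mul [IsCyclic H] (hH : IsPGroup q H) {N : Subgroup H}
    (hN : Nat.card N = q) {n h : H} (hn : n ∈ N) (hh : h ∉ N) :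
    ∃ m, q.Coprime m ∧ n * h = h ^ m := by
  have hNmem : ∀ g : H, g ^ q = 1 → g ∈ N := fun g hg =>
    mem_of_pow_card_eq_one_of_isCyclic N (hN.symm ▸ hg)
  obtain ⟨c, hc⟩ := hH.dvd_orderOf fun e : h ^ q = 1 => hh (hNmem h e)
  have hpow : ((h ^ q) ^ c) ^ q = 1 := by rw [← pow_mul, mul_comm c, ← hc, pow_orderOf_eq_one]
  have hne : (h ^ q) ^ c ≠ 1 := by
    refine pow_ne_one_of_lt_orderOf (fun e => ?_) ?_
    · exact (orderOf_pos (h ^ q)).ne' (by rw [hc, e, mul_zero])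
    · have hpos := orderOf_pos (h ^ q)
      rw [hc] at hpos ⊢
      exact lt_mul_of_one_lt_left (Nat.pos_of_mul_pos_left hpos) hq.out.one_lt
  obtain ⟨j, hj⟩ : (⟨n, hn⟩ : N) ∈ Submonoid.powers (⟨_, hNmem _ hpow⟩ : N) :=
    mem_powers_of_prime_card hN fun e => hne (congrArg Subtype.val e)
  have hj' : ((h ^ q) ^ c) ^ j = n := congrArg Subtype.val hj
  refine ⟨q * (c * j) + 1,
    (Nat.coprime_mul_left_add_right _ _ _).2 (Nat.coprime_one_right q), ?_⟩
  rw [← hj', pow_succ, ← pow_mul, ← pow_mul]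

end Cyclic

namespace RepRing

section Cyclic

variable {k : Type} [Field k] [CharZero k] {H : Type u} [Group H] [Finite H] {q : ℕ}
  [hq : Fact q.Prime]

theorem sum_char_mul_eq_zero {N : Subgroup H} [N.Normal] [Fintype N] {x : RepRing k H}
    (hx : avg N x = 0) (h : H) : ∑ n : N, char x (n * h) = 0 := by
  have hsum := char_avg N x h
  rw [hx, map_zero, Pi.zero_apply] at hsum
  exact (mul_eq_zero.1 hsum.symm).resolve_left
    (inv_ne_zero (Nat.cast_ne_zero.2 Nat.card_pos.ne'))

theorem char_eq_zero_of_notMem [IsCyclic H] (hH : IsPGroup q H) {N : Subgroup H} [N.Normal]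
    (hN : Nat.card N = q) {x : RepRing k H} (hx : PowInvariant q x) (hxN : avg N x = 0)
    {h : H} (hh : h ∉ N) : char x h = 0 := by
  have := Fintype.ofFinite N
  have hconst : ∀ n : N, char x (n * h) = char x h := fun n => by
    obtain ⟨m, hm, e⟩ := exists_coprime_pow_eq_mul hH hN n.2 hh
    rw [e, hx m hm]
  have hsum := sum_char_mul_eq_zero hxN h
  rw [Finset.sum_congr rfl fun n _ => hconst n, Finset.sum_const, Finset.card_univ,
    ← Nat.card_eq_fintype_card, hN, nsmul_eq_mul] at hsum
  exact (mul_eq_zero.1 hsum).resolve_left (Nat.cast_ne_zero.2 hq.out.ne_zero)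

theorem PowInvariant.char_eq_of_mem {N : Subgroup H} (hN : Nat.card N = q) {x : RepRing k H}
    (hx : PowInvariant q x) {g h : H} (hg : g ∈ N) (hg1 : g ≠ 1) (hh : h ∈ N) (hh1 : h ≠ 1) :
    char x h = char x g := by
  obtain ⟨m, hm⟩ : (⟨h, hh⟩ : N) ∈ Submonoid.powers (⟨g, hg⟩ : N) :=
    mem_powers_of_prime_card hN fun e => hg1 (congrArg Subtype.val e)
  obtain rfl : g ^ m = h := congrArg Subtype.val hm
  refine hx m ((Nat.Prime.coprime_iff_not_dvd hq.out).2 ?_) g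
  rintro ⟨c, rfl⟩
  exact hh1 (by rw [pow_mul, pow_eq_one_of_card_eq hN hg, one_pow])

open Classical in
theorem PowInvariant.char_eq_sub_ite {N : Subgroup H} [N.Normal] (hN : Nat.card N = q)
    {x : RepRing k H} (hx : PowInvariant q x) (hxN : RepRing.avg N x = 0) {g h : H} (hg : g ∈ N)
    (hg1 : g ≠ 1) (hh : h ∈ N) : char x h = char x g - if h = 1 then q * char x g else 0 := by
  have := Fintype.ofFinite N
  split_ifs with h1
  · subst h1
    have hsum := sum_char_mul_eq_zero hxN 1
    have hrest : ∑ n ∈ Finset.univ.erase (1 : N), char x (n * 1) = (q - 1 : ℕ) • char x g := by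
      rw [Finset.sum_congr rfl fun n hn => by
          rw [mul_one, hx.char_eq_of_mem hN hg hg1 n.2 fun e =>
            Finset.ne_of_mem_erase hn (Subtype.ext e)],
        Finset.sum_const, Finset.card_erase_of_mem (Finset.mem_univ _), Finset.card_univ,
        ← Nat.card_eq_fintype_card, hN]
    rw [← Finset.add_sum_erase _ _ (Finset.mem_univ 1), hrest, nsmul_eq_mul,
      Nat.cast_sub hq.out.one_le, Nat.cast_one, OneMemClass.coe_one, mul_one] at hsum
    linear_combination hsum
  · rw [hx.char_eq_of_mem hN hg hg1 hh h1, sub_zero]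

theorem exists_int_sum_char_mul (x : RepRing k H) {K : Type} [Field K] [CharZero K] [Algebra k K]
    [Fintype H] (χ : H →* K) :
    ∃ n : ℤ, ∑ h : H, algebraMap k K (char x h) * χ h = n * Nat.card H := by
  obtain ⟨n, hn⟩ := exists_int_char_pairing (baseChange K H x) χ
  exact ⟨n, by simpa only [char_baseChange] using hn⟩

theorem sum_char_mul_eq_neg [IsCyclic H] [Fintype H] (hH : IsPGroup q H) {N : Subgroup H}
    [N.Normal] (hN : Nat.card N = q) {x : RepRing k H} (hx : PowInvariant q x)
    (hxN : avg N x = 0) {g : H} (hg : g ∈ N) {K : Type} [Field K] [Algebra k K] {χ : H →* K}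
    (hχ : χ g ≠ 1) :
    ∑ h : H, algebraMap k K (char x h) * χ h = algebraMap k K (-(q * char x g)) := by
  classical
  have := Fintype.ofFinite N
  have hg1 : g ≠ 1 := fun e => hχ (by rw [e, map_one])
  have hsupp : ∑ n : N, algebraMap k K (char x n) * χ n =
      ∑ h : H, algebraMap k K (char x h) * χ h := by
    refine (Finset.sum_subtype (Finset.univ.filter (· ∈ N)) (by simp)
      fun h => algebraMap k K (char x h) * χ h).symm.trans ?_
    refine Finset.sum_subset (Finset.subset_univ _) fun h _ hh => ?_
    rw [char_eq_zero_of_notMem hH hN hx hxN (by simpa using hh), map_zero, zero_mul]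
  have hsum : ∑ n : N, χ n = 0 := sum_hom_units_eq_zero (χ.comp N.subtype) fun e =>
    hχ (DFunLike.congr_fun e (⟨g, hg⟩ : N))
  calc ∑ h : H, algebraMap k K (char x h) * χ h
      = ∑ n : N, (algebraMap k K (char x g) * χ n -
          if n = 1 then algebraMap k K (q * char x g) else 0) :=
        hsupp.symm.trans <| Finset.sum_congr rfl fun n _ => by
          rw [hx.char_eq_sub_ite hN hxN hg hg1 n.2, OneMemClass.coe_eq_one]
          split_ifs with h1
          · rw [h1, OneMemClass.coe_one, map_one, mul_one, mul_one, map_sub]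
          · rw [sub_zero, sub_zero]
    _ = algebraMap k K (-(q * char x g)) := by
        rw [Finset.sum_sub_distrib, ← Finset.mul_sum, hsum, mul_zero, Finset.sum_ite_eq',
          if_pos (Finset.mem_univ _), zero_sub, map_neg]

theorem exists_int_neg_char_eq [IsCyclic H] (hH : IsPGroup q H) {N : Subgroup H} [N.Normal]
    (hN : Nat.card N = q) {x : RepRing k H} (hx : PowInvariant q x) (hxN : avg N x = 0)
    {g : H} (hg : g ∈ N) (hg1 : g ≠ 1) : ∃ c : ℤ, -char x g = c * Nat.card (H ⧸ N) := by
  have := Fintype.ofFinite H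
  let _ : CommGroup H := IsCyclic.commGroup
  let K := AlgebraicClosure k
  obtain ⟨φ, hφ⟩ := CommGroup.exists_apply_ne_one_of_hasEnoughRootsOfUnity H K hg1
  let χ : H →* K := (Units.coeHom K).comp φ
  obtain ⟨c, hc⟩ := exists_int_sum_char_mul x χ
  rw [sum_char_mul_eq_neg hH hN hx hxN hg fun e : χ g = 1 => hφ (Units.ext e)] at hc
  have hcard : Nat.card H = Nat.card (H ⧸ N) * q := by
    rw [N.card_eq_card_quotient_mul_card_subgroup, hN]
  have hk : -(q * char x g) = c * (Nat.card (H ⧸ N) * q) := by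
    refine (algebraMap k K).injective ?_
    rw [hc, hcard, map_mul, map_mul, map_intCast, map_natCast, map_natCast, Nat.cast_mul]
  refine ⟨c, mul_right_cancel₀ (Nat.cast_ne_zero.2 hq.out.ne_zero : (q : k) ≠ 0) ?_⟩
  linear_combination hk

theorem mem_range_lin_of_isCyclic_of_avg_eq_zero [IsCyclic H] (hH : IsPGroup q H)
    {N : Subgroup H} [N.Normal] (hN : Nat.card N = q) {x : RepRing k H} (hx : PowInvariant q x)
    (hxN : avg N x = 0) : x ∈ (lin k H).range := by
  classical
  obtain ⟨g, hg, hg1⟩ := N.bot_or_exists_ne_one.resolve_left fun e =>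
    hq.out.ne_one (by rw [← hN, e, Subgroup.card_bot])
  obtain ⟨c, hc⟩ := exists_int_neg_char_eq hH hN hx hxN hg hg1
  let y : RepRing k H := lin k H (BurnsideRing.regular H) -
    pull (QuotientGroup.mk' N) (lin k (H ⧸ N) (BurnsideRing.regular (H ⧸ N)))
  have hy : y ∈ (lin k H).range := sub_mem ⟨_, rfl⟩ (pull_mem_range_lin _ ⟨_, rfl⟩)
  suffices hxy : x = c • y from hxy ▸ zsmul_mem hy c
  refine char_injective (funext fun h => ?_)
  have hcard : (Nat.card H : k) = Nat.card (H ⧸ N) * q := by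
    rw [N.card_eq_card_quotient_mul_card_subgroup, hN, Nat.cast_mul]
  rw [map_zsmul, Pi.smul_apply, map_sub, Pi.sub_apply, char_pull, char_lin_regular,
    char_lin_regular, zsmul_eq_mul, hcard]
  simp only [QuotientGroup.mk'_apply, QuotientGroup.eq_one_iff]
  by_cases hh : h ∈ N
  · rw [hx.char_eq_sub_ite hN hxN hg hg1 hh, if_pos hh]
    split_ifs
    · linear_combination ((q : k) - 1) * hc
    · linear_combination -hc
  · rw [char_eq_zero_of_notMem hH hN hx hxN hh, if_neg hh,
      if_neg fun e : h = 1 => hh (e ▸ N.one_mem), sub_zero, mul_zero]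

end Cyclic

end RepRing

section Lines

variable {H : Type u} [Group H] [Finite H] {q : ℕ} [hq : Fact q.Prime] {E : Subgroup H}

/-- The subgroups of order `q` of `E`; when `E` is elementary abelian, these are the lines of a
vector space over `ZMod q`. -/
abbrev Lines (q : ℕ) (E : Subgroup H) : Type u :=
  {L : Subgroup H // L ≤ E ∧ Nat.card L = q}

theorem sum_lines {M : Type*} [AddCommMonoid M] (hE : ∀ e ∈ E, e ^ q = 1) [Fintype E]
    [Fintype (Lines q E)] [∀ L : Lines q E, Fintype L.1] (F : H → M) (hF : F 1 = 0) :
    ∑ L : Lines q E, ∑ f : L.1, F f = ∑ f : E, F f := by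
  classical
  have := Fintype.ofFinite H
  have sum_subgroup (S : Subgroup H) [Fintype S] :
      ∑ f : S, F f = ∑ f : H, if f ∈ S then F f else 0 := by
    rw [← Finset.sum_filter]
    exact (Finset.sum_subtype (Finset.univ.filter (· ∈ S)) (by simp) F).symm
  simp only [sum_subgroup]
  rw [Finset.sum_comm]
  refine Finset.sum_congr rfl fun f _ => ?_
  by_cases hf1 : f = 1
  · simp only [hf1, hF, ite_self, Finset.sum_const_zero]
  by_cases hf : f ∈ E
  · have hcard : Nat.card (Subgroup.zpowers f) = q := card_zpowers_of_pow_eq_one (hE f hf) hf1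
    rw [if_pos hf, Finset.sum_eq_single ⟨Subgroup.zpowers f, Subgroup.zpowers_le.2 hf, hcard⟩,
      if_pos (Subgroup.mem_zpowers f)]
    · rintro ⟨L, hLE, hL⟩ _ hne
      refine if_neg fun hfL => hne (Subtype.ext (Subgroup.eq_of_le_of_card_ge ?_ ?_).symm)
      · exact Subgroup.zpowers_le.2 hfL
      · rw [hL, hcard]
    · exact fun h => absurd (Finset.mem_univ _) h
  · rw [if_neg hf]
    exact Finset.sum_eq_zero fun L _ => if_neg fun h => hf (L.2.1 h)

theorem card_lines (hcard : Nat.card E = q ^ 2) (hE : ∀ e ∈ E, e ^ q = 1) :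
    Nat.card (Lines q E) = q + 1 := by
  classical
  have := Fintype.ofFinite (Lines q E)
  have := Fintype.ofFinite H
  have sum_nontrivial (S : Subgroup H) :
      ∑ f : S, (if (f : H) = 1 then 0 else 1) = Nat.card S - 1 := by
    rw [Nat.card_eq_fintype_card, ← Finset.card_univ,
      ← Finset.card_erase_of_mem (Finset.mem_univ 1), Finset.card_eq_sum_ones]
    simp [Finset.sum_ite, Finset.filter_ne']
  have hsum := sum_lines hE (fun f => if f = 1 then 0 else 1) (if_pos rfl)
  simp only [sum_nontrivial, hcard] at hsum
  rw [Finset.sum_congr rfl fun L _ => by rw [L.2.2], Finset.sum_const, Finset.card_univ,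
    ← Nat.card_eq_fintype_card, smul_eq_mul, ← one_pow 2, Nat.sq_sub_sq, one_pow] at hsum
  exact Nat.eq_of_mul_eq_mul_right (Nat.sub_pos_of_lt hq.out.one_lt) hsum

end Lines

namespace RepRing

section CentralElementary

variable {k : Type} [Field k] [CharZero k] {H : Type u} [Group H] [Finite H] {q : ℕ}
  [hq : Fact q.Prime] {E : Subgroup H}

theorem eq_sum_avg_sub_nsmul_avg [E.Normal] [∀ L : Lines q E, L.1.Normal]
    [Fintype (Lines q E)] (hcard : Nat.card E = q ^ 2) (hexp : ∀ e ∈ E, e ^ q = 1)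
    (x : RepRing k H) : x = ∑ L : Lines q E, avg L.1 x - q • avg E x := by
  have := Fintype.ofFinite H
  classical
  refine char_injective (funext fun h => ?_)
  have hq0 : (q : k) ≠ 0 := Nat.cast_ne_zero.2 hq.out.ne_zero
  have hsum := sum_lines hexp (fun f => char x (f * h) - char x h) (by rw [one_mul, sub_self])
  have hlines : ∑ L : Lines q E, char (avg L.1 x) h =
      (q : k)⁻¹ * ∑ L : Lines q E, ∑ f : L.1, char x (f * h) := by
    rw [Finset.mul_sum]
    exact Finset.sum_congr rfl fun L _ => by rw [char_avg, L.2.2]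
  have hcL : ∀ L : Lines q E, Fintype.card L.1 = q := fun L => by
    rw [← Nat.card_eq_fintype_card, L.2.2]
  simp only [Finset.sum_sub_distrib, Finset.sum_const, Finset.card_univ, hcL,
    ← Nat.card_eq_fintype_card, hcard, card_lines hcard hexp, nsmul_eq_mul, Nat.cast_add,
    Nat.cast_pow, Nat.cast_one] at hsum
  rw [map_sub, map_sum, Pi.sub_apply, Finset.sum_apply, map_nsmul, Pi.smul_apply, char_avg, hlines,
    hcard, nsmul_eq_mul, Nat.cast_pow]
  field_simp
  linear_combination -hsum

theorem mem_range_lin_of_central (hE : E ≤ Subgroup.center H) (hcard : Nat.card E = q ^ 2)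
    (hexp : ∀ e ∈ E, e ^ q = 1) {x : RepRing k H}
    (hx : ∀ (N : Subgroup H) [N.Normal], N ≠ ⊥ → avg N x ∈ (lin k H).range) :
    x ∈ (lin k H).range := by
  have := normal_of_le_center hE
  have (L : Lines q E) : L.1.Normal := normal_of_le_center (L.2.1.trans hE)
  have := Fintype.ofFinite (Lines q E)
  rw [eq_sum_avg_sub_nsmul_avg hcard hexp x]
  refine sub_mem (sum_mem fun L _ => hx L.1 ?_) (nsmul_mem (hx E ?_) q)
  · exact L.1.one_lt_card_iff_ne_bot.1 (L.2.2.symm ▸ hq.out.one_lt)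
  · exact E.one_lt_card_iff_ne_bot.1 (hcard.symm ▸ Nat.one_lt_pow two_ne_zero hq.out.one_lt)

end CentralElementary

end RepRing

section Centralizers

variable {H : Type u} [Group H] {D Z : Subgroup H}

instance normal_subgroupOf_centralizer :
    (D.subgroupOf (Subgroup.centralizer (D : Set H))).Normal :=
  normal_of_le_center fun d hd => Subgroup.mem_center_iff.2 fun c =>
    Subtype.ext (Subgroup.mem_centralizer_iff.1 c.2 d (Subgroup.mem_subgroupOf.1 hd)).symm

theorem le_centralizer_of_card_prime (hp : (Nat.card D).Prime) :
    D ≤ Subgroup.centralizer (D : Set H) := by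
  have := Fact.mk hp
  have := isCyclic_of_prime_card (α := D) rfl
  exact fun d hd => Subgroup.mem_centralizer_iff.2 fun e he =>
    congrArg Subtype.val (mul_comm' (⟨e, he⟩ : D) ⟨d, hd⟩)

theorem le_of_mem_of_card_prime (hp : (Nat.card D).Prime) {S : Subgroup H} {d : H} (hd : d ∈ D)
    (hd1 : d ≠ 1) (hdS : d ∈ S) : D ≤ S := by
  have := Fact.mk hp
  intro e he
  obtain ⟨i, hi⟩ := (Submonoid.mem_powers_iff _ _).1
    (mem_powers_of_prime_card rfl fun h => hd1 (congrArg Subtype.val h) :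
      (⟨e, he⟩ : D) ∈ Submonoid.powers (⟨d, hd⟩ : D))
  rw [← show d ^ i = e from congrArg Subtype.val hi]
  exact pow_mem hdS i

open scoped commutatorElement

theorem card_eq_card_centralizer_mul (hZ : Z ≤ Subgroup.center H)
    (hcomm : ⁅(⊤ : Subgroup H), D⁆ ≤ Z) (hZp : (Nat.card Z).Prime) (hDp : (Nat.card D).Prime)
    (hD : ¬ D ≤ Subgroup.center H) :
    Nat.card H = Nat.card (Subgroup.centralizer (D : Set H)) * Nat.card Z := by
  obtain ⟨d, hd, hdc⟩ := SetLike.not_le_iff_exists.1 hD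
  have hd1 : d ≠ 1 := fun e => hdc (e ▸ one_mem _)
  have hdZ (x : H) : ⁅MonoidHom.id H x, d⁆ ∈ Z :=
    hcomm (Subgroup.commutator_mem_commutator (Subgroup.mem_top x) hd)
  obtain ⟨y, hy⟩ : ∃ y, y * d ≠ d * y := by
    by_contra! h
    exact hdc (Subgroup.mem_center_iff.2 h)
  have hker : (commutatorHom hZ _ d hdZ).ker = Subgroup.centralizer (D : Set H) := by
    ext c
    refine (mem_ker_commutatorHom hZ hdZ).trans
      ⟨fun hcd => Subgroup.mem_centralizer_iff.2 fun e he => ?_,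
        fun hc => (Subgroup.mem_centralizer_iff.1 hc d hd).symm⟩
    have hle : D ≤ Subgroup.centralizer {c} :=
      le_of_mem_of_card_prime hDp hd hd1 (Subgroup.mem_centralizer_singleton_iff.2 hcd.symm)
    exact Subgroup.mem_centralizer_singleton_iff.1 (hle he)
  rw [← hker, ← (commutatorHom hZ _ d hdZ).ker.card_mul_index, Subgroup.index_ker,
    MonoidHom.range_eq_top.2 (commutatorHom_surjective hZ hdZ hZp hy), Subgroup.card_top]

end Centralizers

namespace RepRing

section NoncentralElementary

open scoped commutatorElement

variable {k : Type} [Field k] [CharZero k] {H : Type u} [Group H] [Finite H] {D Z : Subgroup H}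

/-- Restriction to the centralizer `C` of `D`, followed by the projection to the representations of
`C` with trivial action of `D`, followed by induction back to the whole group. -/
noncomputable def centralizerInd (D : Subgroup H) (x : RepRing k H) : RepRing k H :=
  ind (Subgroup.centralizer (D : Set H)).subtype
    (avg (D.subgroupOf (Subgroup.centralizer (D : Set H)))
      (pull (Subgroup.centralizer (D : Set H)).subtype x))

theorem char_centralizerInd_of_mem [Fintype H] [Fintype D]
    [hC : (Subgroup.centralizer (D : Set H)).Normal] (hD : D ≤ Subgroup.centralizer (D : Set H))
    (x : RepRing k H) {h : H} (hh : h ∈ Subgroup.centralizer (D : Set H)) :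
    char (centralizerInd D x) h =
      (Nat.card (Subgroup.centralizer (D : Set H)) : k)⁻¹ * ((Nat.card D : k)⁻¹ *
        ∑ d : D, ∑ t : H, char x (d * (t * h * t⁻¹))) := by
  have := Fintype.ofFinite (D.subgroupOf (Subgroup.centralizer (D : Set H)))
  rw [centralizerInd, char_ind]
  refine (indChar_subtype_of_normal _ _ ⟨h, hh⟩).trans ?_
  rw [Finset.sum_comm, Finset.mul_sum (a := (Nat.card D : k)⁻¹)]
  refine congrArg _ (Finset.sum_congr rfl fun t _ => ?_)
  rw [char_avg, Nat.card_congr (Subgroup.subgroupOfEquivOfLe hD).toEquiv]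
  refine congrArg _ (Fintype.sum_equiv (Subgroup.subgroupOfEquivOfLe hD).toEquiv _ _ fun d => ?_)
  rw [char_pull]
  rfl

theorem char_centralizerInd_of_notMem [(Subgroup.centralizer (D : Set H)).Normal]
    (x : RepRing k H) {h : H} (hh : h ∉ Subgroup.centralizer (D : Set H)) :
    char (centralizerInd D x) h = 0 := by
  rw [centralizerInd, char_ind, indChar_subtype_of_notMem _ _ hh]

variable (hZ : Z ≤ Subgroup.center H) (hcomm : ⁅(⊤ : Subgroup H), D⁆ ≤ Z)
  (hZp : (Nat.card Z).Prime)
include hZ hcomm hZp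

theorem sum_char_mul_conj_mul [Fintype H] (x : RepRing k H) {d z : H} (hd : d ∈ D)
    (hdc : d ∉ Subgroup.center H) (hz : z ∈ Z) (h : H) :
    ∑ t : H, char x (d * (t * (z * h) * t⁻¹)) = ∑ t : H, char x (d * (t * h * t⁻¹)) := by
  have hdZ (x : H) : ⁅MonoidHom.id H x, d⁆ ∈ Z :=
    hcomm (Subgroup.commutator_mem_commutator (Subgroup.mem_top x) hd)
  obtain ⟨c, hc⟩ : ∃ c, c * d ≠ d * c := by
    by_contra! hcd
    exact hdc (Subgroup.mem_center_iff.2 hcd)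
  obtain ⟨y, hy : y * d * y⁻¹ = z * d⟩ := exists_conj_eq_mul hZ hdZ hZp hc hz
  have hzc := Subgroup.mem_center_iff.1 (hZ hz)
  refine Fintype.sum_equiv (Equiv.mulLeft y⁻¹) _ _ fun t => ?_
  refine (congrArg (char x) ?_).trans (char_conj x _ y)
  calc d * (t * (z * h) * t⁻¹) = d * (t * z) * h * t⁻¹ := by group
    _ = d * z * (t * h * t⁻¹) := by rw [hzc t]; group
    _ = y * d * y⁻¹ * (t * h * t⁻¹) := by rw [hzc d, hy]
    _ = y * (d * (y⁻¹ * t * h * (y⁻¹ * t)⁻¹)) * y⁻¹ := by group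

theorem char_mul_eq_of_notMem_centralizer (x : RepRing k H) {z h : H} (hz : z ∈ Z)
    (hh : h ∉ Subgroup.centralizer (D : Set H)) : char x (z * h) = char x h := by
  obtain ⟨d, hd, hdh⟩ : ∃ d ∈ D, d * h ≠ h * d := by
    by_contra! hdh
    exact hh (Subgroup.mem_centralizer_iff.2 hdh)
  have hhZ (e : D) : ⁅D.subtype e, h⁆ ∈ Z := (Subgroup.commutator_comm ⊤ D ▸ hcomm)
    (Subgroup.commutator_mem_commutator e.2 (Subgroup.mem_top h))
  obtain ⟨e, he⟩ := exists_conj_eq_mul hZ hhZ hZp (x := ⟨d, hd⟩) hdh hz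
  rw [← he, char_conj]

variable (hDp : (Nat.card D).Prime) (hD : ¬ D ≤ Subgroup.center H)
include hDp hD

theorem sum_sum_char_mul_conj_mul_sub [Fintype H] [Fintype D] (x : RepRing k H) {z : H}
    (hz : z ∈ Z) (h : H) :
    ∑ d : D, ∑ t : H, char x (d * (t * (z * h) * t⁻¹)) -
      ∑ d : D, ∑ t : H, char x (d * (t * h * t⁻¹)) =
      Nat.card H * (char x (z * h) - char x h) := by
  rw [← Finset.sum_sub_distrib, Finset.sum_eq_single 1]
  · simp only [OneMemClass.coe_one, one_mul, char_conj, Finset.sum_const, Finset.card_univ,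
      Nat.card_eq_fintype_card, nsmul_eq_mul, mul_sub]
  · intro d _ hd
    rw [sum_char_mul_conj_mul hZ hcomm hZp x d.2 (fun hdc => hD ?_) hz, sub_self]
    exact le_of_mem_of_card_prime hDp d.2 (fun e => hd (Subtype.ext e)) hdc
  · exact fun h1 => absurd (Finset.mem_univ _) h1

theorem char_sub_centralizerInd_mul (hcard : Nat.card D = Nat.card Z) (x : RepRing k H) {z : H}
    (hz : z ∈ Z) (h : H) :
    char (x - centralizerInd D x) (z * h) = char (x - centralizerInd D x) h := by
  have := Fintype.ofFinite H
  have := Fintype.ofFinite D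
  have := centralizer_normal_of_commutator_le hZ hcomm
  have hzC : z ∈ Subgroup.centralizer (D : Set H) := Subgroup.center_le_centralizer _ (hZ hz)
  rw [map_sub, Pi.sub_apply, Pi.sub_apply]
  by_cases hh : h ∈ Subgroup.centralizer (D : Set H)
  · have hle := le_centralizer_of_card_prime hDp
    rw [char_centralizerInd_of_mem hle x hh, char_centralizerInd_of_mem hle x (mul_mem hzC hh)]
    have hdiff := sum_sum_char_mul_conj_mul_sub hZ hcomm hZp hDp hD x hz h
    have hC0 : (Nat.card (Subgroup.centralizer (D : Set H)) : k) ≠ 0 :=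
      Nat.cast_ne_zero.2 Nat.card_pos.ne'
    have hD0 : (Nat.card D : k) ≠ 0 := Nat.cast_ne_zero.2 Nat.card_pos.ne'
    rw [card_eq_card_centralizer_mul hZ hcomm hZp hDp hD, ← hcard, Nat.cast_mul] at hdiff
    field_simp
    linear_combination -hdiff
  · have hzh : z * h ∉ Subgroup.centralizer (D : Set H) := fun h' =>
      hh ((Subgroup.mul_mem_cancel_left _ hzC).1 h')
    rw [char_centralizerInd_of_notMem x hh, char_centralizerInd_of_notMem x hzh,
      char_mul_eq_of_notMem_centralizer hZ hcomm hZp x hz hh]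

theorem centralizerInd_add_avg [Z.Normal] (hcard : Nat.card D = Nat.card Z) (x : RepRing k H) :
    centralizerInd D x + avg Z (x - centralizerInd D x) = x := by
  rw [avg_eq_self fun z hz h => char_sub_centralizerInd_mul hZ hcomm hZp hDp hD hcard x hz h,
    add_sub_cancel]

end NoncentralElementary

end RepRing

namespace RepRing

section RitterSegal

open scoped commutatorElement

variable {k : Type} [Field k] [CharZero k] {H : Type u} [Group H] [Finite H] {q : ℕ}
  [hq : Fact q.Prime]

theorem PowInvariant.mem_range_lin_of_isCyclic [IsCyclic H] (hH : IsPGroup q H)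
    {x : RepRing k H} (hx : PowInvariant q x)
    (havg : ∀ (N : Subgroup H) [N.Normal], N ≠ ⊥ → RepRing.avg N x ∈ (lin k H).range) :
    x ∈ (lin k H).range := by
  rcases subsingleton_or_nontrivial H with _ | _
  · exact mem_range_lin_of_subsingleton x
  obtain ⟨N, -, hNc, hN⟩ := exists_le_center_card_eq hH (⊤ : Subgroup H) top_ne_bot
  have := normal_of_le_center hNc
  have hsub := mem_range_lin_of_isCyclic_of_avg_eq_zero hH hN (hx.sub (hx.avg hH N))
    (by rw [map_sub, avg_avg, sub_self])
  have hN1 : N ≠ ⊥ := N.one_lt_card_iff_ne_bot.1 (hN.symm ▸ hq.out.one_lt)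
  simpa only [sub_add_cancel] using add_mem hsub (havg N hN1)

theorem PowInvariant.mem_range_lin_of_commutator_le (hH : IsPGroup q H) {Z D : Subgroup H}
    (hZ : Z ≤ Subgroup.center H) (hcomm : ⁅(⊤ : Subgroup H), D⁆ ≤ Z) (hZq : Nat.card Z = q)
    (hDq : Nat.card D = q) (hD : ¬ D ≤ Subgroup.center H) {x : RepRing k H}
    (hx : PowInvariant q x)
    (hC : ∀ y : RepRing k (Subgroup.centralizer (D : Set H)), PowInvariant q y →
      y ∈ (lin k (Subgroup.centralizer (D : Set H))).range)
    (havg : ∀ (N : Subgroup H) [N.Normal], N ≠ ⊥ → ∀ y : RepRing k H, PowInvariant q y →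
      RepRing.avg N y ∈ (lin k H).range) :
    x ∈ (lin k H).range := by
  have := normal_of_le_center hZ
  have hZp : (Nat.card Z).Prime := hZq.symm ▸ hq.out
  have hCq := hH.to_subgroup (Subgroup.centralizer (D : Set H))
  have hy : PowInvariant q (RepRing.avg (D.subgroupOf (Subgroup.centralizer (D : Set H)))
      (RepRing.pull (Subgroup.centralizer (D : Set H)).subtype x)) := (hx.pull _).avg hCq _
  have hind : PowInvariant q (centralizerInd D x) :=
    hy.ind hH hCq (Subgroup.centralizer (D : Set H)).subtype
  rw [← centralizerInd_add_avg hZ hcomm hZp (hDq.symm ▸ hq.out) hD (hDq.trans hZq.symm) x]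
  exact add_mem (ind_mem_range_lin (Subgroup.subtype_injective _) (hC _ hy))
    (havg Z (Z.one_lt_card_iff_ne_bot.1 hZp.one_lt) _ (hx.sub hind))

theorem PowInvariant.mem_range_lin (hodd : Odd q) (hH : IsPGroup q H) {x : RepRing k H}
    (hx : PowInvariant q x) : x ∈ (lin k H).range := by
  induction hn : Nat.card H using Nat.strong_induction_on generalizing H with
  | _ n ih =>
  subst hn
  have havg (N : Subgroup H) [N.Normal] (hN : N ≠ ⊥) (y : RepRing k H) (hy : PowInvariant q y) :
      RepRing.avg N y ∈ (lin k H).range :=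
    pull_mem_range_lin _ (ih _ (card_quotient_lt hN) (hH.to_quotient N)
      (hy.ind (hH.to_quotient N) hH _) rfl)
  by_cases hcyc : IsCyclic H
  · exact hx.mem_range_lin_of_isCyclic hH fun N _ hN => havg N hN x hx
  obtain ⟨E, hE, hcard, hexp⟩ | ⟨Z, hZ, D, hD, hcomm, hZq, hDq⟩ :=
    exists_central_card_sq_or_exists_commutator_le hodd hH hcyc
  · exact mem_range_lin_of_central hE hcard hexp fun N _ hN => havg N hN x hx
  · refine hx.mem_range_lin_of_commutator_le hH hZ hcomm hZq hDq hD (fun y hy => ?_) havg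
    refine ih _ ?_ (hH.to_subgroup _) hy rfl
    rw [card_eq_card_centralizer_mul hZ hcomm (hZq.symm ▸ hq.out) (hDq.symm ▸ hq.out) hD, hZq]
    exact lt_mul_of_one_lt_right Nat.card_pos hq.out.one_lt

end RitterSegal

end RepRing

section RootsOfUnity

open Polynomial in
theorem sum_pow_eq_of_coprime {K : Type*} [Field K] [CharZero K] {N n : ℕ} [NeZero N] {ζ : K}
    (hζ : IsPrimitiveRoot ζ N) (hn : n.Coprime N) {ι : Type*} [Fintype ι] {μ : ι → K}
    (hμ : ∀ i, μ i ^ N = 1) {c : ℚ} (hc : ∑ i, μ i = c) : ∑ i, μ i ^ n = c := by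
  choose a _ ha using fun i => hζ.eq_pow_of_pow_eq_one (hμ i)
  let P : ℚ[X] := ∑ i, X ^ a i - C c
  have heval (w : K) : aeval w P = ∑ i, w ^ a i - c := by simp [P]
  have hroot : aeval ζ P = 0 := by rw [heval, Finset.sum_congr rfl fun i _ => ha i, hc, sub_self]
  have hconj : minpoly ℚ ζ = minpoly ℚ (ζ ^ n) := by
    rw [← cyclotomic_eq_minpoly_rat hζ (NeZero.pos N),
      ← cyclotomic_eq_minpoly_rat (hζ.pow_of_coprime n hn) (NeZero.pos N)]
  have hroot' : aeval (ζ ^ n) P = 0 :=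
    aeval_eq_zero_of_dvd_aeval_eq_zero (hconj ▸ minpoly.dvd ℚ ζ hroot) (minpoly.aeval ℚ _)
  rw [heval, sub_eq_zero] at hroot'
  rw [← hroot']
  exact Finset.sum_congr rfl fun i _ => by rw [← ha i, pow_right_comm]

theorem exists_character_pow_eq_sum_pow {H : Type u} [Group H] [Finite H] (V : FinRep ℂ H)
    (h : H) : ∃ (d : ℕ) (μ : Fin d → ℂ), (∀ i, μ i ^ Monoid.exponent H = 1) ∧
      ∀ m, V.ρ.character (h ^ m) = ∑ i, μ i ^ m := by
  have hN : V.ρ h ^ Monoid.exponent H = 1 := by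
    rw [← map_pow, Monoid.pow_exponent_eq_one, map_one]
  obtain ⟨d, b, μ, hμ⟩ := Representation.exists_eigenbasis (V.ρ h) _
    Monoid.exponent_ne_zero_of_finite hN
  refine ⟨d, μ, fun i => ?_, fun m => ?_⟩
  · have hvec : End.HasEigenvector (V.ρ h) (μ i) (b i) :=
      ⟨End.mem_eigenspace_iff.2 (hμ i), b.ne_zero i⟩
    have hpow := hvec.pow_apply (Monoid.exponent H)
    rw [hN, End.one_apply] at hpow
    exact smul_left_injective ℂ (b.ne_zero i) (by simpa only [one_smul] using hpow.symm)
  · rw [Representation.character, map_pow, Representation.trace_pow_eq_psum b _ μ hμ,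
      MvPolynomial.psum, map_sum]
    simp only [map_pow, MvPolynomial.aeval_X]

end RootsOfUnity

namespace IsPrimitiveRootMod

theorem of_dvd {ℓ m n : ℕ} [NeZero m] (hℓ : IsPrimitiveRootMod ℓ m) (h : n ∣ m) :
    IsPrimitiveRootMod ℓ n := by
  obtain ⟨u, hu, hgen⟩ := hℓ
  refine ⟨ZMod.unitsMap h u, ?_, fun v => ?_⟩
  · rw [ZMod.unitsMap_val, hu, ZMod.cast_natCast h]
  · obtain ⟨w, rfl⟩ := ZMod.unitsMap_surjective h v
    obtain ⟨j, rfl⟩ := hgen w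
    exact ⟨j, (map_zpow _ _ _).symm⟩

theorem exists_pow_modEq {ℓ n m : ℕ} [NeZero n] (hℓ : IsPrimitiveRootMod ℓ n)
    (hm : n.Coprime m) : ∃ j, ℓ ^ j ≡ m [MOD n] := by
  obtain ⟨u, hu, hgen⟩ := hℓ
  obtain ⟨j, hj⟩ := (Submonoid.mem_powers_iff _ _).1 <|
    mem_powers_iff_mem_zpowers.2 (hgen (ZMod.unitOfCoprime m hm.symm))
  refine ⟨j, (ZMod.natCast_eq_natCast_iff _ _ _).1 ?_⟩
  rw [Nat.cast_pow, ← hu, ← Units.val_pow_eq_pow_val, hj, ZMod.coe_unitOfCoprime]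

theorem coprime_natCard {H : Type*} [Group H] [Finite H] {ℓ : ℕ}
    (hℓ : IsPrimitiveRootMod ℓ (Monoid.exponent H)) : (Nat.card H).Coprime ℓ := by
  refine Nat.Coprime.symm (Nat.coprime_of_dvd fun p hp hpℓ hpH => ?_)
  have := Fact.mk hp
  obtain ⟨h, hh⟩ := exists_prime_orderOf_dvd_card' p hpH
  exact hp.not_dvd_one (hℓ.coprime ▸ Nat.dvd_gcd (hh ▸ Monoid.order_dvd_exponent h) hpℓ)

end IsPrimitiveRootMod

namespace RepRing

section RationalCharacters

variable {H : Type u} [Group H] [Finite H]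

theorem PowInvariant.of_rat (x : RepRing ℚ H) : PowInvariant (Monoid.exponent H) x := by
  intro n hn h
  have : NeZero (Monoid.exponent H) := ⟨Monoid.exponent_ne_zero_of_finite⟩
  have hrep (V : FinRep ℚ H) : V.ρ.character (h ^ n) = V.ρ.character h := by
    obtain ⟨d, μ, hμ, hpow⟩ := exists_character_pow_eq_sum_pow (V.baseChange ℂ) h
    simp only [RepSemiring.char_baseChange_aux] at hpow
    refine (algebraMap ℚ ℂ).injective ?_
    rw [hpow]
    exact sum_pow_eq_of_coprime (Complex.isPrimitiveRoot_exp _ (NeZero.ne _)) hn.symm hμ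
      (by simpa only [pow_one, eq_ratCast] using (hpow 1).symm)
  obtain ⟨a, b, rfl⟩ := exists_sub x
  obtain ⟨V, rfl⟩ := RepSemiring.exists_mk a
  obtain ⟨W, rfl⟩ := RepSemiring.exists_mk b
  simp only [map_sub, char_of, Pi.sub_apply, RepSemiring.char_mk, hrep]

theorem lin_rat_surjective {q : ℕ} [Fact q.Prime] (hodd : Odd q) (hH : IsPGroup q H) :
    Function.Surjective (lin ℚ H) :=
  fun x => ((PowInvariant.of_rat x).of_exponent hH).mem_range_lin hodd hH

section BaseChange

variable {k k' : Type} [Field k] [CharZero k] [Field k'] [CharZero k'] [Algebra k k']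

theorem baseChange_injective : Function.Injective (baseChange (k := k) k' H) := by
  intro x y hxy
  refine char_injective (funext fun h => (algebraMap k k').injective ?_)
  rw [← char_baseChange k', ← char_baseChange k', hxy]

theorem baseChange_lin (x : BurnsideRing H) : baseChange k' H (lin k H x) = lin k' H x := by
  refine char_injective (funext fun h => ?_)
  obtain ⟨a, b, rfl⟩ := exists_sub x
  obtain ⟨X, rfl⟩ := BurnsideSemiring.exists_mk a
  obtain ⟨Y, rfl⟩ := BurnsideSemiring.exists_mk b
  rw [char_baseChange]
  simp only [map_sub, lin, mapRing_of, char_of, Pi.sub_apply, RepSemiring.char_lin, map_natCast]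

variable (k k') in
theorem lin_eq_zero_iff (x : BurnsideRing H) : lin k H x = 0 ↔ lin k' H x = 0 := by
  rw [← baseChange_lin (k := k) (k' := k'), map_eq_zero_iff _ baseChange_injective]

end BaseChange

theorem adams_baseChange {n : ℕ} (hn : (Monoid.exponent H).Coprime n) (x : RepRing ℚ H) :
    adams n H (baseChange ℂ H x) = baseChange ℂ H x := by
  refine char_injective (funext fun h => ?_)
  rw [char_adams, char_baseChange, char_baseChange, PowInvariant.of_rat x n hn]

theorem PowInvariant.of_adams_eq {ℓ : ℕ} (hℓ : IsPrimitiveRootMod ℓ (Monoid.exponent H))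
    {x : RepRing ℂ H} (hx : adams ℓ H x = x) : PowInvariant (Monoid.exponent H) x := by
  intro n hn h
  have : NeZero (Monoid.exponent H) := ⟨Monoid.exponent_ne_zero_of_finite⟩
  have hpow (j : ℕ) : char x (h ^ ℓ ^ j) = char x h := by
    induction j with
    | zero => rw [pow_zero, pow_one]
    | succ j ih => rw [pow_succ, pow_mul, ← char_adams, hx, ih]
  obtain ⟨j, hj⟩ := hℓ.exists_pow_modEq hn
  rw [← pow_eq_pow_iff_modEq.2 (hj.of_dvd (Monoid.order_dvd_exponent h)), hpow]

theorem exists_baseChange_eq_of_adams_eq {q : ℕ} [Fact q.Prime] (hodd : Odd q)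
    (hH : IsPGroup q H) {ℓ : ℕ} (hℓ : IsPrimitiveRootMod ℓ (Monoid.exponent H)) {x : RepRing ℂ H}
    (hx : adams ℓ H x = x) : ∃ y : RepRing ℚ H, baseChange ℂ H y = x := by
  obtain ⟨a, rfl⟩ := ((PowInvariant.of_adams_eq hℓ hx).of_exponent hH).mem_range_lin hodd hH
  exact ⟨lin ℚ H a, baseChange_lin a⟩

end RationalCharacters

end RepRing

namespace GreenFunctor

variable {G : Type u} [Group G] {M N : GreenFunctor.{u, v} G}

/-- A morphism of Green functors that is bijective at every subgroup, as an isomorphism. -/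
noncomputable def Iso.ofBijective (f : Hom M N) (hf : ∀ H, Function.Bijective (f.app H)) :
    Iso M N where
  app H := RingEquiv.ofBijective (f.app H) (hf H)
  app_res := f.app_res
  app_tr := f.app_tr
  app_conj := f.app_conj

/-- The morphism on a quotient induced by a morphism that vanishes on the ideal. -/
def quotientLift (I : GreenIdeal M) (f : Hom M N) (hf : ∀ H, ∀ x ∈ I.ideal H, f.app H x = 0) :
    Hom (M.quotient I) N where
  app H := Ideal.Quotient.lift (I.ideal H) (f.app H) (hf H)
  app_res h x := by
    obtain ⟨x, rfl⟩ := Ideal.Quotient.mk_surjective x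
    exact f.app_res h x
  app_tr h x := by
    obtain ⟨x, rfl⟩ := Ideal.Quotient.mk_surjective x
    exact f.app_tr h x
  app_conj g _ _ e x := by
    obtain ⟨x, rfl⟩ := Ideal.Quotient.mk_surjective x
    exact f.app_conj g e x

theorem quotientLift_bijective (I : GreenIdeal M) (f : Hom M N)
    (hf : ∀ H, ∀ x, x ∈ I.ideal H ↔ f.app H x = 0)
    (hsurj : ∀ H, Function.Surjective (f.app H)) (H : Subgroup G) :
    Function.Bijective ((quotientLift I f fun H x => (hf H x).1).app H) := by
  refine ⟨(injective_iff_map_eq_zero _).2 fun x hx => ?_,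
    Ideal.Quotient.lift_surjective_of_surjective _ _ (hsurj H)⟩
  obtain ⟨x, rfl⟩ := Ideal.Quotient.mk_surjective x
  exact Ideal.Quotient.eq_zero_iff_mem.2 ((hf H x).2 hx)

/-- A morphism with values fixed by `f`, as a morphism to the kernel of `f - 1`. -/
def kerSubOneLift (f : Hom N N) (g : Hom M N) (hg : ∀ H x, f.app H (g.app H x) = g.app H x) :
    Hom M (kerSubOne f) where
  app H := (g.app H).codRestrict (kerSubOneRing f H) fun x =>
    (mem_kerSubOneRing f H _).2 (hg H x)
  app_res h x := Subtype.ext (g.app_res h x)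
  app_tr h x := Subtype.ext (g.app_tr h x)
  app_conj a _ _ e x := Subtype.ext (g.app_conj a e x)

theorem kerSubOneLift_bijective (f : Hom N N) (g : Hom M N)
    (hg : ∀ H x, f.app H (g.app H x) = g.app H x) (hinj : ∀ H, Function.Injective (g.app H))
    (hsurj : ∀ H x, f.app H x = x → ∃ y, g.app H y = x) (H : Subgroup G) :
    Function.Bijective ((kerSubOneLift f g hg).app H) := by
  refine ⟨fun x y hxy => hinj H (congrArg Subtype.val hxy), fun ⟨x, hx⟩ => ?_⟩
  obtain ⟨y, hy⟩ := hsurj H x ((mem_kerSubOneRing f H x).1 hx)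
  exact ⟨y, Subtype.ext hy⟩

end GreenFunctor

theorem mainTheorem7_general {G : Type u} [Group G] [Finite G] (q : ℕ) (hq : q.Prime)
    (hodd : Odd q) (hG : IsPGroup q G) (ℓ : ℕ) (hℓ : IsPrimitiveRootMod ℓ (Monoid.exponent G)) :
    ∃ (e₁ : GreenFunctor.Iso ((burnsideGreen G).quotient (linHom ℂ G).ker) (repGreen ℚ G))
      (e₂ : GreenFunctor.Iso (repGreen ℚ G)
        (GreenFunctor.kerSubOne (adamsHom G ℓ hℓ.coprime_natCard))),
      (∀ (H : Subgroup G) (x : (burnsideGreen G).obj H),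
        e₁.app H (((burnsideGreen G).quotientMk (linHom ℂ G).ker).app H x) =
          (linHom ℚ G).app H x) ∧
      (∀ (H : Subgroup G) (x : (repGreen ℚ G).obj H),
        (GreenFunctor.kerSubOneIncl (adamsHom G ℓ hℓ.coprime_natCard)).app H (e₂.app H x) =
          (baseChangeHom ℚ ℂ G).app H x) := by
  have := Fact.mk hq
  have : NeZero (Monoid.exponent G) := ⟨Monoid.exponent_ne_zero_of_finite⟩
  have hℓH (H : Subgroup G) : IsPrimitiveRootMod ℓ (Monoid.exponent H) :=
    hℓ.of_dvd (Monoid.exponent_dvd_of_monoidHom H.subtype H.subtype_injective)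
  have hlin := GreenFunctor.quotientLift_bijective (linHom ℂ G).ker (linHom ℚ G)
    (fun H x => (RepRing.lin_eq_zero_iff ℚ ℂ x).symm)
    fun H => RepRing.lin_rat_surjective hodd (hG.to_subgroup H)
  have hbase := GreenFunctor.kerSubOneLift_bijective (adamsHom G ℓ hℓ.coprime_natCard)
    (baseChangeHom ℚ ℂ G) (fun H => RepRing.adams_baseChange (hℓH H).coprime)
    (fun _ => RepRing.baseChange_injective) fun H _ =>
      RepRing.exists_baseChange_eq_of_adams_eq hodd (hG.to_subgroup H) (hℓH H)
  exact ⟨.ofBijective _ hlin, .ofBijective _ hbase, fun _ _ => rfl, fun _ _ => rfl⟩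

theorem mainTheorem7 {G : Type u} [Group G] [Finite G] (q : ℕ) (hq : q.Prime) (hodd : Odd q)
    (hG : IsPGroup q G) (ℓ : ℕ) (hℓ : IsPrimitiveRootMod ℓ (Nat.card G)) :
    ∃ (e₁ : GreenFunctor.Iso ((burnsideGreen G).quotient (linHom ℂ G).ker) (repGreen ℚ G))
      (e₂ : GreenFunctor.Iso (repGreen ℚ G)
        (GreenFunctor.kerSubOne (adamsHom G ℓ hℓ.coprime))),
      (∀ (H : Subgroup G) (x : (burnsideGreen G).obj H),
        e₁.app H (((burnsideGreen G).quotientMk (linHom ℂ G).ker).app H x) =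
          (linHom ℚ G).app H x) ∧
      (∀ (H : Subgroup G) (x : (repGreen ℚ G).obj H),
        (GreenFunctor.kerSubOneIncl (adamsHom G ℓ hℓ.coprime)).app H (e₂.app H x) =
          (baseChangeHom ℚ ℂ G).app H x) :=
  mainTheorem7_general q hq hodd hG ℓ (hℓ.of_dvd Group.exponent_dvd_nat_card)
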